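/- Let $(N,g)$ be a smooth Riemannian manifold of dimension $n\ge 3$. For a closed surface $M$ (smooth, compact, connected, without boundary) and a smooth immersion $x:M\to N$ let $I=x^*g$ be the induced metric, with Gauss curvature $K$ and area measure $dM$; let $II(u,v)=(\nabla_u\,dx(v))^{\perp}$ be the second fundamental form, where $\nabla$ is the Levi-Civita connection of $g$ and $\perp$ denotes the component normal to $dx(TM)$; let $\vec H=\frac12\operatorname{tr}_I II$ be the mean curvature vector, and let $\tilde K(p)$ be the sectional curvature of $N$ along the plane $dx(T_pM)$. The Willmore functional is $$W(x)=\int_M\left(|\vec H|^2-K+\tilde K\right)dM .$$ The immersion $x$ is called totally umbilic if $II=\vec H\, I$ on $M$, and totally geodesic if $II\equiv 0$. A torus is a surface $T^2$ diffeomorphic to $S^1\times S^1$. **Theorem 3.1.** (i) For every immersed torus $x:T^2\to N$ the integrand of $W(x)$ is integrable and $W(x)\ge 0$; moreover $W(x)=0$ if and only if $x$ is totally umbilic. (ii) Assume that $N$ has positive sectional curvature. Then no immersion $x:M\to N$ of a closed orientable surface $M$ of genus $\gamma\ge 1$ is totally umbilic. In particular $W(x)>0$ for every immersed torus $x:T^2\to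 N$. (iii) Assume that $N$ has nonnegative sectional curvature. Then every totally umbilic immersed torus $x:T^2\to N$ is flat (that is, $K\equiv 0$) and totally geodesic. Here a closed orientable surface has genus $\gamma$ if its Euler characteristic $V-E+F$, computed from a smooth triangulation, equals $2-2\gamma$. -/

import Mathlib

open scoped Manifold ContDiff Topology

noncomputable section

namespace Willmore

universe u v

/-- The Euclidean model space of an `m`-dimensional manifold. -/
abbrev Euc (m : ℕ) : Type := EuclideanSpace ℝ (Fin m)

/-- The standard basis vectors of the model space. -/
abbrev stdVec {m : ℕ} (i : Fin m) : Euc m := EuclideanSpace.single i (1 : ℝ)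

/-! ### Riemannian geometry of a metric on an open set of `ℝᵐ` -/

section Coordinates

variable {m : ℕ}

/-- The matrix `g_ij(y)` of a field of bilinear forms. -/
def gram (G : Euc m → Euc m →L[ℝ] Euc m →L[ℝ] ℝ) (y : Euc m) : Matrix (Fin m) (Fin m) ℝ :=
  Matrix.of fun i j => G y (stdVec i) (stdVec j)

/-- The Christoffel symbols of the Levi-Civita connection, as a vector-valued bilinear expression:
`Γ_y(u, v)^k = ½ ∑_l g^{kl} (∂_u g(v, e_l) + ∂_v g(u, e_l) - ∂_l g(u, v))`. -/
def christoffel (G : Euc m → Euc m →L[ℝ] Euc m →L[ℝ] ℝ) (y u v : Euc m) : Euc m :=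
  ∑ k, ∑ l, ((gram G y)⁻¹ k l *
    (2⁻¹ * (fderiv ℝ G y u v (stdVec l) + fderiv ℝ G y v u (stdVec l)
      - fderiv ℝ G y (stdVec l) u v))) • stdVec k

/-- The Riemann curvature `R(u, v) w = ∇_u ∇_v w - ∇_v ∇_u w` for constant vector fields
`u`, `v`, `w` on an open subset of `ℝᵐ`. -/
def curvature (G : Euc m → Euc m →L[ℝ] Euc m →L[ℝ] ℝ) (y u v w : Euc m) : Euc m :=
  fderiv ℝ (fun z => christoffel G z v w) y u - fderiv ℝ (fun z => christoffel G z u w) y v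
    + christoffel G y u (christoffel G y v w) - christoffel G y v (christoffel G y u w)

end Coordinates

/-- The pullback of a bilinear form by a linear map. -/
def pullForm {a b : ℕ} (B : Euc b →L[ℝ] Euc b →L[ℝ] ℝ) (A : Euc a →L[ℝ] Euc b) :
    Euc a →L[ℝ] Euc a →L[ℝ] ℝ :=
  B.bilinearComp A A

/-! ### Fields of bilinear forms on a manifold: curvature and volume -/

section Manifold

variable {m : ℕ} {M : Type u} [TopologicalSpace M] [ChartedSpace (Euc m) M]

/-- The expression in the preferred chart `φ` at `p` of a field `h` of bilinear forms, that is, the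
pullback of `h` by `φ⁻¹` (meaningful on the target of `φ`). -/
def inChart (h : ∀ q : M, TangentSpace (𝓡 m) q →L[ℝ] TangentSpace (𝓡 m) q →L[ℝ] ℝ) (p : M)
    (y : Euc m) : Euc m →L[ℝ] Euc m →L[ℝ] ℝ :=
  pullForm (h ((extChartAt (𝓡 m) p).symm y))
    (mfderiv 𝓘(ℝ, Euc m) (𝓡 m) (extChartAt (𝓡 m) p).symm y)

/-- Sectional curvature at `p` of the plane spanned by `u` and `v`, for the metric `h`. It is
computed in the preferred chart at `p`, the chart through which Mathlib identifies `T_p M` with the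
model space. -/
def sectionalCurvature (h : ∀ q : M, TangentSpace (𝓡 m) q →L[ℝ] TangentSpace (𝓡 m) q →L[ℝ] ℝ)
    (p : M) (u v : TangentSpace (𝓡 m) p) : ℝ :=
  h p (curvature (inChart h p) (extChartAt (𝓡 m) p p) u v v) u /
    (h p u u * h p v v - h p u v ^ 2)

variable (m M) in
/-- A compact manifold is covered by a sequence of preferred charts. -/
theorem exists_chart_cover [CompactSpace M] [Nonempty M] :
    ∃ c : ℕ → M, ⋃ k, (extChartAt (𝓡 m) (c k)).source = Set.univ := by
  have := ChartedSpace.secondCountable_of_sigmaCompact (Euc m) M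
  obtain ⟨s, hs, hcov⟩ := TopologicalSpace.countable_cover_nhds
    (f := fun p : M => (extChartAt (𝓡 m) p).source) (fun p => extChartAt_source_mem_nhds p)
  have hne : s.Nonempty := by
    rw [Set.nonempty_iff_ne_empty]
    rintro rfl
    simp only [Set.biUnion_empty] at hcov
    exact Set.empty_ne_univ hcov
  obtain ⟨c, rfl⟩ := hs.exists_eq_range hne
  exact ⟨c, by simpa using hcov⟩

section Volume

variable [MeasurableSpace M]

/-- The Riemannian measure on the domain of the preferred chart at `p`: in the chart it is
`√(det g_ij) dy`. -/
def chartVolume (h : ∀ q : M, TangentSpace (𝓡 m) q →L[ℝ] TangentSpace (𝓡 m) q →L[ℝ] ℝ)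
    (p : M) : MeasureTheory.Measure M :=
  ((MeasureTheory.volume.restrict (extChartAt (𝓡 m) p).target).withDensity
    (fun y => ENNReal.ofReal (√(gram (inChart h p) y).det))).map (extChartAt (𝓡 m) p).symm

/-- The Riemannian measure of a compact manifold: the chart measures are glued along the partition
of the manifold into the Borel sets `source (c k) \ ⋃_{j < k} source (c j)`. By the change of
variables formula the chart measures agree on overlaps, so the choice of the cover is immaterial. -/
def riemannianVolume [CompactSpace M] [Nonempty M]
    (h : ∀ q : M, TangentSpace (𝓡 m) q →L[ℝ] TangentSpace (𝓡 m) q →L[ℝ] ℝ) :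
    MeasureTheory.Measure M :=
  MeasureTheory.Measure.sum fun k =>
    (chartVolume h ((exists_chart_cover m M).choose k)).restrict
      (disjointed (fun j => (extChartAt (𝓡 m) ((exists_chart_cover m M).choose j)).source) k)

end Volume

end Manifold

/-! ### Riemannian metrics and immersed submanifolds -/

/-- A smooth Riemannian metric on the `n`-manifold `N`. -/
abbrev Metric (n : ℕ) (N : Type u) [TopologicalSpace N] [ChartedSpace (Euc n) N]
    [IsManifold (𝓡 n) ∞ N] : Type u :=
  Bundle.ContMDiffRiemannianMetric (𝓡 n) ∞ (Euc n) (fun q : N => TangentSpace (𝓡 n) q)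

section Immersions

variable {m n : ℕ} {M : Type v} [TopologicalSpace M] [ChartedSpace (Euc m) M]
  {N : Type u} [TopologicalSpace N] [ChartedSpace (Euc n) N]

/-- A smooth immersion of an `m`-manifold into an `n`-manifold. -/
def IsSmoothImmersion (m n : ℕ) {M : Type v} [TopologicalSpace M] [ChartedSpace (Euc m) M]
    {N : Type u} [TopologicalSpace N] [ChartedSpace (Euc n) N] (x : M → N) : Prop :=
  ContMDiff (𝓡 m) (𝓡 n) ∞ x ∧ ∀ p : M, Function.Injective (mfderiv (𝓡 m) (𝓡 n) x p)

variable [IsManifold (𝓡 n) ∞ N]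

/-- Positive sectional curvature. -/
def PositiveSectionalCurvature (g : Metric n N) : Prop :=
  ∀ (q : N) (u v : TangentSpace (𝓡 n) q), LinearIndependent ℝ ![u, v] →
    0 < sectionalCurvature g.inner q u v

/-- Nonnegative sectional curvature. -/
def NonnegativeSectionalCurvature (g : Metric n N) : Prop :=
  ∀ (q : N) (u v : TangentSpace (𝓡 n) q), LinearIndependent ℝ ![u, v] →
    0 ≤ sectionalCurvature g.inner q u v

/-- The first fundamental form `I = x^* g`. -/
def firstForm (m : ℕ) {M : Type v} [TopologicalSpace M] [ChartedSpace (Euc m) M]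
    (g : Metric n N) (x : M → N) (p : M) :
    TangentSpace (𝓡 m) p →L[ℝ] TangentSpace (𝓡 m) p →L[ℝ] ℝ :=
  pullForm (g.inner (x p)) (mfderiv (𝓡 m) (𝓡 n) x p)

/-- The inverse `I^{ij}` at `p` of the matrix of the first fundamental form in the standard basis of
`T_p M`. -/
def firstFormInv (m : ℕ) {M : Type v} [TopologicalSpace M] [ChartedSpace (Euc m) M]
    (g : Metric n N) (x : M → N) (p : M) : Matrix (Fin m) (Fin m) ℝ :=
  (Matrix.of fun i j : Fin m => firstForm m g x p (stdVec i) (stdVec j))⁻¹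

/-- The component of `w ∈ T_{x(p)} N` that is `g`-orthogonal to `dx(T_p M)`. -/
def normalPart (m : ℕ) {M : Type v} [TopologicalSpace M] [ChartedSpace (Euc m) M]
    (g : Metric n N) (x : M → N) (p : M) (w : TangentSpace (𝓡 n) (x p)) :
    TangentSpace (𝓡 n) (x p) :=
  w - ∑ i : Fin m, ∑ j : Fin m, (firstFormInv m g x p i j *
    g.inner (x p) w (mfderiv (𝓡 m) (𝓡 n) x p (stdVec j))) •
      mfderiv (𝓡 m) (𝓡 n) x p (stdVec i)

/-- The ambient derivative `∇_u (dx(V))` at `p`, where `V` is the extension of `v` with constant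
coefficients in the chart of `M` at `p` and `∇` is the Levi-Civita connection of `g`. In the charts
at `p` and at `x p` it is `D²x(u, v) + Γ(Dx u, Dx v)`. -/
def ambientDerivative (g : Metric n N) (x : M → N) (p : M) (u v : TangentSpace (𝓡 m) p) :
    TangentSpace (𝓡 n) (x p) :=
  let X : Euc m → Euc n := writtenInExtChartAt (𝓡 m) (𝓡 n) p x
  let y : Euc m := extChartAt (𝓡 m) p p
  (fderiv ℝ (fderiv ℝ X) y u v
    + christoffel (inChart g.inner (x p)) (X y) (fderiv ℝ X y u) (fderiv ℝ X y v) : Euc n)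

/-- The second fundamental form `II(u, v) = (∇_u dx(V))^⊥`. -/
def secondForm (g : Metric n N) (x : M → N) (p : M) (u v : TangentSpace (𝓡 m) p) :
    TangentSpace (𝓡 n) (x p) :=
  normalPart m g x p (ambientDerivative g x p u v)

/-- The mean curvature vector `H = (1 / m) tr_I II`. -/
def meanCurvature (m : ℕ) {M : Type v} [TopologicalSpace M] [ChartedSpace (Euc m) M]
    (g : Metric n N) (x : M → N) (p : M) : TangentSpace (𝓡 n) (x p) :=
  (m : ℝ)⁻¹ • ∑ i : Fin m, ∑ j : Fin m,
    firstFormInv m g x p i j • secondForm (m := m) g x p (stdVec i) (stdVec j)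

/-- Totally umbilic: `II = H I`. -/
def IsTotallyUmbilic (m : ℕ) {M : Type v} [TopologicalSpace M] [ChartedSpace (Euc m) M]
    (g : Metric n N) (x : M → N) : Prop :=
  ∀ (p : M) (u v : TangentSpace (𝓡 m) p),
    secondForm g x p u v = firstForm m g x p u v • meanCurvature m g x p

/-- Totally geodesic: `II = 0`. -/
def IsTotallyGeodesic (m : ℕ) {M : Type v} [TopologicalSpace M] [ChartedSpace (Euc m) M]
    (g : Metric n N) (x : M → N) : Prop :=
  ∀ (p : M) (u v : TangentSpace (𝓡 m) p), secondForm g x p u v = 0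

end Immersions

/-! ### Immersed surfaces -/

section Surfaces

variable {n : ℕ} {M : Type v} [TopologicalSpace M] [ChartedSpace (Euc 2) M]
  {N : Type u} [TopologicalSpace N] [ChartedSpace (Euc n) N] [IsManifold (𝓡 n) ∞ N]

/-- The Gauss curvature `K` of the induced metric `x^* g`. -/
def gaussCurvature (g : Metric n N) (x : M → N) (p : M) : ℝ :=
  sectionalCurvature (firstForm 2 g x) p (stdVec 0) (stdVec 1)

/-- The sectional curvature of `N` along the tangent plane `dx(T_p M)`. -/
def ambientCurvature (g : Metric n N) (x : M → N) (p : M) : ℝ :=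
  sectionalCurvature g.inner (x p) (mfderiv (𝓡 2) (𝓡 n) x p (stdVec 0))
    (mfderiv (𝓡 2) (𝓡 n) x p (stdVec 1))

/-- The Willmore integrand `|H|² - K + K̃`. -/
def willmoreDensity (g : Metric n N) (x : M → N) (p : M) : ℝ :=
  g.inner (x p) (meanCurvature 2 g x p) (meanCurvature 2 g x p)
    - gaussCurvature g x p + ambientCurvature g x p

/-- The Riemannian measure `dM` of the induced metric. -/
def inducedVolume [MeasurableSpace M] [CompactSpace M] [Nonempty M]
    (g : Metric n N) (x : M → N) : MeasureTheory.Measure M :=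
  riemannianVolume (firstForm 2 g x)

/-- The Willmore functional `W(x) = ∫_M (|H|² - K + K̃) dM`. -/
def willmore [MeasurableSpace M] [CompactSpace M] [Nonempty M] (g : Metric n N) (x : M → N) : ℝ :=
  ∫ p, willmoreDensity g x p ∂(inducedVolume g x)

/-- The induced metric is flat. -/
def IsFlat (g : Metric n N) (x : M → N) : Prop := ∀ p : M, gaussCurvature g x p = 0

end Surfaces

/-! ### Tori and the genus of a closed surface -/

section Topology

/-- A smooth surface is a torus if it is diffeomorphic to `S¹ × S¹`. -/
def IsTorus (T : Type v) [TopologicalSpace T] [ChartedSpace (Euc 2) T] : Prop :=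
  Nonempty (Diffeomorph (𝓡 2) ((𝓡 1).prod (𝓡 1)) T (Circle × Circle) ∞)

/-- Orientability of a smooth surface: some smooth atlas has transition maps with positive Jacobian
determinant. -/
def IsOrientable (M : Type v) [TopologicalSpace M] [ChartedSpace (Euc 2) M] : Prop :=
  ∃ A ⊆ IsManifold.maximalAtlas (𝓡 2) ∞ M, (∀ p : M, ∃ e ∈ A, p ∈ e.source) ∧
    ∀ e ∈ A, ∀ e' ∈ A, ∀ y ∈ (e.symm.trans e').source,
      0 < (fderiv ℝ (e.symm.trans e') y).det

variable {k : ℕ}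

/-- The polyhedron in `ℝᵏ` of the 2-dimensional simplicial complex on the vertices `0, …, k - 1`
generated by the given triangles: the points of the standard simplex supported in a triangle. -/
def polyhedron (Δ : Finset (Finset (Fin k))) : Set (Fin k → ℝ) :=
  {w | w ∈ stdSimplex ℝ (Fin k) ∧ ∃ t ∈ Δ, ∀ i, w i ≠ 0 → i ∈ t}

/-- The affine parametrization of the plane through the vertices `a 0`, `a 1`, `a 2` of the standard
simplex of `ℝᵏ`. -/
def triangleMap (a : Fin 3 → Fin k) (z : Euc 2) : Fin k → ℝ :=
  (1 - z 0 - z 1) • Pi.single (a 0) 1 + z 0 • Pi.single (a 1) 1 + z 1 • Pi.single (a 2) 1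

/-- The closed standard triangle in the plane. -/
def stdTriangle : Set (Euc 2) := {z | 0 ≤ z 0 ∧ 0 ≤ z 1 ∧ z 0 + z 1 ≤ 1}

/-- A smooth triangulation of a compact Hausdorff surface `M`: a continuous bijection `Φ` (hence
a homeomorphism) from the polyhedron of a finite 2-dimensional simplicial complex onto `M`, which on
each closed triangle extends to a smooth map on a neighborhood, with injective differential on the
triangle. -/
structure IsSmoothTriangulation (M : Type v) [TopologicalSpace M] [ChartedSpace (Euc 2) M]
    (Δ : Finset (Finset (Fin k))) (Φ : (Fin k → ℝ) → M) : Prop where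
  card_eq : ∀ t ∈ Δ, t.card = 3
  continuousOn : ContinuousOn Φ (polyhedron Δ)
  bijOn : Set.BijOn Φ (polyhedron Δ) Set.univ
  smooth : ∀ a : Fin 3 → Fin k, Function.Injective a → Finset.univ.image a ∈ Δ →
    ∃ (U : Set (Euc 2)) (ψ : Euc 2 → M), IsOpen U ∧ stdTriangle ⊆ U ∧
      ContMDiffOn 𝓘(ℝ, Euc 2) (𝓡 2) ∞ ψ U ∧
      (∀ z ∈ stdTriangle, Function.Injective (mfderiv 𝓘(ℝ, Euc 2) (𝓡 2) ψ z)) ∧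
      ∀ z ∈ stdTriangle, ψ z = Φ (triangleMap a z)

/-- The Euler characteristic `V - E + F` of the simplicial complex generated by the triangles. -/
def eulerChar (Δ : Finset (Finset (Fin k))) : ℤ :=
  ((Δ.biUnion id).card : ℤ) - ((Δ.biUnion (Finset.powersetCard 2)).card : ℤ) + (Δ.card : ℤ)

/-- The closed surface `M` is orientable of genus `γ`: its Euler characteristic, computed from a
smooth triangulation, is `2 - 2γ`. -/
def HasGenus (M : Type v) [TopologicalSpace M] [ChartedSpace (Euc 2) M] (γ : ℕ) : Prop :=
  IsOrientable M ∧ ∃ (k : ℕ) (Δ : Finset (Finset (Fin k))) (Φ : (Fin k → ℝ) → M),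
    IsSmoothTriangulation M Δ Φ ∧ eulerChar Δ = 2 - 2 * (γ : ℤ)

end Topology

end Willmore

end

/-!
# The Willmore functional of immersed surfaces

Write `b` for the second fundamental form of a surface in `N`, with values in the normal bundle.
The Gauss equation gives `K - K̃ = (⟨b₀₀, b₁₁⟩ - |b₀₁|²) / det I`, so that `|H|² - K + K̃` is, up
to a positive factor, the squared norm of the trace-free part of `b` (`willmoreDensity_eq`,
`umbilicDefect_eq`). It is therefore nonnegative, and it vanishes exactly where `b = H I`. Being
invariant under changes of charts in `M` and in `N`, it is a continuous function on `M`
(`continuous_willmoreDensity`), and the Riemannian measure of a compact surface is finite and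
positive on nonempty open sets; hence the density is integrable and the integral vanishes only if
the density does (`willmore_eq_zero_iff`).

On a totally umbilic surface `K = |H|² + K̃`. If the sectional curvature of `N` is nonnegative, so
is `K`, and if it is positive, so is `K`. The remaining parts are instances of the Gauss–Bonnet
theorem, which rests on the structure equation `dω = -K dA` for the connection form of a frame on
a plane domain (`IsMetricOn.fderiv_connForm_sub`).

* A torus is covered by a local diffeomorphism from the plane that is periodic in both
  coordinates. The induced metric pulls back to a doubly periodic metric, and Green's formula on a
  period square shows that the integral of its curvature vanishes. So `K ≥ 0` implies `K = 0`
  (`IsTorus.sectionalCurvature_eq_zero`), and then `|H|² + K̃ = 0` gives `H = 0` and `b = 0`. The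
  same statement excludes `K > 0`.

* For a surface given with a smooth triangulation, Green's formula on one triangle is the local
  Gauss–Bonnet formula (`IsMetricOn.gaussBonnet_triangle`); if `K > 0`, the angle sum of the
  triangle exceeds `π` plus the total geodesic curvature of its sides. Sum this over all
  triangles. The tangent sectors of the triangles at a vertex are disjoint, so that the angles
  there add up to at most `2π` (`sum_metricAngle_le_two_pi`). Every side belongs to exactly two
  triangles, which lie on opposite sides of it (`IsFace.exists_adjacent`, `IsFace.side_sign`), so
  that the geodesic curvatures cancel (`IsFace.sideTurning_add`) and `3F = 2E`. Hence `π F < 2π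
  V`, that is, `V - E + F = V - F / 2 > 0` (`IsSmoothTriangulation.eulerChar_pos`), which excludes
  genus at least one. An inequality suffices at the vertices, so that it need not be shown that
  the sectors fill the tangent plane.
-/

open scoped Manifold ContDiff Topology

noncomputable section

namespace Willmore

universe u v

set_option maxSynthPendingDepth 3

/-! ### Metrics on open subsets of a model space -/

section Coordinates
variable {m n : ℕ}

theorem sum_smul_stdVec (v : Euc m) : ∑ i, v i • stdVec i = v := by
  ext j
  simp [Finset.sum_apply, Pi.single_apply]

/-- A field `G` of bilinear forms that is a smooth Riemannian metric on the open set `U`. -/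
structure IsMetricOn (G : Euc m → Euc m →L[ℝ] Euc m →L[ℝ] ℝ) (U : Set (Euc m)) : Prop where
  isOpen : IsOpen U
  contDiffOn : ContDiffOn ℝ ∞ G U
  symm : ∀ y ∈ U, ∀ u v, G y u v = G y v u
  pos : ∀ y ∈ U, ∀ v, v ≠ 0 → 0 < G y v v

theorem bilin_eq_sum (B : Euc m →L[ℝ] Euc m →L[ℝ] ℝ) (u v : Euc m) :
    B u v = ∑ i, ∑ j, u i * v j * B (stdVec i) (stdVec j) := by
  conv_lhs => rw [← sum_smul_stdVec u, ← sum_smul_stdVec v]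
  simp only [map_sum, map_smul, FunLike.coe_sum, FunLike.coe_smul,
    Finset.sum_apply, Pi.smul_apply, smul_eq_mul, Finset.mul_sum]
  rw [Finset.sum_comm]
  exact Finset.sum_congr rfl fun i _ => Finset.sum_congr rfl fun j _ => by ring

namespace IsMetricOn

variable {G : Euc m → Euc m →L[ℝ] Euc m →L[ℝ] ℝ} {U : Set (Euc m)} {y : Euc m}

theorem contDiffAt (hG : IsMetricOn G U) (hy : y ∈ U) : ContDiffAt ℝ ∞ G y :=
  hG.contDiffOn.contDiffAt (hG.isOpen.mem_nhds hy)

theorem mem_nhds (hG : IsMetricOn G U) (hy : y ∈ U) : U ∈ 𝓝 y := hG.isOpen.mem_nhds hy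

theorem differentiableAt (hG : IsMetricOn G U) (hy : y ∈ U) : DifferentiableAt ℝ G y :=
  (hG.contDiffAt hy).differentiableAt (by simp)

theorem eq_of_forall (hG : IsMetricOn G U) (hy : y ∈ U) {a b : Euc m}
    (h : ∀ w, G y a w = G y b w) : a = b := by
  by_contra hab
  have := hG.pos y hy (a - b) (sub_ne_zero.mpr hab)
  simp only [map_sub, FunLike.coe_sub, Pi.sub_apply, h, sub_self, lt_irrefl] at this

theorem self_nonneg (hG : IsMetricOn G U) (hy : y ∈ U) (v : Euc m) : 0 ≤ G y v v := by
  rcases eq_or_ne v 0 with rfl | hv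
  · simp
  · exact (hG.pos y hy v hv).le

theorem self_eq_zero (hG : IsMetricOn G U) (hy : y ∈ U) {v : Euc m} : G y v v = 0 ↔ v = 0 := by
  refine ⟨fun h => ?_, fun h => by simp [h]⟩
  by_contra hv
  exact (hG.pos y hy v hv).ne' h

theorem gram_posDef (hG : IsMetricOn G U) (hy : y ∈ U) : (gram G y).PosDef := by
  refine Matrix.PosDef.of_dotProduct_mulVec_pos ?_ ?_
  · ext i j
    simp [gram, hG.symm y hy (stdVec j)]
  · intro x hx
    have := hG.pos y hy (WithLp.toLp 2 x) (by simpa using hx)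
    rw [bilin_eq_sum] at this
    simpa [dotProduct, Matrix.mulVec, gram, Finset.mul_sum, mul_assoc, mul_comm, mul_left_comm]
      using this

theorem gram_det_pos (hG : IsMetricOn G U) (hy : y ∈ U) : 0 < (gram G y).det :=
  (hG.gram_posDef hy).det_pos

theorem fderiv_symm (hG : IsMetricOn G U) (hy : y ∈ U) (w u v : Euc m) :
    fderiv ℝ G y w u v = fderiv ℝ G y w v u := by
  have hd := (hG.differentiableAt hy).hasFDerivAt
  have h1 : ∀ a b, HasFDerivAt (fun z => G z a b)
      (((fderiv ℝ G y).flip a).flip b) y := fun a b => by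
    have := (hd.clm_apply (hasFDerivAt_const a y)).clm_apply (hasFDerivAt_const b y)
    refine this.congr_fderiv ?_
    ext w; simp
  have h2 : (fun z => G z u v) =ᶠ[𝓝 y] fun z => G z v u := by
    filter_upwards [hG.mem_nhds hy] with z hz using hG.symm z hz u v
  have := ((h1 u v).congr_of_eventuallyEq h2.symm).unique (h1 v u)
  simpa using congrArg (fun L => L w) this

/-- The Koszul formula. -/
theorem koszul (hG : IsMetricOn G U) (hy : y ∈ U) (u v w : Euc m) :
    G y (christoffel G y u v) w =
      2⁻¹ * (fderiv ℝ G y u v w + fderiv ℝ G y v u w - fderiv ℝ G y w u v) := by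
  set c : Fin m → ℝ := fun l => 2⁻¹ * (fderiv ℝ G y u v (stdVec l) + fderiv ℝ G y v u (stdVec l)
      - fderiv ℝ G y (stdVec l) u v) with hc
  have key : ∀ j, G y (christoffel G y u v) (stdVec j) = c j := by
    intro j
    have h1 : gram G y * (gram G y)⁻¹ = 1 :=
      Matrix.mul_nonsing_inv _ (hG.gram_det_pos hy).ne'.isUnit
    have h2 : (gram G y * (gram G y)⁻¹).mulVec c j = c j := by rw [h1, Matrix.one_mulVec]
    rw [← h2, ← Matrix.mulVec_mulVec]
    simp only [christoffel, map_sum, map_smul, FunLike.coe_sum, FunLike.coe_smul,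
      Finset.sum_apply, Pi.smul_apply, smul_eq_mul, Matrix.mulVec, dotProduct, Finset.mul_sum]
    refine Finset.sum_congr rfl fun k _ => Finset.sum_congr rfl fun l _ => ?_
    simp only [gram, Matrix.of_apply, hc, hG.symm y hy (stdVec j)]
    ring
  have h3 : G y (christoffel G y u v) w = ∑ j, w j * c j := by
    conv_lhs => rw [← sum_smul_stdVec w]
    simp [map_sum, map_smul, key]
  rw [h3]
  conv_rhs => rw [← sum_smul_stdVec w]
  simp only [hc, map_sum, map_smul, FunLike.coe_sum, FunLike.coe_smul,
      Finset.sum_apply, Pi.smul_apply, smul_eq_mul, ← Finset.sum_add_distrib,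
      ← Finset.sum_sub_distrib, Finset.mul_sum]
  refine Finset.sum_congr rfl fun k _ => ?_
  ring

theorem christoffel_symm (hG : IsMetricOn G U) (hy : y ∈ U) (u v : Euc m) :
    christoffel G y u v = christoffel G y v u := by
  refine hG.eq_of_forall hy fun w => ?_
  rw [hG.koszul hy, hG.koszul hy, hG.fderiv_symm hy w u v]
  ring

/-- The Levi-Civita connection is metric. -/
theorem fderiv_eq (hG : IsMetricOn G U) (hy : y ∈ U) (w u v : Euc m) :
    fderiv ℝ G y w u v = G y (christoffel G y w u) v + G y u (christoffel G y w v) := by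
  rw [hG.symm y hy u, hG.koszul hy, hG.koszul hy, hG.fderiv_symm hy w v u,
    hG.fderiv_symm hy v w u, hG.fderiv_symm hy u w v]
  ring

end IsMetricOn

/-- The Christoffel symbols as a continuous bilinear map. -/
def christoffelL (G : Euc m → Euc m →L[ℝ] Euc m →L[ℝ] ℝ) (y : Euc m) :
    Euc m →L[ℝ] Euc m →L[ℝ] Euc m :=
  LinearMap.toContinuousBilinearMap <| LinearMap.mk₂ ℝ (christoffel G y)
    (fun a b c => by
      simp only [christoffel, map_add, FunLike.coe_add, Pi.add_apply, ← Finset.sum_add_distrib,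
        ← add_smul]
      refine Finset.sum_congr rfl fun k _ => Finset.sum_congr rfl fun l _ => ?_
      congr 1; ring)
    (fun r a b => by
      simp only [christoffel, map_smul, FunLike.coe_smul, Pi.smul_apply, smul_eq_mul,
        Finset.smul_sum, smul_smul]
      refine Finset.sum_congr rfl fun k _ => Finset.sum_congr rfl fun l _ => ?_
      congr 1; ring)
    (fun a b c => by
      simp only [christoffel, map_add, FunLike.coe_add, Pi.add_apply, ← Finset.sum_add_distrib,
        ← add_smul]
      refine Finset.sum_congr rfl fun k _ => Finset.sum_congr rfl fun l _ => ?_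
      congr 1; ring)
    (fun r a b => by
      simp only [christoffel, map_smul, FunLike.coe_smul, Pi.smul_apply, smul_eq_mul,
        Finset.smul_sum, smul_smul]
      refine Finset.sum_congr rfl fun k _ => Finset.sum_congr rfl fun l _ => ?_
      congr 1; ring)

@[simp] theorem christoffelL_apply (G : Euc m → Euc m →L[ℝ] Euc m →L[ℝ] ℝ) (y u v : Euc m) :
    christoffelL G y u v = christoffel G y u v := rfl

theorem contDiffAt_det {E : Type*} [NormedAddCommGroup E] [NormedSpace ℝ E]
    {A : E → Matrix (Fin m) (Fin m) ℝ} {x : E}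
    (h : ∀ i j, ContDiffAt ℝ ∞ (fun z => A z i j) x) : ContDiffAt ℝ ∞ (fun z => (A z).det) x := by
  simp only [Matrix.det_apply']
  refine ContDiffAt.sum fun σ _ => ?_
  exact contDiffAt_const.mul (contDiffAt_prod fun i _ => h _ _)

theorem IsMetricOn.contDiffAt_gram {G : Euc m → Euc m →L[ℝ] Euc m →L[ℝ] ℝ} {U : Set (Euc m)}
    {y : Euc m} (hG : IsMetricOn G U) (hy : y ∈ U) (i j : Fin m) :
    ContDiffAt ℝ ∞ (fun z => gram G z i j) y :=
  ((hG.contDiffAt hy).clm_apply contDiffAt_const).clm_apply contDiffAt_const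

theorem IsMetricOn.contDiffAt_gram_inv {G : Euc m → Euc m →L[ℝ] Euc m →L[ℝ] ℝ} {U : Set (Euc m)}
    {y : Euc m} (hG : IsMetricOn G U) (hy : y ∈ U) (i j : Fin m) :
    ContDiffAt ℝ ∞ (fun z => (gram G z)⁻¹ i j) y := by
  have h1 := hG.contDiffAt_gram hy
  simp only [Matrix.inv_def, Ring.inverse_eq_inv', Matrix.smul_apply, smul_eq_mul,
    Matrix.adjugate_apply]
  refine ((contDiffAt_det h1).inv (hG.gram_det_pos hy).ne').mul (contDiffAt_det fun k l => ?_)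
  by_cases hk : k = j
  · subst hk
    simpa using contDiffAt_const
  · simpa [Matrix.updateRow_ne hk] using h1 k l

theorem contDiffAt_clm_of_apply {E F : Type*} [NormedAddCommGroup E] [NormedSpace ℝ E]
    [NormedAddCommGroup F] [NormedSpace ℝ F] {f : E → Euc m →L[ℝ] F} {x : E}
    (h : ∀ v, ContDiffAt ℝ ∞ (fun z => f z v) x) : ContDiffAt ℝ ∞ f x := by
  have : f = fun z => ∑ i, ((EuclideanSpace.proj i : Euc m →L[ℝ] ℝ).smulRight
      (f z (stdVec i))) := by
    ext z v
    conv_lhs => rw [← sum_smul_stdVec v]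
    simp
  rw [this]
  refine ContDiffAt.sum fun i _ => ?_
  exact ((ContinuousLinearMap.smulRightL ℝ (Euc m) F
    (EuclideanSpace.proj i)).contDiff.contDiffAt).comp x (h _)

theorem IsMetricOn.contDiffAt_christoffelL {G : Euc m → Euc m →L[ℝ] Euc m →L[ℝ] ℝ}
    {U : Set (Euc m)} {y : Euc m} (hG : IsMetricOn G U) (hy : y ∈ U) :
    ContDiffAt ℝ ∞ (christoffelL G) y := by
  refine contDiffAt_clm_of_apply fun u => contDiffAt_clm_of_apply fun v => ?_
  simp only [christoffelL_apply, christoffel]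
  have hd : ContDiffAt ℝ ∞ (fderiv ℝ G) y := (hG.contDiffAt hy).fderiv_right (by simp)
  have hd' : ∀ a b c, ContDiffAt ℝ ∞ (fun z => fderiv ℝ G z a b c) y := fun a b c =>
    ((hd.clm_apply contDiffAt_const).clm_apply contDiffAt_const).clm_apply contDiffAt_const
  refine ContDiffAt.sum fun k _ => ContDiffAt.sum fun l _ => ?_
  refine ContDiffAt.smul ((hG.contDiffAt_gram_inv hy k l).mul (contDiffAt_const.mul ?_))
    contDiffAt_const
  exact ((hd' _ _ _).add (hd' _ _ _)).sub (hd' _ _ _)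

/-- The curvature in terms of the derivative of the bundled Christoffel symbols. -/
theorem IsMetricOn.curvature_eq {G : Euc m → Euc m →L[ℝ] Euc m →L[ℝ] ℝ}
    {U : Set (Euc m)} {y : Euc m} (hG : IsMetricOn G U) (hy : y ∈ U) (u v w : Euc m) :
    curvature G y u v w = fderiv ℝ (christoffelL G) y u v w - fderiv ℝ (christoffelL G) y v u w
      + christoffel G y u (christoffel G y v w) - christoffel G y v (christoffel G y u w) := by
  have hd : DifferentiableAt ℝ (christoffelL G) y :=
    (hG.contDiffAt_christoffelL hy).differentiableAt (by simp)
  have h : ∀ a b c, fderiv ℝ (fun z => christoffel G z a b) y c =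
      fderiv ℝ (christoffelL G) y c a b := by
    intro a b c
    have := (hd.hasFDerivAt.clm_apply (hasFDerivAt_const a y)).clm_apply (hasFDerivAt_const b y)
    simp only [christoffelL_apply] at this
    rw [this.fderiv]
    simp
  rw [curvature, h, h]

/-! ### The Gauss equation -/

/-- The pullback of a field of bilinear forms by a map between model spaces. -/
def pullMetric (G : Euc n → Euc n →L[ℝ] Euc n →L[ℝ] ℝ) (X : Euc m → Euc n) (z : Euc m) :
    Euc m →L[ℝ] Euc m →L[ℝ] ℝ :=
  pullForm (G (X z)) (fderiv ℝ X z)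

@[simp] theorem pullMetric_apply (G : Euc n → Euc n →L[ℝ] Euc n →L[ℝ] ℝ) (X : Euc m → Euc n)
    (z u v : Euc m) : pullMetric G X z u v = G (X z) (fderiv ℝ X z u) (fderiv ℝ X z v) := rfl

theorem IsMetricOn.pullMetric {G : Euc n → Euc n →L[ℝ] Euc n →L[ℝ] ℝ} {U : Set (Euc n)}
    (hG : IsMetricOn G U) {X : Euc m → Euc n} {V : Set (Euc m)} (hV : IsOpen V)
    (hX : ContDiffOn ℝ ∞ X V) (hXU : Set.MapsTo X V U)
    (hinj : ∀ z ∈ V, Function.Injective (fderiv ℝ X z)) : IsMetricOn (pullMetric G X) V where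
  isOpen := hV
  contDiffOn := by
    intro z hz
    refine ContDiffAt.contDiffWithinAt ?_
    have hXz : ContDiffAt ℝ ∞ X z := hX.contDiffAt (hV.mem_nhds hz)
    have hd : ContDiffAt ℝ ∞ (fderiv ℝ X) z := hXz.fderiv_right (by simp)
    have hG' : ContDiffAt ℝ ∞ (fun z => G (X z)) z := (hG.contDiffAt (hXU hz)).comp z hXz
    refine contDiffAt_clm_of_apply fun u => contDiffAt_clm_of_apply fun v => ?_
    exact (hG'.clm_apply (hd.clm_apply contDiffAt_const)).clm_apply (hd.clm_apply contDiffAt_const)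
  symm y hy u v := hG.symm _ (hXU hy) _ _
  pos y hy v hv := hG.pos _ (hXU hy) _ fun h => hv (hinj y hy (h.trans (map_zero _).symm))

/-- The derivative along `X` of the field `DX v`, where `v` is constant: the second derivative of
`X` corrected by the Christoffel symbols of the ambient metric. -/
def hessianAlong (G : Euc n → Euc n →L[ℝ] Euc n →L[ℝ] ℝ) (X : Euc m → Euc n) (z u v : Euc m) :
    Euc n :=
  fderiv ℝ (fderiv ℝ X) z u v + christoffel G (X z) (fderiv ℝ X z u) (fderiv ℝ X z v)

/-- The normal part of the second derivative of an immersion: the second fundamental form. -/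
def normalHessian (G : Euc n → Euc n →L[ℝ] Euc n →L[ℝ] ℝ) (X : Euc m → Euc n) (z u v : Euc m) :
    Euc n :=
  hessianAlong G X z u v - fderiv ℝ X z (christoffel (Willmore.pullMetric G X) z u v)

section Gauss

variable {G : Euc n → Euc n →L[ℝ] Euc n →L[ℝ] ℝ} {U : Set (Euc n)} {X : Euc m → Euc n}
  {V : Set (Euc m)} {z : Euc m}

/-- The hypotheses under which `X` is an immersion of the open set `V` into the domain `U` of the
metric `G`. -/
structure IsImmersionOn (G : Euc n → Euc n →L[ℝ] Euc n →L[ℝ] ℝ) (U : Set (Euc n))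
    (X : Euc m → Euc n) (V : Set (Euc m)) : Prop where
  metric : IsMetricOn G U
  isOpen : IsOpen V
  contDiffOn : ContDiffOn ℝ ∞ X V
  mapsTo : Set.MapsTo X V U
  injective : ∀ z ∈ V, Function.Injective (fderiv ℝ X z)

namespace IsImmersionOn

variable (hX : IsImmersionOn G U X V)
include hX

theorem mem_nhds (hz : z ∈ V) : V ∈ 𝓝 z := hX.isOpen.mem_nhds hz

theorem contDiffAt (hz : z ∈ V) : ContDiffAt ℝ ∞ X z := hX.contDiffOn.contDiffAt (hX.mem_nhds hz)

theorem contDiffAt_fderiv (hz : z ∈ V) : ContDiffAt ℝ ∞ (fderiv ℝ X) z :=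
  (hX.contDiffAt hz).fderiv_right (by simp)

theorem hasFDerivAt (hz : z ∈ V) : HasFDerivAt X (fderiv ℝ X z) z :=
  ((hX.contDiffAt hz).differentiableAt (by simp)).hasFDerivAt

theorem hasFDerivAt_fderiv (hz : z ∈ V) : HasFDerivAt (fderiv ℝ X) (fderiv ℝ (fderiv ℝ X) z) z :=
  ((hX.contDiffAt_fderiv hz).differentiableAt (by simp)).hasFDerivAt

theorem pullMetric : IsMetricOn (pullMetric G X) V :=
  hX.metric.pullMetric hX.isOpen hX.contDiffOn hX.mapsTo hX.injective

theorem fderiv_fderiv_symm (hz : z ∈ V) (u v : Euc m) :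
    fderiv ℝ (fderiv ℝ X) z u v = fderiv ℝ (fderiv ℝ X) z v u := by
  have := (hX.contDiffAt hz).isSymmSndFDerivAt
    (by simp; exact WithTop.coe_le_coe.2 (le_top : (2 : ℕ∞) ≤ ⊤))
  exact this u v

theorem hessianAlong_symm (hz : z ∈ V) (u v : Euc m) :
    hessianAlong G X z u v = hessianAlong G X z v u := by
  rw [hessianAlong, hessianAlong, hX.fderiv_fderiv_symm hz,
    hX.metric.christoffel_symm (hX.mapsTo hz)]

theorem normalHessian_symm (hz : z ∈ V) (u v : Euc m) :
    normalHessian G X z u v = normalHessian G X z v u := by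
  rw [normalHessian, normalHessian, hX.hessianAlong_symm hz, hX.pullMetric.christoffel_symm hz]

/-- The Levi-Civita connection is metric along `X`, for fields `a`, `b` along `X`. -/
theorem hasFDerivAt_inner (hz : z ∈ V) {a b : Euc m → Euc n} {a' b' : Euc m →L[ℝ] Euc n}
    (ha : HasFDerivAt a a' z) (hb : HasFDerivAt b b' z) :
    ∃ L : Euc m →L[ℝ] ℝ, HasFDerivAt (fun y => G (X y) (a y) (b y)) L z ∧ ∀ u, L u =
      G (X z) (a' u + christoffel G (X z) (fderiv ℝ X z u) (a z)) (b z) +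
        G (X z) (a z) (b' u + christoffel G (X z) (fderiv ℝ X z u) (b z)) := by
  have hG := (hX.metric.differentiableAt (hX.mapsTo hz)).hasFDerivAt.comp z (hX.hasFDerivAt hz)
  refine ⟨_, (hG.clm_apply ha).clm_apply hb, fun u => ?_⟩
  simp only [add_apply, ContinuousLinearMap.flip_apply,
    ContinuousLinearMap.comp_apply, Function.comp_apply,
    hX.metric.fderiv_eq (hX.mapsTo hz), map_add]
  ring

/-- The tangential part of the covariant derivative along `X` is given by the Christoffel symbols
of the pulled back metric. -/
theorem inner_hessianAlong (hz : z ∈ V) (u v w : Euc m) :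
    G (X z) (hessianAlong G X z u v) (fderiv ℝ X z w) =
      Willmore.pullMetric G X z (christoffel (Willmore.pullMetric G X) z u v) w := by
  have hd : ∀ a b c, fderiv ℝ (Willmore.pullMetric G X) z a b c =
      G (X z) (hessianAlong G X z a b) (fderiv ℝ X z c) +
        G (X z) (fderiv ℝ X z b) (hessianAlong G X z a c) := by
    intro a b c
    have hb : ∀ b, HasFDerivAt (fun y => fderiv ℝ X y b)
        ((fderiv ℝ (fderiv ℝ X) z).flip b) z := fun b => by
      refine ((hX.hasFDerivAt_fderiv hz).clm_apply (hasFDerivAt_const b z)).congr_fderiv ?_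
      ext w; simp
    obtain ⟨L, hL, hL'⟩ := hX.hasFDerivAt_inner hz (hb b) (hb c)
    have h2 := ((hX.pullMetric.differentiableAt hz).hasFDerivAt.clm_apply
      (hasFDerivAt_const b z)).clm_apply (hasFDerivAt_const c z)
    have := congrArg (fun L => L a) (h2.unique hL)
    simpa [hL', hessianAlong] using this
  rw [hX.pullMetric.koszul hz, hd, hd, hd, hX.metric.symm _ (hX.mapsTo hz) (fderiv ℝ X z v),
    hX.metric.symm _ (hX.mapsTo hz) (fderiv ℝ X z u),
    hX.metric.symm _ (hX.mapsTo hz) (fderiv ℝ X z u),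
    hX.hessianAlong_symm hz v u, hX.hessianAlong_symm hz w u, hX.hessianAlong_symm hz w v]
  ring

theorem inner_normalHessian (hz : z ∈ V) (u v w : Euc m) :
    G (X z) (normalHessian G X z u v) (fderiv ℝ X z w) = 0 := by
  rw [normalHessian, map_sub, sub_apply, hX.inner_hessianAlong hz,
    pullMetric_apply, sub_self]

/-- The Gauss equation: differentiating `inner_hessianAlong`, which says that the tangential part of
the ambient derivative is the intrinsic one, leaves the products of the normal parts as the
difference of the two curvatures. -/
theorem gauss_equation (hz : z ∈ V) (u v w x : Euc m) :
    G (X z) (curvature G (X z) (fderiv ℝ X z u) (fderiv ℝ X z v) (fderiv ℝ X z w))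
        (fderiv ℝ X z x) =
      Willmore.pullMetric G X z (curvature (Willmore.pullMetric G X) z u v w) x
        - G (X z) (normalHessian G X z v w) (normalHessian G X z u x)
        + G (X z) (normalHessian G X z u w) (normalHessian G X z v x) := by
  have hXz := hX.mapsTo hz
  set h := Willmore.pullMetric G X with hh
  have hm : IsMetricOn h V := hX.pullMetric
  -- covariant derivative of `hessianAlong` along `X`
  have hΓ := ((hX.metric.contDiffAt_christoffelL hXz).differentiableAt (by simp)).hasFDerivAt.comp z
    (hX.hasFDerivAt hz)
  have hΓh := ((hm.contDiffAt_christoffelL hz).differentiableAt (by simp)).hasFDerivAt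
  have hD2 := ((hX.contDiffAt_fderiv hz).fderiv_right (m := ∞) (by simp)).differentiableAt
    (by simp) |>.hasFDerivAt
  have hD3 : ∀ a b c, fderiv ℝ (fderiv ℝ (fderiv ℝ X)) z a b c =
      fderiv ℝ (fderiv ℝ (fderiv ℝ X)) z b a c := by
    intro a b c
    have := (hX.contDiffAt_fderiv hz).isSymmSndFDerivAt
      (by simp; exact WithTop.coe_le_coe.2 (le_top : (2 : ℕ∞) ≤ ⊤))
    exact congrArg (fun L => L c) (this a b)
  have hb : ∀ b, HasFDerivAt (fun y => fderiv ℝ X y b)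
      ((fderiv ℝ (fderiv ℝ X) z).flip b) z := fun b => by
    refine ((hX.hasFDerivAt_fderiv hz).clm_apply (hasFDerivAt_const b z)).congr_fderiv ?_
    ext w; simp
  have hA : ∀ b c, ∃ L : Euc m →L[ℝ] Euc n,
      HasFDerivAt (fun y => hessianAlong G X y b c) L z ∧ ∀ a, L a =
        fderiv ℝ (fderiv ℝ (fderiv ℝ X)) z a b c +
        (fderiv ℝ (christoffelL G) (X z) (fderiv ℝ X z a) (fderiv ℝ X z b) (fderiv ℝ X z c)
        + christoffel G (X z) (fderiv ℝ (fderiv ℝ X) z a b) (fderiv ℝ X z c)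
        + christoffel G (X z) (fderiv ℝ X z b) (fderiv ℝ (fderiv ℝ X) z a c)) := by
    intro b c
    have h1 := (hD2.clm_apply (hasFDerivAt_const b z)).clm_apply (hasFDerivAt_const c z)
    have h2 := (hΓ.clm_apply (hb b)).clm_apply (hb c)
    refine ⟨_, h1.add h2, fun a => ?_⟩
    simp only [add_apply, ContinuousLinearMap.flip_apply,
      ContinuousLinearMap.comp_apply, Function.comp_apply, christoffelL_apply,
      zero_apply, map_zero, zero_add]
    abel
  -- differentiate the relation between the two connections
  have key : ∀ a b c d, ∀ L : Euc m →L[ℝ] Euc n, HasFDerivAt (fun y => hessianAlong G X y b c) L z →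
      G (X z) (L a + christoffel G (X z) (fderiv ℝ X z a) (hessianAlong G X z b c))
        (fderiv ℝ X z d) =
      h z (fderiv ℝ (christoffelL h) z a b c + christoffel h z a (christoffel h z b c)) d
        - G (X z) (normalHessian G X z b c) (normalHessian G X z a d) := by
    intro a b c d L hL
    obtain ⟨L₁, hL₁, hL₁'⟩ := hX.hasFDerivAt_inner hz hL (hb d)
    have h2 : HasFDerivAt (fun y => christoffel h y b c)
        (((fderiv ℝ (christoffelL h) z).flip b).flip c) z := by
      refine ((hΓh.clm_apply (hasFDerivAt_const b z)).clm_apply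
        (hasFDerivAt_const c z)).congr_fderiv ?_
      ext w; simp
    have h3 := ((hm.differentiableAt hz).hasFDerivAt.clm_apply h2).clm_apply
      (hasFDerivAt_const d z)
    have heq : (fun y => G (X y) (hessianAlong G X y b c) (fderiv ℝ X y d)) =ᶠ[𝓝 z]
        fun y => h y (christoffel h y b c) d := by
      filter_upwards [hX.mem_nhds hz] with y hy using hX.inner_hessianAlong hy b c d
    have h4 := congrArg (fun L => L a) (hL₁.unique (h3.congr_of_eventuallyEq heq))
    simp only [hL₁', add_apply, ContinuousLinearMap.flip_apply,
      ContinuousLinearMap.comp_apply, zero_apply, map_zero, zero_add,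
      hm.fderiv_eq hz] at h4
    have h5 : G (X z) (hessianAlong G X z b c) (hessianAlong G X z a d) =
        h z (christoffel h z b c) (christoffel h z a d) +
          G (X z) (normalHessian G X z b c) (normalHessian G X z a d) := by
      have e : ∀ p q, hessianAlong G X z p q =
          fderiv ℝ X z (christoffel h z p q) + normalHessian G X z p q := by
        intro p q; rw [normalHessian]; abel
      have e1 := hX.inner_normalHessian hz
      have e2 : ∀ p q r, G (X z) (fderiv ℝ X z r) (normalHessian G X z p q) = 0 := by
        intro p q r; rw [hX.metric.symm _ hXz, e1]
      rw [e b c, e a d]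
      simp only [map_add, add_apply, e1, e2, hh, pullMetric_apply]
      ring
    have h6 : (fderiv ℝ (fderiv ℝ X) z).flip d a +
        christoffel G (X z) (fderiv ℝ X z a) (fderiv ℝ X z d) = hessianAlong G X z a d := rfl
    rw [ContinuousLinearMap.flip_apply] at h6
    simp only [h6, h5] at h4
    simp only [map_add, add_apply] at h4 ⊢
    linarith
  obtain ⟨L₁, hL₁, hL₁'⟩ := hA v w
  obtain ⟨L₂, hL₂, hL₂'⟩ := hA u w
  have e1 := key u v w x L₁ hL₁
  have e2 := key v u w x L₂ hL₂
  have e3 : curvature G (X z) (fderiv ℝ X z u) (fderiv ℝ X z v) (fderiv ℝ X z w) =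
      (L₁ u + christoffel G (X z) (fderiv ℝ X z u) (hessianAlong G X z v w)) -
      (L₂ v + christoffel G (X z) (fderiv ℝ X z v) (hessianAlong G X z u w)) := by
    rw [hX.metric.curvature_eq hXz, hL₁', hL₂', hD3 v u w, hX.fderiv_fderiv_symm hz v u]
    simp only [hessianAlong, ← christoffelL_apply, map_add]
    abel
  rw [e3, map_sub, sub_apply, e1, e2, hm.curvature_eq hz]
  simp only [map_add, map_sub, add_apply, sub_apply]
  ring

end IsImmersionOn

end Gauss

end Coordinates

section CurvatureSymmetries
variable {m n : ℕ} {G : Euc m → Euc m →L[ℝ] Euc m →L[ℝ] ℝ} {U : Set (Euc m)} {y : Euc m}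

namespace IsMetricOn

theorem curvature_swap (hG : IsMetricOn G U) (hy : y ∈ U) (u v w : Euc m) :
    curvature G y v u w = -curvature G y u v w := by
  rw [hG.curvature_eq hy, hG.curvature_eq hy]; abel

theorem curvature_smul_add_smul (hG : IsMetricOn G U) (hy : y ∈ U) (a b : ℝ) (u u' v w : Euc m) :
    curvature G y (a • u + b • u') v w = a • curvature G y u v w + b • curvature G y u' v w := by
  simp only [hG.curvature_eq hy, ← christoffelL_apply, map_add, map_smul, add_apply, smul_apply]
  module

theorem curvature_right (hG : IsMetricOn G U) (hy : y ∈ U) (a b : ℝ) (u v w w' : Euc m) :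
    curvature G y u v (a • w + b • w') = a • curvature G y u v w + b • curvature G y u v w' := by
  simp only [hG.curvature_eq hy, ← christoffelL_apply, map_add, map_smul]
  module

/-- The curvature endomorphism is skew-adjoint: `½ G(w, w)` has symmetric second derivative. -/
theorem inner_curvature_self (hG : IsMetricOn G U) (hy : y ∈ U) (u v w : Euc m) :
    G y (curvature G y u v w) w = 0 := by
  have hΓ : HasFDerivAt (christoffelL G) (fderiv ℝ (christoffelL G) y) y :=
    ((hG.contDiffAt_christoffelL hy).differentiableAt (by simp)).hasFDerivAt
  have hd2 : HasFDerivAt (fderiv ℝ G) (fderiv ℝ (fderiv ℝ G) y) y :=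
    (((hG.contDiffAt hy).fderiv_right (m := ∞) (by simp)).differentiableAt (by simp)).hasFDerivAt
  have key : ∀ a b, fderiv ℝ (fderiv ℝ G) y a b w w =
      2 * (G y (fderiv ℝ (christoffelL G) y a b w + christoffel G y a (christoffel G y b w)) w
        + G y (christoffel G y b w) (christoffel G y a w)) := by
    intro a b
    have h1 := ((hd2.clm_apply (hasFDerivAt_const b y)).clm_apply
      (hasFDerivAt_const w y)).clm_apply (hasFDerivAt_const w y)
    have h2 := (((hG.differentiableAt hy).hasFDerivAt.clm_apply
      ((hΓ.clm_apply (hasFDerivAt_const b y)).clm_apply (hasFDerivAt_const w y))).clm_apply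
      (hasFDerivAt_const w y)).const_mul 2
    have h3 : (fun z => fderiv ℝ G z b w w) =ᶠ[𝓝 y] fun z => 2 * G z (christoffelL G z b w) w := by
      filter_upwards [hG.mem_nhds hy] with z hz
      rw [hG.fderiv_eq hz, hG.symm z hz w, christoffelL_apply]; ring
    have h4 := congrArg (fun L => L a) (h1.unique (h2.congr_of_eventuallyEq h3))
    simp only [add_apply, ContinuousLinearMap.flip_apply, smul_apply,
      ContinuousLinearMap.comp_apply, zero_apply, map_zero, zero_add, smul_eq_mul] at h4
    rw [h4, hG.fderiv_eq hy]
    simp only [christoffelL_apply]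
    simp only [map_add, add_apply]
    ring
  have hs : fderiv ℝ (fderiv ℝ G) y u v w w = fderiv ℝ (fderiv ℝ G) y v u w w := by
    have := (hG.contDiffAt hy).isSymmSndFDerivAt
      (by simp; exact WithTop.coe_le_coe.2 (le_top : (2 : ℕ∞) ≤ ⊤))
    exact congrArg (fun L => L w w) (this u v)
  rw [key, key, hG.symm y hy (christoffel G y v w)] at hs
  rw [hG.curvature_eq hy]
  simp only [map_add, map_sub, add_apply, sub_apply] at hs ⊢
  linarith

theorem inner_curvature_skew (hG : IsMetricOn G U) (hy : y ∈ U) (u v w x : Euc m) :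
    G y (curvature G y u v w) x = -G y (curvature G y u v x) w := by
  have h := hG.inner_curvature_self hy u v ((1 : ℝ) • w + (1 : ℝ) • x)
  rw [hG.curvature_right hy] at h
  simp only [one_smul, map_add, add_apply, hG.inner_curvature_self hy] at h
  linarith

end IsMetricOn

end CurvatureSymmetries

/-! ### Metrics on plane domains -/

section Plane

/-- The sectional curvature of the coordinate plane spanned by `u` and `v` for a metric on an open
set of `ℝᵐ`. -/
def planeCurvature {m : ℕ} (G : Euc m → Euc m →L[ℝ] Euc m →L[ℝ] ℝ) (y u v : Euc m) : ℝ :=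
  G y (curvature G y u v v) u / (G y u u * G y v v - G y u v ^ 2)

/-- The determinant of two vectors of the plane. -/
def det2 (a b : Euc 2) : ℝ := a 0 * b 1 - a 1 * b 0

/-- The area density `√(det g_ij)`. -/
def areaDensity (h : Euc 2 → Euc 2 →L[ℝ] Euc 2 →L[ℝ] ℝ) (z : Euc 2) : ℝ := √(gram h z).det

variable {h : Euc 2 → Euc 2 →L[ℝ] Euc 2 →L[ℝ] ℝ} {U : Set (Euc 2)} {z : Euc 2}

theorem det_gram (h : Euc 2 → Euc 2 →L[ℝ] Euc 2 →L[ℝ] ℝ) (z : Euc 2) : (gram h z).det =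
    h z (stdVec 0) (stdVec 0) * h z (stdVec 1) (stdVec 1) -
      h z (stdVec 0) (stdVec 1) * h z (stdVec 1) (stdVec 0) := by
  simp [gram, Matrix.det_fin_two]

theorem eq_smul_add_smul (v : Euc 2) : v = v 0 • stdVec 0 + v 1 • stdVec 1 := by
  conv_lhs => rw [← sum_smul_stdVec v]
  simp [Fin.sum_univ_two]

namespace IsMetricOn

theorem areaDensity_pos (hh : IsMetricOn h U) (hz : z ∈ U) : 0 < areaDensity h z :=
  Real.sqrt_pos.2 (hh.gram_det_pos hz)

theorem sq_areaDensity (hh : IsMetricOn h U) (hz : z ∈ U) :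
    areaDensity h z ^ 2 = (gram h z).det := Real.sq_sqrt (hh.gram_det_pos hz).le

theorem apply_two (hh : IsMetricOn h U) (hz : z ∈ U) (u v : Euc 2) :
    h z u v = u 0 * v 0 * h z (stdVec 0) (stdVec 0) +
      (u 0 * v 1 + u 1 * v 0) * h z (stdVec 0) (stdVec 1) +
        u 1 * v 1 * h z (stdVec 1) (stdVec 1) := by
  rw [bilin_eq_sum, Fin.sum_univ_two, Fin.sum_univ_two, Fin.sum_univ_two,
    hh.symm z hz (stdVec 1) (stdVec 0)]
  ring

/-- In dimension two, the area form and the metric are related by a Gram determinant. -/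
theorem gram_det_mul (hh : IsMetricOn h U) (hz : z ∈ U) (a b x : Euc 2) :
    h z a a * h z x b - h z a b * h z x a = areaDensity h z ^ 2 * det2 a b * det2 a x := by
  rw [hh.sq_areaDensity hz, det_gram, hh.symm z hz (stdVec 1) (stdVec 0), hh.apply_two hz a a,
    hh.apply_two hz x b, hh.apply_two hz a b, hh.apply_two hz x a, det2, det2]
  ring

theorem gram_det_sq (hh : IsMetricOn h U) (hz : z ∈ U) (a b : Euc 2) :
    h z a a * h z b b - h z a b ^ 2 = (areaDensity h z * det2 a b) ^ 2 := by
  have := hh.gram_det_mul hz a b b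
  rw [hh.symm z hz b a] at this
  linear_combination this

/-- On a surface, the sectional curvature does not depend on the basis of the tangent plane. -/
theorem planeCurvature_basis (hh : IsMetricOn h U) (hz : z ∈ U) {a b : Euc 2}
    (hab : det2 a b ≠ 0) :
    planeCurvature h z a b = planeCurvature h z (stdVec 0) (stdVec 1) := by
  set R := fun w => curvature h z (stdVec 0) (stdVec 1) w with hR
  have h1 : ∀ w, curvature h z a b w = det2 a b • R w := by
    intro w
    have h00 : ∀ e, curvature h z e e w = 0 := fun e => by
      rw [hh.curvature_eq hz]; abel
    conv_lhs => rw [eq_smul_add_smul a, eq_smul_add_smul b]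
    rw [hh.curvature_smul_add_smul hz, hh.curvature_swap hz (_ + _) (stdVec 0),
      hh.curvature_swap hz (_ + _) (stdVec 1), hh.curvature_smul_add_smul hz,
      hh.curvature_smul_add_smul hz, h00, h00,
      hh.curvature_swap hz (stdVec 0) (stdVec 1)]
    simp only [hR, det2]
    module
  have h2 : h z (R b) a = det2 a b * h z (R (stdVec 1)) (stdVec 0) := by
    conv_lhs => rw [eq_smul_add_smul a, eq_smul_add_smul b]
    simp only [hR]
    rw [hh.curvature_right hz]
    simp only [map_add, map_smul, add_apply, smul_apply, smul_eq_mul,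
      hh.inner_curvature_self hz]
    rw [hh.inner_curvature_skew hz _ _ (stdVec 0) (stdVec 1), det2]
    ring
  have h01 : det2 (stdVec 0) (stdVec 1) = 1 := by simp [det2]
  rw [planeCurvature, planeCurvature, hh.gram_det_sq hz, hh.gram_det_sq hz, h1, h01]
  simp only [map_smul, smul_apply, smul_eq_mul, h2]
  have := (hh.areaDensity_pos hz).ne'
  simp only [hR]
  field_simp

end IsMetricOn

theorem det2_map (A : Euc 2 →L[ℝ] Euc 2) (a b : Euc 2) :
    det2 (A a) (A b) = det2 (A (stdVec 0)) (A (stdVec 1)) * det2 a b := by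
  conv_lhs => rw [eq_smul_add_smul a, eq_smul_add_smul b]
  simp only [map_add, map_smul, det2, PiLp.add_apply, PiLp.smul_apply, smul_eq_mul]
  ring

theorem det2_ne_zero_of_injective {A : Euc 2 →L[ℝ] Euc 2} (hA : Function.Injective A) :
    det2 (A (stdVec 0)) (A (stdVec 1)) ≠ 0 := by
  obtain ⟨B, hB⟩ := LinearMap.exists_rightInverse_of_surjective (A : Euc 2 →ₗ[ℝ] Euc 2)
    (LinearMap.range_eq_top.2 ((LinearMap.injective_iff_surjective).1 hA))
  intro h0
  have h1 := det2_map A (B (stdVec 0)) (B (stdVec 1))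
  have h2 : ∀ x, A (B x) = x := fun x => congrArg (fun L => L x) hB
  rw [h0, h2, h2] at h1
  simp [det2] at h1

/-- Invariance of the Gauss curvature under local diffeomorphisms: the case of the Gauss equation
in which there is no normal direction. -/
theorem IsImmersionOn.planeCurvature_pullMetric {U : Set (Euc 2)} {X : Euc 2 → Euc 2}
    {V : Set (Euc 2)} (hX : IsImmersionOn h U X V) (hz : z ∈ V) :
    planeCurvature (Willmore.pullMetric h X) z (stdVec 0) (stdVec 1) =
      planeCurvature h (X z) (stdVec 0) (stdVec 1) := by
  have hsurj : Function.Surjective (fderiv ℝ X z) :=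
    (LinearMap.injective_iff_surjective (f := (fderiv ℝ X z : Euc 2 →ₗ[ℝ] Euc 2))).1
      (hX.injective z hz)
  have hN : ∀ u v, normalHessian h X z u v = 0 := by
    intro u v
    obtain ⟨w, hw⟩ := hsurj (normalHessian h X z u v)
    have := hX.inner_normalHessian hz u v w
    rwa [hw, hX.metric.self_eq_zero (hX.mapsTo hz)] at this
  have := hX.gauss_equation hz (stdVec 0) (stdVec 1) (stdVec 1) (stdVec 0)
  simp only [hN, map_zero, sub_zero, add_zero] at this
  rw [← hX.metric.planeCurvature_basis (hX.mapsTo hz)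
    (det2_ne_zero_of_injective (hX.injective z hz)), planeCurvature, planeCurvature, this]
  simp only [pullMetric_apply]

/-! ### The connection form -/

/-- The connection form of the Levi-Civita connection with respect to the frame obtained by
normalizing the constant vector field `a`: the rate at which the direction of `a` turns, relative to
parallel transport, when moving along `w`. It is junk for `a = 0`. -/
def connForm (h : Euc 2 → Euc 2 →L[ℝ] Euc 2 →L[ℝ] ℝ) (z a w : Euc 2) : ℝ :=
  areaDensity h z * det2 a (christoffel h z w a) / h z a a

/-- The angle between two vectors for the bilinear form `B`. -/
def metricAngle (B : Euc 2 →L[ℝ] Euc 2 →L[ℝ] ℝ) (u v : Euc 2) : ℝ :=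
  Real.arccos (B u v / (√(B u u) * √(B v v)))

theorem connForm_add (h : Euc 2 → Euc 2 →L[ℝ] Euc 2 →L[ℝ] ℝ) (z a w w' : Euc 2) (r r' : ℝ) :
    connForm h z a (r • w + r' • w') = r * connForm h z a w + r' * connForm h z a w' := by
  simp only [connForm, det2, ← christoffelL_apply, map_add, map_smul, add_apply, smul_apply,
    PiLp.add_apply, PiLp.smul_apply, smul_eq_mul]
  ring

theorem connForm_smul_left (h : Euc 2 → Euc 2 →L[ℝ] Euc 2 →L[ℝ] ℝ) (z a w : Euc 2) {r : ℝ}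
    (hr : r ≠ 0) : connForm h z (r • a) w = connForm h z a w := by
  simp only [connForm, det2, ← christoffelL_apply, map_smul, smul_apply,
    PiLp.smul_apply, smul_eq_mul]
  rcases eq_or_ne (h z a a) 0 with h0 | h0
  · simp [h0]
  · field_simp

namespace IsMetricOn

theorem exists_hasFDerivAt_apply (hh : IsMetricOn h U) (hz : z ∈ U) (a b : Euc 2) :
    ∃ L : Euc 2 →L[ℝ] ℝ, HasFDerivAt (fun y => h y a b) L z ∧ ∀ w, L w =
      h z (christoffel h z w a) b + h z a (christoffel h z w b) := by
  refine ⟨_, ((hh.differentiableAt hz).hasFDerivAt.clm_apply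
    (hasFDerivAt_const a z)).clm_apply (hasFDerivAt_const b z), fun w => ?_⟩
  simp [hh.fderiv_eq hz]

theorem exists_hasFDerivAt_areaDensity (hh : IsMetricOn h U) (hz : z ∈ U) :
    ∃ L : Euc 2 →L[ℝ] ℝ, HasFDerivAt (areaDensity h) L z ∧ ∀ w, L w =
      areaDensity h z * (christoffel h z w (stdVec 0) 0 + christoffel h z w (stdVec 1) 1) := by
  obtain ⟨L0, h0, h0'⟩ := hh.exists_hasFDerivAt_apply hz (stdVec 0) (stdVec 0)
  obtain ⟨L1, h1, h1'⟩ := hh.exists_hasFDerivAt_apply hz (stdVec 0) (stdVec 1)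
  obtain ⟨L2, h2, h2'⟩ := hh.exists_hasFDerivAt_apply hz (stdVec 1) (stdVec 1)
  obtain ⟨L3, h3, h3'⟩ := hh.exists_hasFDerivAt_apply hz (stdVec 1) (stdVec 0)
  have hpos := hh.areaDensity_pos hz
  have hD : HasFDerivAt (fun y => (gram h y).det) _ z :=
    ((h0.mul h2).sub (h1.mul h3)).congr_of_eventuallyEq
      (Filter.Eventually.of_forall fun y => by simp [det_gram])
  refine ⟨_, hD.sqrt (hh.gram_det_pos hz).ne', fun w => ?_⟩
  have hs : √(gram h z).det = areaDensity h z := rfl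
  rw [hs]
  have hsq := hh.sq_areaDensity hz
  rw [det_gram] at hsq
  simp only [smul_apply, sub_apply, add_apply, smul_eq_mul, h0', h1', h2', h3']
  rw [hh.apply_two hz (christoffel h z w (stdVec 0)) (stdVec 0),
    hh.apply_two hz (stdVec 0) (christoffel h z w (stdVec 0)),
    hh.apply_two hz (christoffel h z w (stdVec 0)) (stdVec 1),
    hh.apply_two hz (stdVec 1) (christoffel h z w (stdVec 0)),
    hh.apply_two hz (christoffel h z w (stdVec 1)) (stdVec 0),
    hh.apply_two hz (stdVec 0) (christoffel h z w (stdVec 1)),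
    hh.apply_two hz (christoffel h z w (stdVec 1)) (stdVec 1),
    hh.apply_two hz (stdVec 1) (christoffel h z w (stdVec 1))]
  rw [hh.symm z hz (stdVec 1) (stdVec 0)] at hsq ⊢
  simp
  field_simp
  rw [hsq]
  ring

/-- Turning angle: the angle from `a` to `b` changes at the rate given by the difference of the
connection forms of the two frames. Positive orientation of `(a, b)` fixes the sign, since the angle
itself is unoriented. -/
theorem exists_hasFDerivAt_metricAngle (hh : IsMetricOn h U) (hz : z ∈ U) {a b : Euc 2}
    (hab : 0 < det2 a b) :
    ∃ L : Euc 2 →L[ℝ] ℝ, HasFDerivAt (fun y => metricAngle (h y) a b) L z ∧ ∀ w, L w =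
      connForm h z b w - connForm h z a w := by
  obtain ⟨L0, h0, h0'⟩ := hh.exists_hasFDerivAt_apply hz a a
  obtain ⟨L1, h1, h1'⟩ := hh.exists_hasFDerivAt_apply hz a b
  obtain ⟨L2, h2, h2'⟩ := hh.exists_hasFDerivAt_apply hz b b
  have hpos := hh.areaDensity_pos hz
  have ha : a ≠ 0 := by rintro rfl; simp [det2] at hab
  have hb : b ≠ 0 := by rintro rfl; simp [det2] at hab
  have hE := hh.pos z hz a ha
  have hF := hh.pos z hz b hb
  have hgram := hh.gram_det_sq hz a b
  set A := areaDensity h z with hA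
  set d := det2 a b with hd
  set E := h z a a with hEdef
  set F := h z b b with hFdef
  set C := h z a b with hCdef
  have hsE : 0 < √E := Real.sqrt_pos.2 hE
  have hsF : 0 < √F := Real.sqrt_pos.2 hF
  have hEs : √E ^ 2 = E := Real.sq_sqrt hE.le
  have hFs : √F ^ 2 = F := Real.sq_sqrt hF.le
  have hq : 1 - (C / (√E * √F)) ^ 2 = (A * d / (√E * √F)) ^ 2 := by
    field_simp
    rw [hEs, hFs, ← mul_pow, ← hgram]
  have hAd : 0 < A * d / (√E * √F) := by positivity
  have hlt : (C / (√E * √F)) ^ 2 < 1 := by nlinarith [sq_pos_of_pos hAd]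
  have hne1 : C / (√E * √F) ≠ -1 := by intro h; rw [h] at hlt; norm_num at hlt
  have hne2 : C / (√E * √F) ≠ 1 := by intro h; rw [h] at hlt; norm_num at hlt
  have hc := h1.mul ((hasDerivAt_inv (mul_pos hsE hsF).ne').comp_hasFDerivAt z
    ((h0.sqrt hE.ne').mul (h2.sqrt hF.ne')))
  have hc' := (Real.hasDerivAt_arccos hne1 hne2).comp_hasFDerivAt z
    (hc.congr_of_eventuallyEq (Filter.Eventually.of_forall fun y => by
      simp [div_eq_mul_inv] : (fun y => h y a b / (√(h y a a) * √(h y b b))) =ᶠ[𝓝 z] _))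
  refine ⟨_, hc', fun w => ?_⟩
  rw [hq, Real.sqrt_sq hAd.le]
  have e1 := hh.gram_det_mul hz a b (christoffel h z w a)
  have e2 := hh.gram_det_mul hz b a (christoffel h z w b)
  have hdba : det2 b a = -d := by simp only [hd, det2]; ring
  rw [hdba, hh.symm z hz b a, hh.symm z hz (christoffel h z w b) a] at e2
  simp only [← hA, ← hd, ← hEdef, ← hFdef, ← hCdef] at e1 e2
  simp only [connForm, ← hA, ← hEdef, ← hFdef]
  simp only [smul_apply, add_apply, smul_eq_mul, h0', h1', h2',
    hh.symm z hz a (christoffel h z w a), hh.symm z hz b (christoffel h z w b)]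
  have hval : ((fun y : ℝ => y⁻¹) ∘
      ((fun y => √(h y a a)) * fun y => √(h y b b))) z = (√E * √F)⁻¹ := rfl
  rw [hval, ← hCdef]
  have hX : det2 a (christoffel h z w a) =
      (E * h z (christoffel h z w a) b - C * h z (christoffel h z w a) a) / (A ^ 2 * d) := by
    rw [e1]; field_simp
  have hY : det2 b (christoffel h z w b) =
      -(F * h z a (christoffel h z w b) - C * h z (christoffel h z w b) b) / (A ^ 2 * d) := by
    rw [e2]; field_simp
  rw [hX, hY]
  clear_value E F C A d
  generalize √E = e at *
  generalize √F = f at *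
  subst hEs hFs
  field_simp
  ring

end IsMetricOn

end Plane

section PlaneIntegrals
variable {h : Euc 2 → Euc 2 →L[ℝ] Euc 2 →L[ℝ] ℝ} {U : Set (Euc 2)} {z : Euc 2}

namespace IsMetricOn

theorem contDiffAt_areaDensity (hh : IsMetricOn h U) (hz : z ∈ U) :
    ContDiffAt ℝ ∞ (areaDensity h) z :=
  (contDiffAt_det fun i j => hh.contDiffAt_gram hz i j).sqrt (hh.gram_det_pos hz).ne'

theorem contDiffAt_connForm (hh : IsMetricOn h U) (hz : z ∈ U) {a : Euc 2} (ha : a ≠ 0)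
    (w : Euc 2) : ContDiffAt ℝ ∞ (fun y => connForm h y a w) z := by
  have hc : ContDiffAt ℝ ∞ (fun y => christoffel h y w a) z :=
    ((hh.contDiffAt_christoffelL hz).clm_apply contDiffAt_const).clm_apply contDiffAt_const
  have hi : ∀ i, ContDiffAt ℝ ∞ (fun y => christoffel h y w a i) z := fun i =>
    (EuclideanSpace.proj i : Euc 2 →L[ℝ] ℝ).contDiff.contDiffAt.comp z hc
  refine ((hh.contDiffAt_areaDensity hz).mul ?_).div
    (((hh.contDiffAt hz).clm_apply contDiffAt_const).clm_apply contDiffAt_const)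
    (hh.pos z hz a ha).ne'
  exact (contDiffAt_const.mul (hi 1)).sub (contDiffAt_const.mul (hi 0))

theorem exists_hasFDerivAt_connForm (hh : IsMetricOn h U) (hz : z ∈ U) (w : Euc 2) :
    ∃ L : Euc 2 →L[ℝ] ℝ, HasFDerivAt (fun y => connForm h y (stdVec 0) w) L z ∧ ∀ u, L u =
      areaDensity h z / h z (stdVec 0) (stdVec 0) *
        (fderiv ℝ (christoffelL h) z u w (stdVec 0) 1 + christoffel h z w (stdVec 0) 1 *
          (christoffel h z u (stdVec 0) 0 + christoffel h z u (stdVec 1) 1 -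
            2 * h z (christoffel h z u (stdVec 0)) (stdVec 0) / h z (stdVec 0) (stdVec 0))) := by
  obtain ⟨LA, hA, hA'⟩ := hh.exists_hasFDerivAt_areaDensity hz
  obtain ⟨LE, hE, hE'⟩ := hh.exists_hasFDerivAt_apply hz (stdVec 0) (stdVec 0)
  have hΓ := ((((hh.contDiffAt_christoffelL hz).differentiableAt (by simp)).hasFDerivAt.clm_apply
    (hasFDerivAt_const w z)).clm_apply (hasFDerivAt_const (stdVec (0 : Fin 2)) z))
  have hΓ1 := (EuclideanSpace.proj 1 : Euc 2 →L[ℝ] ℝ).hasFDerivAt.comp z hΓ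
  have hpos := hh.pos z hz (stdVec 0) (by simp)
  have hq := (hA.mul hΓ1).mul ((hasDerivAt_inv hpos.ne').comp_hasFDerivAt z hE)
  refine ⟨_, hq.congr_of_eventuallyEq (Filter.Eventually.of_forall fun y => ?_), fun u => ?_⟩
  · simp [connForm, det2, div_eq_mul_inv]
  · simp [hA', hE', hh.symm z hz (stdVec 0) (christoffel h z u (stdVec 0))]
    field_simp
    ring

/-- The structure equation of a surface: the curvature is the exterior derivative of the connection
form. -/
theorem fderiv_connForm_sub (hh : IsMetricOn h U) (hz : z ∈ U) :
    fderiv ℝ (fun y => connForm h y (stdVec 0) (stdVec 1)) z (stdVec 0) -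
      fderiv ℝ (fun y => connForm h y (stdVec 0) (stdVec 0)) z (stdVec 1) =
      -(planeCurvature h z (stdVec 0) (stdVec 1) * areaDensity h z) := by
  obtain ⟨L1, h1, h1'⟩ := hh.exists_hasFDerivAt_connForm hz (stdVec 1)
  obtain ⟨L0, h0, h0'⟩ := hh.exists_hasFDerivAt_connForm hz (stdVec 0)
  rw [h1.fderiv, h0.fderiv, h1', h0']
  have hpos := hh.pos z hz (stdVec 0) (by simp)
  have hA := hh.areaDensity_pos hz
  set ρ := curvature h z (stdVec 0) (stdVec 1) (stdVec 0) with hρ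
  have e1 : h z ρ (stdVec 0) = 0 := hh.inner_curvature_self hz _ _ _
  have e2 : h z ρ (stdVec 1) = -(planeCurvature h z (stdVec 0) (stdVec 1) *
      areaDensity h z ^ 2) := by
    rw [hρ, hh.inner_curvature_skew hz, planeCurvature, hh.gram_det_sq hz]
    have : det2 (stdVec 0) (stdVec 1) = 1 := by simp [det2]
    rw [this]
    field_simp
  have e3 : ρ 1 = -(planeCurvature h z (stdVec 0) (stdVec 1) * h z (stdVec 0) (stdVec 0)) := by
    have hsq := hh.sq_areaDensity hz
    rw [det_gram, hh.symm z hz (stdVec 1) (stdVec 0)] at hsq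
    rw [hh.apply_two hz] at e1 e2
    simp at e1 e2
    have : ρ 1 * areaDensity h z ^ 2 = -(planeCurvature h z (stdVec 0) (stdVec 1) *
        h z (stdVec 0) (stdVec 0)) * areaDensity h z ^ 2 := by
      linear_combination h z (stdVec 0) (stdVec 0) * e2 - h z (stdVec 0) (stdVec 1) * e1
        + ρ 1 * hsq
    exact mul_right_cancel₀ (by positivity) this
  have hΓ : ∀ a v, christoffel h z a v =
      v 0 • christoffel h z a (stdVec 0) + v 1 • christoffel h z a (stdVec 1) := by
    intro a v
    conv_lhs => rw [eq_smul_add_smul v, ← christoffelL_apply, map_add, map_smul, map_smul]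
    simp
  have e4 : ρ 1 = fderiv ℝ (christoffelL h) z (stdVec 0) (stdVec 1) (stdVec 0) 1 -
      fderiv ℝ (christoffelL h) z (stdVec 1) (stdVec 0) (stdVec 0) 1 +
      (christoffel h z (stdVec 0) (stdVec 1) 0 * christoffel h z (stdVec 0) (stdVec 0) 1 +
       christoffel h z (stdVec 0) (stdVec 1) 1 * christoffel h z (stdVec 0) (stdVec 1) 1) -
      (christoffel h z (stdVec 0) (stdVec 0) 0 * christoffel h z (stdVec 0) (stdVec 1) 1 +
       christoffel h z (stdVec 0) (stdVec 0) 1 * christoffel h z (stdVec 1) (stdVec 1) 1) := by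
    rw [hρ, hh.curvature_eq hz, hΓ (stdVec 0) (christoffel _ _ _ _),
      hΓ (stdVec 1) (christoffel _ _ _ _), hh.christoffel_symm hz (stdVec 1) (stdVec 0)]
    simp
  rw [hh.apply_two hz (christoffel h z (stdVec 0) (stdVec 0)),
    hh.apply_two hz (christoffel h z (stdVec 1) (stdVec 0)),
    hh.christoffel_symm hz (stdVec 1) (stdVec 0)]
  have e5 := e3.symm.trans e4
  simp
  field_simp
  linear_combination -h z (stdVec 0) (stdVec 0) * e5

end IsMetricOn

theorem IsMetricOn.continuousOn_curvature_mul_areaDensity (hh : IsMetricOn h U) :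
    ContinuousOn (fun y => planeCurvature h y (stdVec 0) (stdVec 1) * areaDensity h y) U := by
  have h1 : ∀ w, ContinuousOn (fderiv ℝ fun y => connForm h y (stdVec 0) w) U := fun w =>
    ContDiffOn.continuousOn_fderiv_of_isOpen (n := ∞) (fun y hy =>
      (hh.contDiffAt_connForm hy (by simp) _).contDiffWithinAt) hh.isOpen (by simp)
  have h2 := (h1 (stdVec 1)).clm_apply (continuousOn_const (c := stdVec 0))
  have h3 := (h1 (stdVec 0)).clm_apply (continuousOn_const (c := stdVec 1))
  refine (h2.sub h3).neg.congr fun y hy => ?_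
  have := hh.fderiv_connForm_sub hy
  simp only [Pi.neg_apply, Pi.sub_apply]
  linarith

/-! ### Green's formula on the standard triangle -/

/-- The parametrization of the standard triangle by the unit square that contracts one side to the
vertex at the origin. -/
def squareMap (p : ℝ × ℝ) : Euc 2 := (p.1 * (1 - p.2)) • stdVec 0 + (p.1 * p.2) • stdVec 1

theorem squareMap_mem {p : ℝ × ℝ} (hp : p ∈ Set.Icc (0 : ℝ × ℝ) 1) :
    squareMap p ∈ stdTriangle := by
  obtain ⟨⟨h1, h2⟩, ⟨h3, h4⟩⟩ := hp
  simp at h1 h2 h3 h4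
  refine ⟨?_, ?_, ?_⟩
  · simp [squareMap]; exact mul_nonneg h1 (by linarith)
  · simp [squareMap]; positivity
  · simp [squareMap]; nlinarith

theorem hasFDerivAt_squareMap (p : ℝ × ℝ) : ∃ L : ℝ × ℝ →L[ℝ] Euc 2,
    HasFDerivAt squareMap L p ∧ L (1, 0) = (1 - p.2) • stdVec 0 + p.2 • stdVec 1 ∧
      L (0, 1) = p.1 • (stdVec 1 - stdVec 0) := by
  have h1 : HasFDerivAt (fun p : ℝ × ℝ => p.1) (ContinuousLinearMap.fst ℝ ℝ ℝ) p := hasFDerivAt_fst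
  have h2 : HasFDerivAt (fun p : ℝ × ℝ => p.2) (ContinuousLinearMap.snd ℝ ℝ ℝ) p := hasFDerivAt_snd
  refine ⟨_, ((h1.mul (h2.const_sub 1)).smul_const (stdVec 0)).add
    ((h1.mul h2).smul_const (stdVec 1)), ?_, ?_⟩
  · simp
  · simp [smul_sub]; abel

/-- Green's formula for the form `P dx + Q dy` on the standard triangle, whose area integral is
computed on the unit square through `squareMap`, of Jacobian `p.1`. -/
theorem green_triangle {P Q : Euc 2 → ℝ} (hU : IsOpen U) (htU : stdTriangle ⊆ U)
    (hP : ContDiffOn ℝ 1 P U) (hQ : ContDiffOn ℝ 1 Q U) :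
    ∫ p in Set.Icc (0 : ℝ × ℝ) 1, p.1 * (fderiv ℝ Q (squareMap p) (stdVec 0)
        - fderiv ℝ P (squareMap p) (stdVec 1)) =
      (∫ t in (0 : ℝ)..1, P (t • stdVec 0)) +
        (∫ t in (0 : ℝ)..1, (Q (stdVec 0 + t • (stdVec 1 - stdVec 0))
          - P (stdVec 0 + t • (stdVec 1 - stdVec 0)))) - ∫ t in (0 : ℝ)..1, Q (t • stdVec 1) := by
  set f : ℝ × ℝ → ℝ := fun p => p.1 * (Q (squareMap p) - P (squareMap p)) with hf
  set g : ℝ × ℝ → ℝ := fun p => -((1 - p.2) * P (squareMap p) + p.2 * Q (squareMap p)) with hg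
  have hsq : Continuous squareMap := by unfold squareMap; fun_prop
  have hmem : ∀ p ∈ Set.Icc (0 : ℝ × ℝ) 1, squareMap p ∈ U := fun p hp => htU (squareMap_mem hp)
  have hPd : ∀ p ∈ Set.Icc (0 : ℝ × ℝ) 1, HasFDerivAt P (fderiv ℝ P (squareMap p)) (squareMap p) :=
    fun p hp => ((hP.contDiffAt (hU.mem_nhds (hmem p hp))).differentiableAt (by simp)).hasFDerivAt
  have hQd : ∀ p ∈ Set.Icc (0 : ℝ × ℝ) 1, HasFDerivAt Q (fderiv ℝ Q (squareMap p)) (squareMap p) :=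
    fun p hp => ((hQ.contDiffAt (hU.mem_nhds (hmem p hp))).differentiableAt (by simp)).hasFDerivAt
  choose L hL hL1 hL2 using hasFDerivAt_squareMap
  have h1 : ∀ p : ℝ × ℝ, HasFDerivAt (fun p : ℝ × ℝ => p.1)
      (ContinuousLinearMap.fst ℝ ℝ ℝ) p := fun p => hasFDerivAt_fst
  have h2 : ∀ p : ℝ × ℝ, HasFDerivAt (fun p : ℝ × ℝ => p.2)
      (ContinuousLinearMap.snd ℝ ℝ ℝ) p := fun p => hasFDerivAt_snd
  have hfd : ∀ p ∈ Set.Icc (0 : ℝ × ℝ) 1, ∃ F : ℝ × ℝ →L[ℝ] ℝ, HasFDerivAt f F p ∧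
      F (1, 0) = Q (squareMap p) - P (squareMap p) + p.1 *
        (fderiv ℝ Q (squareMap p) (L p (1, 0)) - fderiv ℝ P (squareMap p) (L p (1, 0))) := by
    intro p hp
    refine ⟨_, (h1 p).mul (((hQd p hp).comp p (hL p)).sub ((hPd p hp).comp p (hL p))), ?_⟩
    simp
    ring
  have hgd : ∀ p ∈ Set.Icc (0 : ℝ × ℝ) 1, ∃ F : ℝ × ℝ →L[ℝ] ℝ, HasFDerivAt g F p ∧
      F (0, 1) = P (squareMap p) - Q (squareMap p) - ((1 - p.2) *
        fderiv ℝ P (squareMap p) (L p (0, 1)) + p.2 * fderiv ℝ Q (squareMap p) (L p (0, 1))) := by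
    intro p hp
    refine ⟨_, ((((h2 p).const_sub 1).mul ((hPd p hp).comp p (hL p))).add
      ((h2 p).mul ((hQd p hp).comp p (hL p)))).neg, ?_⟩
    simp
    ring
  have hPc : ContinuousOn (fun p => P (squareMap p)) (Set.Icc 0 1) :=
    hP.continuousOn.comp hsq.continuousOn hmem
  have hQc : ContinuousOn (fun p => Q (squareMap p)) (Set.Icc 0 1) :=
    hQ.continuousOn.comp hsq.continuousOn hmem
  have hdc : ContinuousOn (fun p : ℝ × ℝ => p.1 * (fderiv ℝ Q (squareMap p) (stdVec 0)
        - fderiv ℝ P (squareMap p) (stdVec 1))) (Set.Icc 0 1) := by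
    have hQ' := (hQ.continuousOn_fderiv_of_isOpen hU le_rfl).comp hsq.continuousOn hmem
    have hP' := (hP.continuousOn_fderiv_of_isOpen hU le_rfl).comp hsq.continuousOn hmem
    exact continuous_fst.continuousOn.mul
      ((hQ'.clm_apply continuousOn_const).sub (hP'.clm_apply continuousOn_const))
  choose! F hF hF' using hfd
  choose! K hK hK' using hgd
  have hpt : ∀ p ∈ Set.Icc (0 : ℝ × ℝ) 1, F p (1, 0) + K p (0, 1) =
      p.1 * (fderiv ℝ Q (squareMap p) (stdVec 0) - fderiv ℝ P (squareMap p) (stdVec 1)) := by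
    intro p hp
    rw [hF' p hp, hK' p hp, hL1, hL2]
    simp only [map_add, map_sub, map_smul, smul_eq_mul]
    ring
  have hIoo : ∀ p ∈ Set.Ioo (0 : ℝ) 1 ×ˢ Set.Ioo (0 : ℝ) 1, p ∈ Set.Icc (0 : ℝ × ℝ) 1 :=
    fun p hp => ⟨⟨hp.1.1.le, hp.2.1.le⟩, ⟨hp.1.2.le, hp.2.2.le⟩⟩
  have hcongr := MeasureTheory.setIntegral_congr_fun (μ := MeasureTheory.volume)
    measurableSet_Icc (fun p hp => (hpt p hp).symm)
  rw [hcongr, MeasureTheory.integral_divergence_prod_Icc_of_hasFDerivAt_of_le f g F K 0 1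
    zero_le_one (continuous_fst.continuousOn.mul (hQc.sub hPc))
    (((continuous_const.sub continuous_snd).continuousOn.mul hPc).add
      (continuous_snd.continuousOn.mul hQc)).neg
    (fun p hp => hF p (hIoo p hp)) (fun p hp => hK p (hIoo p hp))
    ((hdc.congr hpt).integrableOn_compact isCompact_Icc)]
  have s1 : ∀ t : ℝ, squareMap (t, 1) = t • stdVec 1 := by intro t; simp [squareMap]
  have s2 : ∀ t : ℝ, squareMap (t, 0) = t • stdVec 0 := by intro t; simp [squareMap]
  have s3 : ∀ t : ℝ, squareMap (1, t) = stdVec 0 + t • (stdVec 1 - stdVec 0) := by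
    intro t; simp only [squareMap]; module
  simp [hf, hg, s1, s2, s3]
  ring

theorem setIntegral_Icc_pos {f : ℝ × ℝ → ℝ} {a b : ℝ × ℝ} (hf : ContinuousOn f (Set.Icc a b))
    (h0 : ∀ p ∈ Set.Icc a b, 0 ≤ f p) {p : ℝ × ℝ}
    (hp : p ∈ Set.Ioo a.1 b.1 ×ˢ Set.Ioo a.2 b.2) (hfp : 0 < f p) :
    0 < ∫ x in Set.Icc a b, f x := by
  have hsub : Set.Ioo a.1 b.1 ×ˢ Set.Ioo a.2 b.2 ⊆ Set.Icc a b :=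
    fun p hp => ⟨⟨hp.1.1.le, hp.2.1.le⟩, ⟨hp.1.2.le, hp.2.2.le⟩⟩
  have hop : IsOpen (Set.Ioo a.1 b.1 ×ˢ Set.Ioo a.2 b.2) := isOpen_Ioo.prod isOpen_Ioo
  rw [MeasureTheory.setIntegral_pos_iff_support_of_nonneg_ae
    ((MeasureTheory.ae_restrict_iff' measurableSet_Icc).2 (Filter.Eventually.of_forall h0))
    (hf.integrableOn_compact isCompact_Icc)]
  have hV : IsOpen ((Set.Ioo a.1 b.1 ×ˢ Set.Ioo a.2 b.2) ∩ f ⁻¹' Set.Ioi 0) :=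
    (hf.mono hsub).isOpen_inter_preimage hop isOpen_Ioi
  refine (hV.measure_pos MeasureTheory.volume ⟨p, hp, hfp⟩).trans_le
    (MeasureTheory.measure_mono fun q hq => ⟨(ne_of_gt hq.2 : f q ≠ 0), hsub hq.1⟩)

/-! ### Angles -/

/-- A positive definite form on the plane is the pullback of the Euclidean inner product of `ℂ`. -/
theorem exists_isometry_complex {B : Euc 2 →L[ℝ] Euc 2 →L[ℝ] ℝ} (hs : ∀ u v, B u v = B v u)
    (hp : ∀ v, v ≠ 0 → 0 < B v v) :
    ∃ L : Euc 2 →L[ℝ] ℂ, Function.Bijective L ∧ ∀ u v, B u v = inner ℝ (L u) (L v) := by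
  have hB : IsMetricOn (fun _ : Euc 2 => B) Set.univ :=
    ⟨isOpen_univ, contDiffOn_const, fun _ _ => hs, fun _ _ => hp⟩
  set E := B (stdVec 0) (stdVec 0) with hE
  set F := B (stdVec 0) (stdVec 1) with hF
  set C := B (stdVec 1) (stdVec 1) with hC
  have hE0 : 0 < E := hp _ (by simp)
  have hD : 0 < E * C - F ^ 2 := by
    have := hB.gram_det_pos (Set.mem_univ (0 : Euc 2))
    rw [det_gram, hs (stdVec 1) (stdVec 0)] at this
    rw [sq]; exact this
  have ha : 0 < √E := Real.sqrt_pos.2 hE0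
  have ha2 : √E ^ 2 = E := Real.sq_sqrt hE0.le
  have hd2 : √(E * C - F ^ 2) ^ 2 = E * C - F ^ 2 := Real.sq_sqrt hD.le
  let L : Euc 2 →L[ℝ] ℂ := (EuclideanSpace.proj 0 : Euc 2 →L[ℝ] ℝ).smulRight (⟨√E, 0⟩ : ℂ) +
    (EuclideanSpace.proj 1 : Euc 2 →L[ℝ] ℝ).smulRight (⟨F / √E, √(E * C - F ^ 2) / √E⟩ : ℂ)
  have hL : ∀ u v, B u v = inner ℝ (L u) (L v) := by
    intro u v
    have := hB.apply_two (Set.mem_univ (0 : Euc 2)) u v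
    simp only [← hE, ← hF, ← hC] at this
    rw [this, Complex.inner]
    simp [L]
    field_simp
    rw [ha2, hd2]
    ring
  have hinj : Function.Injective L := by
    rw [injective_iff_map_eq_zero]
    intro v hv
    by_contra h0
    have := hp v h0
    rw [hL, hv] at this
    simp at this
  refine ⟨L, ⟨hinj, ?_⟩, hL⟩
  exact (LinearMap.injective_iff_surjective_of_finrank_eq_finrank (f := (L : Euc 2 →ₗ[ℝ] ℂ))
    (by simp [Complex.finrank_real_complex])).1 hinj

theorem metricAngle_eq_angle {B : Euc 2 →L[ℝ] Euc 2 →L[ℝ] ℝ} {L : Euc 2 →L[ℝ] ℂ}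
    (hL : ∀ u v, B u v = inner ℝ (L u) (L v)) (u v : Euc 2) :
    metricAngle B u v = InnerProductGeometry.angle (L u) (L v) := by
  rw [metricAngle, InnerProductGeometry.angle, hL, hL, hL, real_inner_self_eq_norm_sq,
    real_inner_self_eq_norm_sq, Real.sqrt_sq (norm_nonneg _), Real.sqrt_sq (norm_nonneg _)]

/-! ### The Gauss–Bonnet formula for a triangle -/

/-- The vertices of the standard triangle. -/
def triVertex : Fin 3 → Euc 2 := ![0, stdVec 0, stdVec 1]

/-- The side of the standard triangle opposite to the vertex `i`, as a vector, in the positive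
orientation of the boundary. -/
def sideVec (i : Fin 3) : Euc 2 := triVertex (i + 2) - triVertex (i + 1)

/-- The total geodesic curvature, for the metric `h`, of the side opposite to the vertex `i`,
traversed in the positive orientation of the boundary. -/
def sideTurning (h : Euc 2 → Euc 2 →L[ℝ] Euc 2 →L[ℝ] ℝ) (i : Fin 3) : ℝ :=
  ∫ s in (0 : ℝ)..1, connForm h (triVertex (i + 1) + s • sideVec i) (sideVec i) (sideVec i)

/-- The interior angle, for the metric `h`, at the vertex `i` of the standard triangle. -/
def vertexAngle (h : Euc 2 → Euc 2 →L[ℝ] Euc 2 →L[ℝ] ℝ) (i : Fin 3) : ℝ :=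
  metricAngle (h (triVertex i)) (triVertex (i + 1) - triVertex i) (triVertex (i + 2) - triVertex i)

/-- Continuity of functions along a segment in the standard triangle. -/
theorem continuousOn_segment {f : Euc 2 → ℝ} (hf : ∀ y ∈ U, ContDiffAt ℝ ∞ f y) {a w : Euc 2}
    (haw : ∀ s ∈ Set.Icc (0 : ℝ) 1, a + s • w ∈ U) :
    ContinuousOn (fun s : ℝ => f (a + s • w)) (Set.uIcc 0 1) := by
  rw [Set.uIcc_of_le zero_le_one]
  intro s hs
  refine ContinuousAt.continuousWithinAt ?_
  exact ContinuousAt.comp (g := f) (f := fun s : ℝ => a + s • w)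
    (hf _ (haw s hs)).continuousAt (by fun_prop)

/-- Integrated form of the turning angle formula. -/
theorem IsMetricOn.integral_connForm_sub (hh : IsMetricOn h U) {b c : Euc 2} (hbc : 0 < det2 b c)
    {a w : Euc 2} (haw : ∀ s ∈ Set.Icc (0 : ℝ) 1, a + s • w ∈ U) :
    (∫ s in (0 : ℝ)..1, connForm h (a + s • w) b w) =
      (∫ s in (0 : ℝ)..1, connForm h (a + s • w) c w) -
        (metricAngle (h (a + w)) b c - metricAngle (h a) b c) := by
  have hb : b ≠ 0 := by rintro rfl; simp [det2] at hbc
  have hc : c ≠ 0 := by rintro rfl; simp [det2] at hbc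
  have hcb := continuousOn_segment (fun y hy => hh.contDiffAt_connForm hy hb w) haw
  have hcc := continuousOn_segment (fun y hy => hh.contDiffAt_connForm hy hc w) haw
  have hder : ∀ s ∈ Set.uIcc (0 : ℝ) 1,
      HasDerivAt (fun s : ℝ => metricAngle (h (a + s • w)) b c)
        (connForm h (a + s • w) c w - connForm h (a + s • w) b w) s := by
    intro s hs
    rw [Set.uIcc_of_le zero_le_one] at hs
    obtain ⟨L, hL, hL'⟩ := hh.exists_hasFDerivAt_metricAngle (haw s hs) hbc
    have hline : HasDerivAt (fun s : ℝ => a + s • w) w s := by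
      simpa using ((hasDerivAt_id s).smul_const w).const_add a
    rw [← hL']
    exact hL.comp_hasDerivAt s hline
  have := intervalIntegral.integral_eq_sub_of_hasDerivAt hder (hcc.sub hcb).intervalIntegrable
  rw [intervalIntegral.integral_sub hcc.intervalIntegrable hcb.intervalIntegrable] at this
  simp only [one_smul, zero_smul, add_zero] at this
  linarith

/-- The local Gauss–Bonnet formula for a triangle, with the integral over the triangle computed in
the coordinates of `squareMap`. It is Green's formula for the connection form of the frame along
`stdVec 0`; on each side this frame is compared with the tangent of the side. -/
theorem IsMetricOn.gaussBonnet_triangle (hh : IsMetricOn h U) (hU : stdTriangle ⊆ U) :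
    ∫ p in Set.Icc (0 : ℝ × ℝ) 1, p.1 * (planeCurvature h (squareMap p) (stdVec 0) (stdVec 1) *
        areaDensity h (squareMap p)) =
      ∑ i, vertexAngle h i - Real.pi - ∑ i, sideTurning h i := by
  have he0 : (stdVec 0 : Euc 2) ≠ 0 := by simp
  have hP : ContDiffOn ℝ 1 (fun y => connForm h y (stdVec 0) (stdVec 0)) U := fun y hy =>
    ((hh.contDiffAt_connForm hy he0 _).of_le (by simp)).contDiffWithinAt
  have hQ : ContDiffOn ℝ 1 (fun y => connForm h y (stdVec 0) (stdVec 1)) U := fun y hy =>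
    ((hh.contDiffAt_connForm hy he0 _).of_le (by simp)).contDiffWithinAt
  have hG := green_triangle hh.isOpen hU hP hQ
  have hc := MeasureTheory.setIntegral_congr_fun (μ := MeasureTheory.volume)
    (measurableSet_Icc (a := (0 : ℝ × ℝ)) (b := 1))
    (f := fun p => p.1 * (fderiv ℝ (fun y => connForm h y (stdVec 0) (stdVec 1)) (squareMap p)
      (stdVec 0) - fderiv ℝ (fun y => connForm h y (stdVec 0) (stdVec 0)) (squareMap p)
      (stdVec 1)))
    (g := fun p => -(p.1 * (planeCurvature h (squareMap p) (stdVec 0) (stdVec 1) *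
        areaDensity h (squareMap p))))
    (fun p hp => by simp only [hh.fderiv_connForm_sub (hU (squareMap_mem hp))]; ring)
  rw [hc, MeasureTheory.integral_neg] at hG
  have seg : ∀ a w : Euc 2, a ∈ stdTriangle → a + w ∈ stdTriangle →
      ∀ s ∈ Set.Icc (0 : ℝ) 1, a + s • w ∈ U := by
    intro a w ha haw s hs
    apply hU
    obtain ⟨a1, a2, a3⟩ := ha
    obtain ⟨b1, b2, b3⟩ := haw
    obtain ⟨s1, s2⟩ := hs
    simp only [PiLp.add_apply] at b1 b2 b3
    refine ⟨?_, ?_, ?_⟩ <;> simp only [PiLp.add_apply, PiLp.smul_apply, smul_eq_mul] <;> nlinarith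
  have m0 : (0 : Euc 2) ∈ stdTriangle := by simp [stdTriangle]
  have m1 : (stdVec 0 : Euc 2) ∈ stdTriangle := by simp [stdTriangle]
  have m2 : (stdVec 1 : Euc 2) ∈ stdTriangle := by simp [stdTriangle]
  -- the side from vertex `0` to vertex `1`, where the frame is tangent to the side
  have t2 : sideTurning h 2 =
      ∫ t in (0 : ℝ)..1, connForm h (t • stdVec 0) (stdVec 0) (stdVec 0) := by
    have h21 : (2 : Fin 3) + 1 = 0 := rfl
    have h22 : (2 : Fin 3) + 2 = 1 := rfl
    simp [sideTurning, sideVec, triVertex, h21, h22]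
  -- the side from vertex `1` to vertex `2`
  have w0 : sideVec 0 = stdVec 1 - stdVec 0 := by simp [sideVec, triVertex]
  have t0 := hh.integral_connForm_sub (b := stdVec 0) (c := sideVec 0) (a := stdVec 0)
    (w := sideVec 0) (by simp [w0, det2]) (seg _ _ m1 (by simpa [w0] using m2))
  have t0' : sideTurning h 0 =
      ∫ s in (0 : ℝ)..1, connForm h (stdVec 0 + s • sideVec 0) (sideVec 0) (sideVec 0) := by
    simp [sideTurning, triVertex]
  rw [← t0', w0] at t0
  have t0'' : ∀ y, connForm h y (stdVec 0) (stdVec 1 - stdVec 0) =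
      connForm h y (stdVec 0) (stdVec 1) - connForm h y (stdVec 0) (stdVec 0) := by
    intro y
    have := connForm_add h y (stdVec 0) (stdVec 1) (stdVec 0) 1 (-1)
    rw [one_smul, neg_one_smul, ← sub_eq_add_neg] at this
    rw [this]; ring
  simp only [t0'', add_sub_cancel] at t0
  -- the side from vertex `2` to vertex `0`, against the direction of `stdVec 1`
  have t1 := hh.integral_connForm_sub (b := stdVec 0) (c := stdVec 1) (a := 0)
    (w := stdVec 1) (by simp [det2]) (seg _ _ m0 (by simpa using m2))
  simp only [zero_add] at t1
  have t1' : sideTurning h 1 =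
      -∫ t in (0 : ℝ)..1, connForm h (t • stdVec 1) (stdVec 1) (stdVec 1) := by
    have h11 : (1 : Fin 3) + 1 = 2 := rfl
    have h12 : (1 : Fin 3) + 2 = 0 := rfl
    have e : ∀ s : ℝ, connForm h (stdVec 1 + -(s • stdVec 1)) (-stdVec 1) (-stdVec 1) =
        -connForm h ((1 - s) • stdVec 1) (stdVec 1) (stdVec 1) := by
      intro s
      have h1 := connForm_smul_left h (stdVec 1 + -(s • stdVec 1)) (stdVec 1) (-stdVec 1)
        (r := -1) (by norm_num)
      have h2 := connForm_add h (stdVec 1 + -(s • stdVec 1)) (stdVec 1) (stdVec 1) 0 (-1) 0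
      simp only [neg_one_smul, smul_zero, add_zero, zero_mul, neg_one_mul] at h1 h2
      rw [h1, h2]
      congr 2
      module
    have := intervalIntegral.integral_comp_sub_left (a := 0) (b := 1)
      (fun t : ℝ => connForm h (t • stdVec 1) (stdVec 1) (stdVec 1)) 1
    simp only [sub_self, sub_zero] at this
    rw [← this, ← intervalIntegral.integral_neg]
    simp [sideTurning, sideVec, triVertex, h11, h12, e]
  -- supplementary angles at vertex `1`, and the Euclidean angle sum of `h y` at vertex `2`
  have ang : ∀ y ∈ U, metricAngle (h y) (stdVec 1 - stdVec 0) (-stdVec 0) =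
        Real.pi - metricAngle (h y) (stdVec 0) (stdVec 1 - stdVec 0) ∧
      metricAngle (h y) (stdVec 0) (stdVec 1 - stdVec 0) = metricAngle (h y) (stdVec 0) (stdVec 1) +
        metricAngle (h y) (-stdVec 1) (stdVec 0 - stdVec 1) := by
    intro y hy
    obtain ⟨L, hLb, hL⟩ := exists_isometry_complex (hh.symm y hy) (hh.pos y hy)
    simp only [metricAngle_eq_angle hL, map_sub, map_neg]
    constructor
    · rw [InnerProductGeometry.angle_neg_right, InnerProductGeometry.angle_comm]
    · have h1 := InnerProductGeometry.angle_add_angle_sub_add_angle_sub_eq_pi (L (stdVec 0))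
        (y := L (stdVec 1)) (fun h0 => by
          have := hLb.1 (h0.trans (map_zero L).symm); simp at this)
      have h2 := InnerProductGeometry.angle_neg_neg (-L (stdVec 1)) (L (stdVec 0) - L (stdVec 1))
      have h3 := InnerProductGeometry.angle_neg_right (L (stdVec 0)) (L (stdVec 0) - L (stdVec 1))
      rw [neg_sub, neg_neg] at h2
      rw [neg_sub] at h3
      rw [← h2, h3]
      linarith
  have a0 : vertexAngle h 0 = metricAngle (h 0) (stdVec 0) (stdVec 1) := by
    simp [vertexAngle, triVertex]
  have a1 : vertexAngle h 1 = metricAngle (h (stdVec 0)) (stdVec 1 - stdVec 0) (-stdVec 0) := by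
    have h11 : (1 : Fin 3) + 1 = 2 := rfl
    have h12 : (1 : Fin 3) + 2 = 0 := rfl
    simp [vertexAngle, triVertex, h11, h12]
  have a2 : vertexAngle h 2 = metricAngle (h (stdVec 1)) (-stdVec 1) (stdVec 0 - stdVec 1) := by
    have h21 : (2 : Fin 3) + 1 = 0 := rfl
    have h22 : (2 : Fin 3) + 2 = 1 := rfl
    simp [vertexAngle, triVertex, h21, h22]
  rw [Fin.sum_univ_three, Fin.sum_univ_three, a0, a1, a2, (ang _ (hU m1)).1, t1', t2]
  have := (ang _ (hU m2)).2
  linarith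

/-- In positive curvature the angle sum of a triangle exceeds `π` by more than the total geodesic
curvature of the boundary. -/
theorem IsMetricOn.pi_add_sideTurning_lt (hh : IsMetricOn h U) (hU : stdTriangle ⊆ U)
    (hK : ∀ y ∈ stdTriangle, 0 < planeCurvature h y (stdVec 0) (stdVec 1)) :
    Real.pi + ∑ i, sideTurning h i < ∑ i, vertexAngle h i := by
  have hG := hh.gaussBonnet_triangle hU
  suffices 0 < ∫ p in Set.Icc (0 : ℝ × ℝ) 1, p.1 * (planeCurvature h (squareMap p) (stdVec 0)
      (stdVec 1) * areaDensity h (squareMap p)) by linarith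
  have hsq : Continuous squareMap := by unfold squareMap; fun_prop
  have hc := hh.continuousOn_curvature_mul_areaDensity
  refine setIntegral_Icc_pos (continuous_fst.continuousOn.mul
    (hc.comp hsq.continuousOn fun p hp => hU (squareMap_mem hp))) (fun p hp => ?_)
    (p := (1 / 2, 1 / 2)) (by norm_num) ?_
  · exact mul_nonneg hp.1.1 (mul_nonneg (hK _ (squareMap_mem hp)).le
      (hh.areaDensity_pos (hU (squareMap_mem hp))).le)
  · have hp : ((1 / 2, 1 / 2) : ℝ × ℝ) ∈ Set.Icc (0 : ℝ × ℝ) 1 := by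
      constructor <;> constructor <;> norm_num
    exact mul_pos (by norm_num) (mul_pos (hK _ (squareMap_mem hp))
      (hh.areaDensity_pos (hU (squareMap_mem hp))))

/-! ### The Gauss–Bonnet formula for a doubly periodic metric -/

/-- The Levi-Civita connection of a periodic metric is periodic. -/
theorem connForm_add_period {c : Euc 2} (hper : ∀ y, h (y + c) = h y) (z a w : Euc 2) :
    connForm h (z + c) a w = connForm h z a w := by
  have hd : fderiv ℝ h (z + c) = fderiv ℝ h z := by
    rw [← fderiv_comp_add_right]
    exact congrArg (fun f => fderiv ℝ f z) (funext hper)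
  simp only [connForm, areaDensity, gram, christoffel, hd, hper]

/-- A doubly periodic metric of nonnegative curvature on the plane is flat: the integral of the
curvature over a period parallelogram is the integral of a periodic form over its boundary. -/
theorem IsMetricOn.curvature_eq_zero_of_periodic (hh : IsMetricOn h Set.univ) {T : ℝ} (hT : 0 < T)
    (hper : ∀ y i, h (y + T • stdVec i) = h y)
    (hK : ∀ y, 0 ≤ planeCurvature h y (stdVec 0) (stdVec 1)) (y : Euc 2) :
    planeCurvature h y (stdVec 0) (stdVec 1) = 0 := by
  by_contra hne
  have hy : 0 < planeCurvature h y (stdVec 0) (stdVec 1) := lt_of_le_of_ne (hK y) (Ne.symm hne)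
  set L : ℝ × ℝ →L[ℝ] Euc 2 := (ContinuousLinearMap.fst ℝ ℝ ℝ).smulRight (stdVec 0) +
    (ContinuousLinearMap.snd ℝ ℝ ℝ).smulRight (stdVec 1) with hL
  -- the period square is centred at `y`
  set c : Euc 2 := y - (T / 2) • stdVec 0 - (T / 2) • stdVec 1 with hc
  set τ : ℝ × ℝ → Euc 2 := fun p => c + L p with hτ
  have hτd : ∀ p, HasFDerivAt τ L p := fun p => L.hasFDerivAt.const_add c
  have hd : ∀ w p, HasFDerivAt (fun y => connForm h y (stdVec 0) w)
      (fderiv ℝ (fun y => connForm h y (stdVec 0) w) (τ p)) (τ p) := fun w p =>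
    ((hh.contDiffAt_connForm (Set.mem_univ _) (by simp) w).differentiableAt (by simp)).hasFDerivAt
  have hQ : ∀ p, HasFDerivAt (fun p => connForm h (τ p) (stdVec 0) (stdVec 1)) _ p :=
    fun p => (hd (stdVec 1) p).comp p (hτd p)
  have hP : ∀ p, HasFDerivAt (fun p => -connForm h (τ p) (stdVec 0) (stdVec 0)) _ p :=
    fun p => ((hd (stdVec 0) p).comp p (hτd p)).neg
  have hL0 : L (1, 0) = stdVec 0 := by simp [hL]
  have hL1 : L (0, 1) = stdVec 1 := by simp [hL]
  set F : ℝ × ℝ → ℝ := fun p => planeCurvature h (τ p) (stdVec 0) (stdVec 1) *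
    areaDensity h (τ p) with hF
  have hτc : Continuous τ := by
    rw [continuous_iff_continuousAt]; exact fun p => (hτd p).continuousAt
  have hFc : Continuous F := by
    have := hh.continuousOn_curvature_mul_areaDensity
    rw [continuousOn_univ] at this
    exact this.comp hτc
  have hpt : ∀ p : ℝ × ℝ, -F p =
      ((fderiv ℝ (fun y => connForm h y (stdVec 0) (stdVec 1)) (τ p)).comp L) (1, 0) +
        (-(fderiv ℝ (fun y => connForm h y (stdVec 0) (stdVec 0)) (τ p)).comp L) (0, 1) := by
    intro p
    simp only [neg_apply, ContinuousLinearMap.comp_apply, hL0, hL1, hF]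
    have := hh.fderiv_connForm_sub (Set.mem_univ (τ p))
    linarith
  have hdiv := MeasureTheory.integral_divergence_prod_Icc_of_hasFDerivAt_of_le
    _ _ _ _ (0 : ℝ × ℝ) (T, T) (by constructor <;> exact hT.le)
    (fun p _ => (hQ p).continuousAt.continuousWithinAt)
    (fun p _ => (hP p).continuousAt.continuousWithinAt)
    (fun p _ => hQ p) (fun p _ => hP p) (by
      simp only [← hpt]
      exact hFc.neg.continuousOn.integrableOn_compact isCompact_Icc)
  simp only [← hpt, MeasureTheory.integral_neg] at hdiv
  have p0 : ∀ s, connForm h (τ (T, s)) (stdVec 0) (stdVec 1) =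
      connForm h (τ (0, s)) (stdVec 0) (stdVec 1) := by
    intro s
    rw [← connForm_add_period (fun y => hper y 0) (τ (0, s))]
    congr 1
    simp only [hτ, hL, add_apply, ContinuousLinearMap.smulRight_apply,
      ContinuousLinearMap.coe_fst', ContinuousLinearMap.coe_snd']
    module
  have p1 : ∀ s, connForm h (τ (s, T)) (stdVec 0) (stdVec 0) =
      connForm h (τ (s, 0)) (stdVec 0) (stdVec 0) := by
    intro s
    rw [← connForm_add_period (fun y => hper y 1) (τ (s, 0))]
    congr 1
    simp only [hτ, hL, add_apply, ContinuousLinearMap.smulRight_apply,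
      ContinuousLinearMap.coe_fst', ContinuousLinearMap.coe_snd']
    module
  simp only [p0, p1, Prod.fst_zero, Prod.snd_zero] at hdiv
  have hpos : 0 < ∫ p in Set.Icc (0 : ℝ × ℝ) (T, T), F p := by
    refine setIntegral_Icc_pos hFc.continuousOn (fun p _ => mul_nonneg (hK _)
      (hh.areaDensity_pos (Set.mem_univ _)).le) (p := (T / 2, T / 2)) ?_ ?_
    · constructor <;> constructor <;> simp [hT]
    · have : τ (T / 2, T / 2) = y := by
        simp only [hτ, hL, hc, add_apply, ContinuousLinearMap.smulRight_apply,
          ContinuousLinearMap.coe_fst', ContinuousLinearMap.coe_snd']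
        module
      simp only [hF, this]
      exact mul_pos hy (hh.areaDensity_pos (Set.mem_univ _))
  linarith

end PlaneIntegrals

section Congr
variable {m : ℕ} {G G' : Euc m → Euc m →L[ℝ] Euc m →L[ℝ] ℝ} {U : Set (Euc m)} {y : Euc m}

theorem christoffel_congr (h : G =ᶠ[𝓝 y] G') (u v : Euc m) :
    christoffel G y u v = christoffel G' y u v := by
  simp only [christoffel, gram, h.fderiv_eq, h.eq_of_nhds]

theorem curvature_congr (h : G =ᶠ[𝓝 y] G') (u v w : Euc m) :
    curvature G y u v w = curvature G' y u v w := by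
  have h1 : ∀ a b, (fun z => christoffel G z a b) =ᶠ[𝓝 y] fun z => christoffel G' z a b := by
    intro a b
    filter_upwards [h.eventuallyEq_nhds] with z hz using christoffel_congr hz a b
  simp only [curvature, christoffel_congr h, (h1 _ _).fderiv_eq]

theorem planeCurvature_congr (h : G =ᶠ[𝓝 y] G') (u v : Euc m) :
    planeCurvature G y u v = planeCurvature G' y u v := by
  simp only [planeCurvature, curvature_congr h, h.eq_of_nhds]

theorem IsMetricOn.congr (hG : IsMetricOn G U) (h : Set.EqOn G' G U) : IsMetricOn G' U where
  isOpen := hG.isOpen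
  contDiffOn := hG.contDiffOn.congr h
  symm y hy u v := by rw [h hy]; exact hG.symm y hy u v
  pos y hy v hv := by rw [h hy]; exact hG.pos y hy v hv

theorem IsMetricOn.of_local (hU : ∀ y ∈ U, ∃ V ⊆ U, y ∈ V ∧ IsMetricOn G V) :
    IsMetricOn G U where
  isOpen := isOpen_iff_mem_nhds.2 fun y hy => by
    obtain ⟨V, hV, hyV, h⟩ := hU y hy
    exact Filter.mem_of_superset (h.mem_nhds hyV) hV
  contDiffOn y hy := by
    obtain ⟨V, -, hyV, h⟩ := hU y hy
    exact (h.contDiffAt hyV).contDiffWithinAt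
  symm y hy := by
    obtain ⟨V, -, hyV, h⟩ := hU y hy
    exact h.symm y hyV
  pos y hy := by
    obtain ⟨V, -, hyV, h⟩ := hU y hy
    exact h.pos y hyV

end Congr

/-! ### Riemannian fields on manifolds and their expressions in parametrizations -/

section Manifold

variable {a m : ℕ} {M : Type u} [TopologicalSpace M] [ChartedSpace (Euc m) M]

/-- A field of bilinear forms on a manifold that is a smooth Riemannian metric in every preferred
chart. -/
def IsRiemannianField (h : ∀ q : M, TangentSpace (𝓡 m) q →L[ℝ] TangentSpace (𝓡 m) q →L[ℝ] ℝ) :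
    Prop :=
  ∀ p, IsMetricOn (inChart h p) (extChartAt (𝓡 m) p).target

/-- The pullback `ψ^* h` of a field of bilinear forms by a map `ψ` from a model space. -/
def paramField (h : ∀ q : M, TangentSpace (𝓡 m) q →L[ℝ] TangentSpace (𝓡 m) q →L[ℝ] ℝ)
    (ψ : Euc a → M) (z : Euc a) : Euc a →L[ℝ] Euc a →L[ℝ] ℝ :=
  pullForm (h (ψ z)) (mfderiv 𝓘(ℝ, Euc a) (𝓡 m) ψ z)

/-- The value at `q` of a field of bilinear forms, as a form on the model space. -/
def formAt (h : ∀ q : M, TangentSpace (𝓡 m) q →L[ℝ] TangentSpace (𝓡 m) q →L[ℝ] ℝ) (q : M) :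
    Euc m →L[ℝ] Euc m →L[ℝ] ℝ := h q

variable {h : ∀ q : M, TangentSpace (𝓡 m) q →L[ℝ] TangentSpace (𝓡 m) q →L[ℝ] ℝ}

theorem formAt_congr {q q' : M} (hq : q = q') {u v u' v' : Euc m} (hu : u = u') (hv : v = v') :
    formAt h q u v = formAt h q' u' v' := by
  rw [hq, hu, hv]

variable [IsManifold (𝓡 m) ∞ M]

instance isManifold_one : IsManifold (𝓡 m) 1 M := IsManifold.of_le (n := ∞) (by simp)

theorem mdifferentiableAt_extChartAt_symm {p : M} {y : Euc m}
    (hy : y ∈ (extChartAt (𝓡 m) p).target) :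
    MDifferentiableAt 𝓘(ℝ, Euc m) (𝓡 m) (extChartAt (𝓡 m) p).symm y :=
  ((contMDiffOn_extChartAt_symm (n := ∞) p).contMDiffAt
    ((isOpen_extChartAt_target p).mem_nhds hy)).mdifferentiableAt (by simp)

theorem injective_mfderiv_extChartAt_symm {p : M} {y : Euc m}
    (hy : y ∈ (extChartAt (𝓡 m) p).target) :
    Function.Injective (mfderiv 𝓘(ℝ, Euc m) (𝓡 m) (extChartAt (𝓡 m) p).symm y) := by
  have := isInvertible_mfderivWithin_extChartAt_symm (I := 𝓡 m) hy
  rw [modelWithCornersSelf_coe, Set.range_id, mfderivWithin_univ] at this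
  exact this.injective

/-- The chain rule in the chart at `p`. -/
theorem mfderiv_eq_comp_extChartAt {ψ : Euc a → M} {z : Euc a}
    (hψ : MDifferentiableAt 𝓘(ℝ, Euc a) (𝓡 m) ψ z) {p : M} (hp : ψ z ∈ (extChartAt (𝓡 m) p).source)
    (u : Euc a) :
    mfderiv 𝓘(ℝ, Euc a) (𝓡 m) ψ z u = mfderiv 𝓘(ℝ, Euc m) (𝓡 m) (extChartAt (𝓡 m) p).symm
      (extChartAt (𝓡 m) p (ψ z)) (fderiv ℝ (extChartAt (𝓡 m) p ∘ ψ) z u) := by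
  have h1 : MDifferentiableAt (𝓡 m) 𝓘(ℝ, Euc m) (extChartAt (𝓡 m) p) (ψ z) :=
    mdifferentiableAt_extChartAt (by simpa using hp)
  have h2 := mdifferentiableAt_extChartAt_symm ((extChartAt (𝓡 m) p).map_source hp)
  have h3 : ψ =ᶠ[𝓝 z] (extChartAt (𝓡 m) p).symm ∘ (extChartAt (𝓡 m) p ∘ ψ) := by
    filter_upwards [hψ.continuousAt.preimage_mem_nhds
      ((isOpen_extChartAt_source p).mem_nhds hp)] with y hy
    exact ((extChartAt (𝓡 m) p).left_inv hy).symm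
  rw [h3.mfderiv_eq, mfderiv_comp z h2 (h1.comp z hψ), mfderiv_eq_fderiv]
  rfl

theorem paramField_eq_pullMetric {ψ : Euc a → M} {z : Euc a}
    (hψ : MDifferentiableAt 𝓘(ℝ, Euc a) (𝓡 m) ψ z) {p : M}
    (hp : ψ z ∈ (extChartAt (𝓡 m) p).source) :
    paramField h ψ z = pullMetric (inChart h p) (extChartAt (𝓡 m) p ∘ ψ) z := by
  ext u v
  exact formAt_congr ((extChartAt (𝓡 m) p).left_inv hp).symm
    (mfderiv_eq_comp_extChartAt hψ hp u) (mfderiv_eq_comp_extChartAt hψ hp v)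

omit [IsManifold (𝓡 m) ∞ M] in
theorem paramField_comp {b : ℕ} {ψ : Euc a → M} {τ : Euc b → Euc a} {z : Euc b}
    (hψ : MDifferentiableAt 𝓘(ℝ, Euc a) (𝓡 m) ψ (τ z)) (hτ : DifferentiableAt ℝ τ z) :
    paramField h (ψ ∘ τ) z = pullMetric (paramField h ψ) τ z := by
  ext u v
  have e := mfderiv_comp z hψ hτ.mdifferentiableAt
  rw [mfderiv_eq_fderiv] at e
  exact formAt_congr (h := h) rfl (congrArg (fun L => L u) e) (congrArg (fun L => L v) e)

/-- A smooth map from an open subset of a model space to a manifold, with injective differentials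
at the points of that subset. -/
structure IsParamOn (m : ℕ) {M : Type u} [TopologicalSpace M] [ChartedSpace (Euc m) M]
    (ψ : Euc a → M) (V : Set (Euc a)) : Prop where
  isOpen : IsOpen V
  contMDiffOn : ContMDiffOn 𝓘(ℝ, Euc a) (𝓡 m) ∞ ψ V
  injective : ∀ z ∈ V, Function.Injective (mfderiv 𝓘(ℝ, Euc a) (𝓡 m) ψ z)

theorem isParamOn_extChartAt_symm (p : M) :
    IsParamOn m (extChartAt (𝓡 m) p).symm (extChartAt (𝓡 m) p).target where
  isOpen := isOpen_extChartAt_target p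
  contMDiffOn := contMDiffOn_extChartAt_symm p
  injective _ hz := injective_mfderiv_extChartAt_symm hz

namespace IsParamOn

variable {ψ : Euc a → M} {V : Set (Euc a)} {z : Euc a}

omit [IsManifold (𝓡 m) ∞ M] in
omit [IsManifold (𝓡 m) ∞ M] in
theorem contMDiffAt (hψ : IsParamOn m ψ V) (hz : z ∈ V) :
    ContMDiffAt 𝓘(ℝ, Euc a) (𝓡 m) ∞ ψ z :=
  hψ.contMDiffOn.contMDiffAt (hψ.isOpen.mem_nhds hz)

omit [IsManifold (𝓡 m) ∞ M] in
theorem mdifferentiableAt (hψ : IsParamOn m ψ V) (hz : z ∈ V) :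
    MDifferentiableAt 𝓘(ℝ, Euc a) (𝓡 m) ψ z :=
  (hψ.contMDiffAt hz).mdifferentiableAt (by simp)

/-- In a chart of the target, a parametrization is an immersion between open subsets of model
spaces. -/
theorem isImmersionOn (hψ : IsParamOn m ψ V) (hh : IsRiemannianField h) (p : M) :
    IsImmersionOn (inChart h p) (extChartAt (𝓡 m) p).target (extChartAt (𝓡 m) p ∘ ψ)
      (V ∩ ψ ⁻¹' (extChartAt (𝓡 m) p).source) where
  metric := hh p
  isOpen := hψ.contMDiffOn.continuousOn.isOpen_inter_preimage hψ.isOpen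
    (isOpen_extChartAt_source p)
  contDiffOn := by
    rw [← contMDiffOn_iff_contDiffOn]
    exact (contMDiffOn_extChartAt (n := ∞) (x := p)).comp
      (hψ.contMDiffOn.mono Set.inter_subset_left) fun z hz => by simpa using hz.2
  mapsTo z hz := (extChartAt (𝓡 m) p).map_source hz.2
  injective z hz := by
    have := hψ.injective z hz.1
    intro u v huv
    apply this
    rw [mfderiv_eq_comp_extChartAt (hψ.mdifferentiableAt hz.1) hz.2,
      mfderiv_eq_comp_extChartAt (hψ.mdifferentiableAt hz.1) hz.2, huv]

theorem isMetricOn (hψ : IsParamOn m ψ V) (hh : IsRiemannianField h) :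
    IsMetricOn (paramField h ψ) V := by
  refine IsMetricOn.of_local fun z hz => ?_
  have hX := hψ.isImmersionOn hh (ψ z)
  refine ⟨V ∩ ψ ⁻¹' (extChartAt (𝓡 m) (ψ z)).source, Set.inter_subset_left,
    ⟨hz, mem_extChartAt_source (ψ z)⟩, ?_⟩
  exact hX.pullMetric.congr fun y hy =>
    paramField_eq_pullMetric (hψ.mdifferentiableAt hy.1) hy.2

end IsParamOn

theorem mfderiv_extChartAt_symm_self (p : M) :
    mfderiv 𝓘(ℝ, Euc m) (𝓡 m) (extChartAt (𝓡 m) p).symm (extChartAt (𝓡 m) p p) =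
      ContinuousLinearMap.id ℝ (Euc m) := by
  have h1 := mfderivWithin_extChartAt_symm_comp_mfderiv_extChartAt' (I := 𝓡 m)
    (mem_extChartAt_source p)
  rw [modelWithCornersSelf_coe, Set.range_id, mfderivWithin_univ, mfderiv_extChartAt_self] at h1
  exact h1

theorem inChart_self (h : ∀ q : M, TangentSpace (𝓡 m) q →L[ℝ] TangentSpace (𝓡 m) q →L[ℝ] ℝ)
    (p : M) (u v : Euc m) :
    inChart h p (extChartAt (𝓡 m) p p) u v = h p u v := by
  have e := mfderiv_extChartAt_symm_self (m := m) p
  exact formAt_congr (extChartAt_to_inv p) (congrArg (fun L => L u) e) (congrArg (fun L => L v) e)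

theorem sectionalCurvature_eq_planeCurvature
    (h : ∀ q : M, TangentSpace (𝓡 m) q →L[ℝ] TangentSpace (𝓡 m) q →L[ℝ] ℝ) (p : M)
    (u v : Euc m) :
    sectionalCurvature h p u v = planeCurvature (inChart h p) (extChartAt (𝓡 m) p p) u v := by
  simp only [sectionalCurvature, planeCurvature, inChart_self]

end Manifold

section Surface

variable {M : Type u} [TopologicalSpace M] [ChartedSpace (Euc 2) M] [IsManifold (𝓡 2) ∞ M]
  {h : ∀ q : M, TangentSpace (𝓡 2) q →L[ℝ] TangentSpace (𝓡 2) q →L[ℝ] ℝ}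

/-- The Gauss curvature of a surface can be computed in any local parametrization. -/
theorem IsParamOn.sectionalCurvature_eq {ψ : Euc 2 → M} {V : Set (Euc 2)} {z : Euc 2}
    (hψ : IsParamOn 2 ψ V) (hh : IsRiemannianField h) (hz : z ∈ V) :
    sectionalCurvature h (ψ z) (stdVec 0 : Euc 2) (stdVec 1 : Euc 2) =
      planeCurvature (paramField h ψ) z (stdVec 0) (stdVec 1) := by
  have hX := hψ.isImmersionOn hh (ψ z)
  have hz' : z ∈ V ∩ ψ ⁻¹' (extChartAt (𝓡 2) (ψ z)).source := ⟨hz, mem_extChartAt_source (ψ z)⟩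
  rw [sectionalCurvature_eq_planeCurvature]
  refine (hX.planeCurvature_pullMetric hz').symm.trans (planeCurvature_congr ?_ _ _)
  filter_upwards [hX.mem_nhds hz'] with y hy
  exact (paramField_eq_pullMetric (hψ.mdifferentiableAt hy.1) hy.2).symm

end Surface

/-! ### The ambient metric and the first fundamental form -/

section Immersion

variable {m n : ℕ} {M : Type v} [TopologicalSpace M] [ChartedSpace (Euc m) M]
  {N : Type u} [TopologicalSpace N] [ChartedSpace (Euc n) N] [IsManifold (𝓡 n) ∞ N]

theorem contMDiffOn_symmL_of_mem (e : Bundle.Trivialization (Euc n)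
    (Bundle.TotalSpace.proj : TangentBundle (𝓡 n) N → N)) [MemTrivializationAtlas e] (w : Euc n) :
    ContMDiffOn (𝓡 n) ((𝓡 n).prod 𝓘(ℝ, Euc n)) ∞
      (fun q : N => Bundle.TotalSpace.mk' (Euc n) q (e.symmL ℝ q w)) e.baseSet := by
  intro q hq
  have h0 : (q, w) ∈ e.target := by simpa [e.target_eq] using hq
  have h1 := (e.contMDiffOn_symm (IB := 𝓡 n) (n := ∞)).contMDiffAt (e.open_target.mem_nhds h0)
  have h2 : ContMDiffAt (𝓡 n) ((𝓡 n).prod 𝓘(ℝ, Euc n)) ∞ (fun q : N => (q, w)) q :=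
    contMDiffAt_id.prodMk contMDiffAt_const
  have h3 := h1.comp q h2
  refine (h3.congr_of_eventuallyEq ?_).contMDiffWithinAt
  filter_upwards [e.open_baseSet.mem_nhds hq] with q' hq'
  rw [Bundle.Trivialization.symmL_apply e hq']
  exact e.mk_symm hq' w

/-- The vector fields with constant components in a trivialization of the tangent bundle are
smooth. -/
theorem contMDiffOn_symmL (p : N) (w : Euc n) :
    ContMDiffOn (𝓡 n) ((𝓡 n).prod 𝓘(ℝ, Euc n)) ∞ (fun q : N => Bundle.TotalSpace.mk' (Euc n) q
      ((trivializationAt (Euc n) (fun q : N => TangentSpace (𝓡 n) q) p).symmL ℝ q w))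
      (chartAt (Euc n) p).source := by
  exact contMDiffOn_symmL_of_mem _ w

theorem contDiffAt_inner_inChart (g : Metric n N) (p : N) {y : Euc n}
    (hy : y ∈ (extChartAt (𝓡 n) p).target) (u v : Euc n) :
    ContDiffAt ℝ ∞ (fun z => inChart g.inner p z u v) y := by
  have hq : (extChartAt (𝓡 n) p).symm y ∈ (chartAt (Euc n) p).source := by
    have := (extChartAt (𝓡 n) p).map_target hy
    simpa using this
  have hs : ∀ w, ContMDiffAt (𝓡 n) ((𝓡 n).prod 𝓘(ℝ, Euc n)) ∞
      (fun q : N => Bundle.TotalSpace.mk' (Euc n) q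
        ((trivializationAt (Euc n) (fun q : N => TangentSpace (𝓡 n) q) p).symmL ℝ q w))
      ((extChartAt (𝓡 n) p).symm y) := fun w =>
    (contMDiffOn_symmL p w).contMDiffAt ((chartAt (Euc n) p).open_source.mem_nhds hq)
  have h3 : ContMDiffAt (𝓡 n) ((𝓡 n).prod 𝓘(ℝ)) ∞
      (fun q => Bundle.TotalSpace.mk' ℝ (E := Bundle.Trivial N ℝ) q
        (g.inner q
          ((trivializationAt (Euc n) (fun q : N => TangentSpace (𝓡 n) q) p).symmL ℝ q u)
          ((trivializationAt (Euc n) (fun q : N => TangentSpace (𝓡 n) q) p).symmL ℝ q v)))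
      ((extChartAt (𝓡 n) p).symm y) := by
    apply ContMDiffAt.clm_bundle_apply₂ (F₁ := Euc n) (F₂ := Euc n)
    · exact g.contMDiff.contMDiffAt
    · exact hs u
    · exact hs v
  rw [Bundle.contMDiffAt_totalSpace] at h3
  have h4 := h3.2.comp y ((contMDiffOn_extChartAt_symm (n := ∞) p).contMDiffAt
      ((isOpen_extChartAt_target p).mem_nhds hy))
  rw [contMDiffAt_iff_contDiffAt] at h4
  refine h4.congr_of_eventuallyEq ?_
  filter_upwards [(isOpen_extChartAt_target p).mem_nhds hy] with z hz
  have hz' : (extChartAt (𝓡 n) p).symm z ∈ (chartAt (Euc n) p).source := by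
    have := (extChartAt (𝓡 n) p).map_target hz
    simpa using this
  have h5 := TangentBundle.symmL_trivializationAt (I := 𝓡 n) hz'
  rw [modelWithCornersSelf_coe, Set.range_id, mfderivWithin_univ,
    (extChartAt (𝓡 n) p).right_inv hz] at h5
  exact formAt_congr (h := g.inner) rfl (congrArg (fun L => L u) h5.symm)
    (congrArg (fun L => L v) h5.symm)

theorem isRiemannianField_inner (g : Metric n N) : IsRiemannianField g.inner := by
  intro p
  constructor
  · exact isOpen_extChartAt_target p
  · intro y hy
    exact (contDiffAt_clm_of_apply fun u => contDiffAt_clm_of_apply fun v =>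
      contDiffAt_inner_inChart g p hy u v).contDiffWithinAt
  · intro y _ u v
    exact g.symm ((extChartAt (𝓡 n) p).symm y)
      (mfderiv 𝓘(ℝ, Euc n) (𝓡 n) (extChartAt (𝓡 n) p).symm y u)
      (mfderiv 𝓘(ℝ, Euc n) (𝓡 n) (extChartAt (𝓡 n) p).symm y v)
  · intro y hy v hv
    have h0 : mfderiv 𝓘(ℝ, Euc n) (𝓡 n) (extChartAt (𝓡 n) p).symm y v ≠ 0 := fun h0 =>
      hv (injective_mfderiv_extChartAt_symm hy (h0.trans (map_zero _).symm))
    exact g.pos ((extChartAt (𝓡 n) p).symm y)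
      (mfderiv 𝓘(ℝ, Euc n) (𝓡 n) (extChartAt (𝓡 n) p).symm y v) h0

variable [IsManifold (𝓡 m) ∞ M]

omit [IsManifold (𝓡 m) ∞ M] in
theorem paramField_firstForm {a : ℕ} (g : Metric n N) {x : M → N} {ψ : Euc a → M} {z : Euc a}
    (hψ : MDifferentiableAt 𝓘(ℝ, Euc a) (𝓡 m) ψ z)
    (hx : MDifferentiableAt (𝓡 m) (𝓡 n) x (ψ z)) :
    paramField (firstForm m g x) ψ z = paramField g.inner (x ∘ ψ) z := by
  ext u v
  have e := mfderiv_comp z hx hψ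
  exact (formAt_congr (h := g.inner) rfl (congrArg (fun L => L u) e)
    (congrArg (fun L => L v) e)).symm

omit [IsManifold (𝓡 n) ∞ N] [IsManifold (𝓡 m) ∞ M] in
theorem IsParamOn.comp_immersion {a : ℕ} {x : M → N} (hx : IsSmoothImmersion m n x)
    {ψ : Euc a → M} {V : Set (Euc a)} (hψ : IsParamOn m ψ V) : IsParamOn n (x ∘ ψ) V where
  isOpen := hψ.isOpen
  contMDiffOn := hx.1.comp_contMDiffOn hψ.contMDiffOn
  injective z hz := by
    rw [mfderiv_comp z (hx.1.mdifferentiable (by simp) _) (hψ.mdifferentiableAt hz)]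
    exact (hx.2 _).comp (hψ.injective z hz)

theorem isRiemannianField_firstForm (g : Metric n N) {x : M → N} (hx : IsSmoothImmersion m n x) :
    IsRiemannianField (firstForm m g x) := by
  intro p
  refine (((isParamOn_extChartAt_symm p).comp_immersion hx).isMetricOn
    (isRiemannianField_inner g)).congr fun y hy => ?_
  exact paramField_firstForm g (mdifferentiableAt_extChartAt_symm hy)
    (hx.1.mdifferentiable (by simp) _)

end Immersion

section UmbilicDefect

variable {n : ℕ}

/-- The expression `|H|² + (|b|² - ⟨a, c⟩) / D` attached to a first fundamental form with
coefficients `E`, `F`, `C` of determinant `D = EC - F²`, and a normal valued second fundamental form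
with coefficients `a`, `b`, `c`; here `H = (C a - 2 F b + E c) / (2 D)`. -/
def umbilicDefect (B : Euc n →L[ℝ] Euc n →L[ℝ] ℝ) (E F C : ℝ) (a b c : Euc n) : ℝ :=
  B (C • a - (2 * F) • b + E • c) (C • a - (2 * F) • b + E • c) / (4 * (E * C - F ^ 2) ^ 2) +
    (B b b - B a c) / (E * C - F ^ 2)

variable {B : Euc n →L[ℝ] Euc n →L[ℝ] ℝ}

/-- The defect is the squared norm of the trace-free part of the second fundamental form, here
expressed in an orthonormal basis whose first vector is proportional to the first basis vector. -/
theorem umbilicDefect_eq (hs : ∀ u v, B u v = B v u) {E F C : ℝ} (hE : 0 < E)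
    (hD : 0 < E * C - F ^ 2) (a b c : Euc n) :
    umbilicDefect B E F C a b c =
      4⁻¹ * B (E⁻¹ • a - (E / (E * C - F ^ 2)) • (c - (2 * F / E) • b + (F ^ 2 / E ^ 2) • a))
        (E⁻¹ • a - (E / (E * C - F ^ 2)) • (c - (2 * F / E) • b + (F ^ 2 / E ^ 2) • a)) +
      B (b - (F / E) • a) (b - (F / E) • a) / (E * C - F ^ 2) := by
  have hD' := hD.ne'
  obtain ⟨D, hDE⟩ : ∃ D, D = E * C - F ^ 2 := ⟨_, rfl⟩
  have hC : C = (D + F ^ 2) / E := by rw [eq_div_iff hE.ne', hDE]; ring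
  rw [← hDE] at hD'
  rw [umbilicDefect, ← hDE, hC]
  simp only [map_add, map_sub, map_smul, add_apply, sub_apply, smul_apply,
    smul_eq_mul, hs b a, hs c a, hs c b]
  field_simp
  ring

theorem umbilicDefect_nonneg (hs : ∀ u v, B u v = B v u) (hp : ∀ v, 0 ≤ B v v) {E F C : ℝ}
    (hE : 0 < E) (hD : 0 < E * C - F ^ 2) (a b c : Euc n) : 0 ≤ umbilicDefect B E F C a b c := by
  rw [umbilicDefect_eq hs hE hD]
  exact add_nonneg (mul_nonneg (by norm_num) (hp _)) (div_nonneg (hp _) hD.le)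

theorem umbilicDefect_eq_zero_iff (hs : ∀ u v, B u v = B v u) (hp : ∀ v, v ≠ 0 → 0 < B v v)
    {E F C : ℝ} (hE : 0 < E) (hD : 0 < E * C - F ^ 2) {a b c H : Euc n}
    (hH : H = (2 * (E * C - F ^ 2))⁻¹ • (C • a - (2 * F) • b + E • c)) :
    umbilicDefect B E F C a b c = 0 ↔ a = E • H ∧ b = F • H ∧ c = C • H := by
  have hD' := hD.ne'
  have hp0 : ∀ v, 0 ≤ B v v := fun v => by
    rcases eq_or_ne v 0 with rfl | hv
    · simp
    · exact (hp v hv).le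
  constructor
  · intro h
    rw [umbilicDefect_eq hs hE hD] at h
    obtain ⟨h1, h2⟩ := (add_eq_zero_iff_of_nonneg (mul_nonneg (by norm_num) (hp0 _))
      (div_nonneg (hp0 _) hD.le)).1 h
    have z : ∀ v, B v v = 0 → v = 0 := fun v hv => by
      by_contra h0
      exact (hp v h0).ne' hv
    have hb := z _ ((div_eq_zero_iff.1 h2).resolve_right hD')
    have ha := z _ ((mul_eq_zero.1 h1).resolve_left (by norm_num))
    rw [sub_eq_zero] at hb
    have hc : c = (C / E) • a := by
      have h3 := congrArg (fun v => ((E * C - F ^ 2) / E) • v) ha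
      simp only [smul_zero] at h3
      rw [hb] at h3
      have h4 : ((E * C - F ^ 2) / E) • (E⁻¹ • a - (E / (E * C - F ^ 2)) •
          (c - (2 * F / E) • (F / E) • a + (F ^ 2 / E ^ 2) • a)) = (C / E) • a - c := by
        match_scalars <;> field_simp
        ring
      rw [h4, sub_eq_zero] at h3
      exact h3.symm
    have hH' : H = E⁻¹ • a := by
      rw [hH, hb, hc]
      match_scalars
      field_simp
      ring
    refine ⟨?_, ?_, ?_⟩
    · rw [hH', smul_smul, mul_inv_cancel₀ hE.ne', one_smul]
    · rw [hH', smul_smul, ← div_eq_mul_inv, hb]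
    · rw [hH', smul_smul, ← div_eq_mul_inv, hc]
  · rintro ⟨rfl, rfl, rfl⟩
    simp only [umbilicDefect, map_add, map_sub, map_smul, add_apply, sub_apply, smul_apply,
      smul_eq_mul]
    field_simp
    ring

/-- Invariance under a change of basis with matrix `(p, q; r, s)`. -/
theorem umbilicDefect_basis (hs : ∀ u v, B u v = B v u) {E F C : ℝ} (hD : E * C - F ^ 2 ≠ 0)
    (a b c : Euc n) {p q r s : ℝ} (hdet : p * s - q * r ≠ 0) :
    umbilicDefect B (p ^ 2 * E + 2 * (p * q) * F + q ^ 2 * C)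
      (p * r * E + (p * s + q * r) * F + q * s * C) (r ^ 2 * E + 2 * (r * s) * F + s ^ 2 * C)
      (p ^ 2 • a + (2 * (p * q)) • b + q ^ 2 • c)
      ((p * r) • a + (p * s + q * r) • b + (q * s) • c)
      (r ^ 2 • a + (2 * (r * s)) • b + s ^ 2 • c) = umbilicDefect B E F C a b c := by
  have hD' : (p ^ 2 * E + 2 * (p * q) * F + q ^ 2 * C) * (r ^ 2 * E + 2 * (r * s) * F + s ^ 2 * C)
      - (p * r * E + (p * s + q * r) * F + q * s * C) ^ 2 =
      (p * s - q * r) ^ 2 * (E * C - F ^ 2) := by ring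
  have hP : (r ^ 2 * E + 2 * (r * s) * F + s ^ 2 * C) •
        (p ^ 2 • a + (2 * (p * q)) • b + q ^ 2 • c) -
      (2 * (p * r * E + (p * s + q * r) * F + q * s * C)) •
        ((p * r) • a + (p * s + q * r) • b + (q * s) • c) +
      (p ^ 2 * E + 2 * (p * q) * F + q ^ 2 * C) • (r ^ 2 • a + (2 * (r * s)) • b + s ^ 2 • c) =
      ((p * s - q * r) ^ 2) • (C • a - (2 * F) • b + E • c) := by
    match_scalars <;> ring
  have hM : B ((p * r) • a + (p * s + q * r) • b + (q * s) • c)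
        ((p * r) • a + (p * s + q * r) • b + (q * s) • c) -
      B (p ^ 2 • a + (2 * (p * q)) • b + q ^ 2 • c) (r ^ 2 • a + (2 * (r * s)) • b + s ^ 2 • c) =
      (p * s - q * r) ^ 2 * (B b b - B a c) := by
    simp only [map_add, map_smul, add_apply, smul_apply, smul_eq_mul, hs b a, hs c a, hs c b]
    ring
  rw [umbilicDefect, umbilicDefect, hD', hP, hM]
  simp only [map_smul, smul_apply, smul_eq_mul]
  field_simp

end UmbilicDefect

/-! ### Second fundamental forms of compositions -/

section Composition

variable {k m n : ℕ} {G : Euc n → Euc n →L[ℝ] Euc n →L[ℝ] ℝ} {U : Set (Euc n)} {X : Euc m → Euc n}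
  {V : Set (Euc m)} {τ : Euc k → Euc m} {W : Set (Euc k)} {z : Euc k}

theorem IsImmersionOn.pullMetric_comp (hX : IsImmersionOn G U X V)
    (hτ : IsImmersionOn (Willmore.pullMetric G X) V τ W) (hz : z ∈ W) :
    Willmore.pullMetric G (X ∘ τ) z = Willmore.pullMetric (Willmore.pullMetric G X) τ z := by
  ext u v
  have h := fderiv_comp z (hX.hasFDerivAt (hτ.mapsTo hz)).differentiableAt
    (hτ.hasFDerivAt hz).differentiableAt
  simp only [Willmore.pullMetric_apply, h]
  rfl

/-- The second fundamental form of a composition of immersions is the sum of those of the two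
factors. -/
theorem IsImmersionOn.normalHessian_comp (hX : IsImmersionOn G U X V)
    (hτ : IsImmersionOn (Willmore.pullMetric G X) V τ W) (hz : z ∈ W) (u v : Euc k) :
    normalHessian G (X ∘ τ) z u v =
      normalHessian G X (τ z) (fderiv ℝ τ z u) (fderiv ℝ τ z v) +
        fderiv ℝ X (τ z) (normalHessian (Willmore.pullMetric G X) τ z u v) := by
  have h1 : ∀ y ∈ W, fderiv ℝ (X ∘ τ) y = (fderiv ℝ X (τ y)).comp (fderiv ℝ τ y) := fun y hy =>
    fderiv_comp y (hX.hasFDerivAt (hτ.mapsTo hy)).differentiableAt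
      (hτ.hasFDerivAt hy).differentiableAt
  have h2 : fderiv ℝ (X ∘ τ) =ᶠ[𝓝 z] fun y => (fderiv ℝ X (τ y)).comp (fderiv ℝ τ y) := by
    filter_upwards [hτ.mem_nhds hz] with y hy using h1 y hy
  have h3 := (((hX.hasFDerivAt_fderiv (hτ.mapsTo hz)).comp z (hτ.hasFDerivAt hz)).clm_comp
    (hτ.hasFDerivAt_fderiv hz)).congr_of_eventuallyEq h2
  have h4 : christoffel (Willmore.pullMetric G (X ∘ τ)) z u v =
      christoffel (Willmore.pullMetric (Willmore.pullMetric G X) τ) z u v := by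
    refine christoffel_congr ?_ u v
    filter_upwards [hτ.mem_nhds hz] with y hy using hX.pullMetric_comp hτ hy
  simp only [normalHessian, hessianAlong, h3.fderiv, h4, h1 z hz, Function.comp_apply]
  simp
  abel

/-- An immersion between spaces of the same dimension has no second fundamental form. -/
theorem IsImmersionOn.normalHessian_eq_zero {G : Euc m → Euc m →L[ℝ] Euc m →L[ℝ] ℝ}
    {U V : Set (Euc m)} {X : Euc m → Euc m} {z : Euc m} (hX : IsImmersionOn G U X V) (hz : z ∈ V)
    (u v : Euc m) : normalHessian G X z u v = 0 := by
  have hsurj : Function.Surjective (fderiv ℝ X z) :=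
    (LinearMap.injective_iff_surjective (f := (fderiv ℝ X z : Euc m →ₗ[ℝ] Euc m))).1
      (hX.injective z hz)
  obtain ⟨w, hw⟩ := hsurj (normalHessian G X z u v)
  have := hX.inner_normalHessian hz u v w
  rwa [hw, hX.metric.self_eq_zero (hX.mapsTo hz)] at this

theorem normalHessian_congr {G G' : Euc n → Euc n →L[ℝ] Euc n →L[ℝ] ℝ} {X X' : Euc m → Euc n}
    {z : Euc m} (hX : X =ᶠ[𝓝 z] X') (hXc : ContinuousAt X z) (hG : G =ᶠ[𝓝 (X z)] G')
    (u v : Euc m) : normalHessian G X z u v = normalHessian G' X' z u v := by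
  have h1 : pullMetric G X =ᶠ[𝓝 z] pullMetric G' X' := by
    filter_upwards [hX.eventuallyEq_nhds, hXc.eventually hG] with y hy hy'
    rw [pullMetric, pullMetric, hy.fderiv_eq, hy', hy.eq_of_nhds]
  rw [normalHessian, normalHessian, hessianAlong, hessianAlong, hX.fderiv.fderiv_eq,
    hX.fderiv_eq, christoffel_congr h1, hX.eq_of_nhds, christoffel_congr (hX.eq_of_nhds ▸ hG)]

end Composition

section CoordinateDensity

variable {n : ℕ} {G : Euc n → Euc n →L[ℝ] Euc n →L[ℝ] ℝ} {U : Set (Euc n)} {X : Euc 2 → Euc n}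
  {V : Set (Euc 2)} {z : Euc 2}

/-- The squared norm of the trace-free second fundamental form of a surface in coordinates. -/
def coordDensity (G : Euc n → Euc n →L[ℝ] Euc n →L[ℝ] ℝ) (X : Euc 2 → Euc n) (z : Euc 2) : ℝ :=
  umbilicDefect (G (X z)) (pullMetric G X z (stdVec 0) (stdVec 0))
    (pullMetric G X z (stdVec 0) (stdVec 1)) (pullMetric G X z (stdVec 1) (stdVec 1))
    (normalHessian G X z (stdVec 0) (stdVec 0)) (normalHessian G X z (stdVec 0) (stdVec 1))
    (normalHessian G X z (stdVec 1) (stdVec 1))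

theorem IsMetricOn.det_pos {h : Euc 2 → Euc 2 →L[ℝ] Euc 2 →L[ℝ] ℝ} (hh : IsMetricOn h V)
    (hz : z ∈ V) : 0 < h z (stdVec 0) (stdVec 0) * h z (stdVec 1) (stdVec 1) -
      h z (stdVec 0) (stdVec 1) ^ 2 := by
  have := hh.gram_det_pos hz
  rwa [det_gram, hh.symm z hz (stdVec 1) (stdVec 0), ← sq] at this

theorem coordDensity_congr {G' : Euc n → Euc n →L[ℝ] Euc n →L[ℝ] ℝ} {X' : Euc 2 → Euc n}
    (hX : X =ᶠ[𝓝 z] X') (hXc : ContinuousAt X z) (hG : G =ᶠ[𝓝 (X z)] G') :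
    coordDensity G X z = coordDensity G' X' z := by
  have h1 : pullMetric G X z = pullMetric G' X' z := by
    rw [pullMetric, pullMetric, hX.fderiv_eq, hG.eq_of_nhds, hX.eq_of_nhds]
  have h2 := hG.eq_of_nhds
  rw [hX.eq_of_nhds] at h2
  simp only [coordDensity, normalHessian_congr hX hXc hG, h1, h2, hX.eq_of_nhds]

namespace IsImmersionOn

theorem normalHessianL (G : Euc n → Euc n →L[ℝ] Euc n →L[ℝ] ℝ) (X : Euc 2 → Euc n) (z : Euc 2) :
    ∃ L : Euc 2 →L[ℝ] Euc 2 →L[ℝ] Euc n, ∀ u v, normalHessian G X z u v = L u v := by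
  refine ⟨LinearMap.toContinuousBilinearMap (LinearMap.mk₂ ℝ (normalHessian G X z) ?_ ?_ ?_ ?_),
    fun u v => rfl⟩ <;> intros <;>
    simp only [normalHessian, hessianAlong, ← christoffelL_apply, map_add, map_smul, add_apply,
      smul_apply] <;> module

/-- Invariance of the density under reparametrization. -/
theorem coordDensity_comp_right (hX : IsImmersionOn G U X V) {τ : Euc 2 → Euc 2} {W : Set (Euc 2)}
    (hτ : IsImmersionOn (Willmore.pullMetric G X) V τ W) (hz : z ∈ W) :
    coordDensity G (X ∘ τ) z = coordDensity G X (τ z) := by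
  have hτz := hτ.mapsTo hz
  have hN : ∀ u v, normalHessian G (X ∘ τ) z u v =
      normalHessian G X (τ z) (fderiv ℝ τ z u) (fderiv ℝ τ z v) := by
    intro u v
    rw [hX.normalHessian_comp hτ hz, hτ.normalHessian_eq_zero hz, map_zero, add_zero]
  obtain ⟨L, hL⟩ := normalHessianL G X (τ z)
  have hLs : L (stdVec 1) (stdVec 0) = L (stdVec 0) (stdVec 1) := by
    rw [← hL, ← hL, hX.normalHessian_symm hτz]
  have hL2 : ∀ u v, L u v = (u 0 * v 0) • L (stdVec 0) (stdVec 0) +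
      (u 0 * v 1 + u 1 * v 0) • L (stdVec 0) (stdVec 1) +
      (u 1 * v 1) • L (stdVec 1) (stdVec 1) := by
    intro u v
    conv_lhs => rw [eq_smul_add_smul u, eq_smul_add_smul v]
    simp only [map_add, map_smul, add_apply, smul_apply, hLs]
    module
  have hdet := det2_ne_zero_of_injective (hτ.injective z hz)
  rw [det2] at hdet
  have hh := hX.pullMetric
  simp only [coordDensity, hN, hX.pullMetric_comp hτ hz, pullMetric_apply (Willmore.pullMetric G X)]
  rw [hh.apply_two hτz (fderiv ℝ τ z (stdVec 0)) (fderiv ℝ τ z (stdVec 0)),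
    hh.apply_two hτz (fderiv ℝ τ z (stdVec 0)) (fderiv ℝ τ z (stdVec 1)),
    hh.apply_two hτz (fderiv ℝ τ z (stdVec 1)) (fderiv ℝ τ z (stdVec 1))]
  simp only [hL]
  rw [hL2 (fderiv ℝ τ z (stdVec 0)) (fderiv ℝ τ z (stdVec 0)),
    hL2 (fderiv ℝ τ z (stdVec 0)) (fderiv ℝ τ z (stdVec 1)),
    hL2 (fderiv ℝ τ z (stdVec 1)) (fderiv ℝ τ z (stdVec 1))]
  rw [← umbilicDefect_basis (hX.metric.symm _ (hX.mapsTo hτz)) (hh.det_pos hτz).ne' _ _ _ hdet]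
  congr 1 <;> first | ring1 | module

/-- Invariance of the density under local isometries of the ambient space. -/
theorem coordDensity_comp_left {σ : Euc n → Euc n} {W : Set (Euc n)} (hσ : IsImmersionOn G U σ W)
    (hX : IsImmersionOn (Willmore.pullMetric G σ) W X V) (hz : z ∈ V) :
    coordDensity G (σ ∘ X) z = coordDensity (Willmore.pullMetric G σ) X z := by
  have hN : ∀ u v, normalHessian G (σ ∘ X) z u v =
      fderiv ℝ σ (X z) (normalHessian (Willmore.pullMetric G σ) X z u v) := by
    intro u v
    rw [hσ.normalHessian_comp hX hz, hσ.normalHessian_eq_zero (hX.mapsTo hz), zero_add]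
  simp only [coordDensity, hN, hσ.pullMetric_comp hX hz, umbilicDefect, ← map_smul, ← map_sub,
    ← map_add]
  rfl

theorem continuousAt_coordDensity (hX : IsImmersionOn G U X V) (hz : z ∈ V) :
    ContinuousAt (coordDensity G X) z := by
  have hG : ContinuousAt (fun y => G (X y)) z :=
    ContinuousAt.comp (g := G) (hX.metric.contDiffAt (hX.mapsTo hz)).continuousAt
      (hX.contDiffAt hz).continuousAt
  have hh := hX.pullMetric
  have hI : ∀ u v, ContinuousAt (fun y => Willmore.pullMetric G X y u v) z := fun u v =>
    ((hh.contDiffAt hz).continuousAt.clm_apply continuousAt_const).clm_apply continuousAt_const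
  have hd := (hX.contDiffAt_fderiv hz).continuousAt
  have hdd := ((hX.contDiffAt_fderiv hz).fderiv_right (m := ∞) (by simp)).continuousAt
  have hΓ : ContinuousAt (fun y => christoffelL G (X y)) z :=
    ContinuousAt.comp (g := christoffelL G)
      (hX.metric.contDiffAt_christoffelL (hX.mapsTo hz)).continuousAt
      (hX.contDiffAt hz).continuousAt
  have hΓh := (hh.contDiffAt_christoffelL hz).continuousAt
  have hN : ∀ u v, ContinuousAt (fun y => normalHessian G X y u v) z := fun u v => by
    simp only [normalHessian, hessianAlong, ← christoffelL_apply]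
    exact (((hdd.clm_apply continuousAt_const).clm_apply continuousAt_const).add
      ((hΓ.clm_apply (hd.clm_apply continuousAt_const)).clm_apply
        (hd.clm_apply continuousAt_const))).sub
      (hd.clm_apply ((hΓh.clm_apply continuousAt_const).clm_apply continuousAt_const))
  have hP := (((hI (stdVec 1) (stdVec 1)).smul (hN (stdVec 0) (stdVec 0))).sub
    ((continuousAt_const (y := (2 : ℝ)).mul (hI (stdVec 0) (stdVec 1))).smul
      (hN (stdVec 0) (stdVec 1)))).add ((hI (stdVec 0) (stdVec 0)).smul (hN (stdVec 1) (stdVec 1)))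
  have hD := ((hI (stdVec 0) (stdVec 0)).mul (hI (stdVec 1) (stdVec 1))).sub
    ((hI (stdVec 0) (stdVec 1)).pow 2)
  have hpos := (hh.det_pos hz).ne'
  refine ((((hG.clm_apply hP).clm_apply hP).div (continuousAt_const.mul (hD.pow 2)) ?_)).add
    ((((hG.clm_apply (hN _ _)).clm_apply (hN _ _)).sub
      ((hG.clm_apply (hN _ _)).clm_apply (hN _ _))).div hD hpos)
  exact mul_ne_zero (by norm_num) (pow_ne_zero 2 hpos)

end IsImmersionOn
end CoordinateDensity

theorem IsImmersionOn.change_metric {m n : ℕ} {G G' : Euc n → Euc n →L[ℝ] Euc n →L[ℝ] ℝ}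
    {U U' : Set (Euc n)} {X : Euc m → Euc n} {V : Set (Euc m)} (hX : IsImmersionOn G U X V)
    (hG' : IsMetricOn G' U') : IsImmersionOn G' U' X (V ∩ X ⁻¹' U') where
  metric := hG'
  isOpen := hX.contDiffOn.continuousOn.isOpen_inter_preimage hX.isOpen hG'.isOpen
  contDiffOn := hX.contDiffOn.mono Set.inter_subset_left
  mapsTo _ hz := hz.2
  injective z hz := hX.injective z hz.1

/-! ### The second fundamental form in charts -/

section General

variable {m n : ℕ} {M : Type v} [TopologicalSpace M] [ChartedSpace (Euc m) M]
  {N : Type u} [TopologicalSpace N] [ChartedSpace (Euc n) N] [IsManifold (𝓡 n) ∞ N]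

theorem inv_gram_mulVec {G : Euc m → Euc m →L[ℝ] Euc m →L[ℝ] ℝ} {U : Set (Euc m)} {y : Euc m}
    (hG : IsMetricOn G U) (hy : y ∈ U) (w : Euc m) :
    ∑ i, ∑ j, ((gram G y)⁻¹ i j * G y w (stdVec j)) • (stdVec i : Euc m) = w := by
  have h1 : ∀ j, G y w (stdVec j) = (gram G y).mulVec w j := by
    intro j
    rw [hG.symm y hy]
    conv_lhs => rw [← sum_smul_stdVec w]
    simp [Matrix.mulVec, dotProduct, gram, mul_comm]
  have h2 : (gram G y)⁻¹.mulVec ((gram G y).mulVec w) = w := by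
    rw [Matrix.mulVec_mulVec, Matrix.nonsing_inv_mul _ (hG.gram_det_pos hy).ne'.isUnit,
      Matrix.one_mulVec]
  conv_rhs => rw [← sum_smul_stdVec w]
  refine Finset.sum_congr rfl fun i _ => ?_
  rw [← Finset.sum_smul]
  congr 1
  rw [← congrFun h2 i]
  simp [Matrix.mulVec, dotProduct, h1]

variable [IsManifold (𝓡 m) ∞ M]

theorem isImmersionOn_writtenInExtChartAt (g : Metric n N) {x : M → N}
    (hx : IsSmoothImmersion m n x) (p : M) (q : N) :
    IsImmersionOn (inChart g.inner q) (extChartAt (𝓡 n) q).target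
      (extChartAt (𝓡 n) q ∘ x ∘ (extChartAt (𝓡 m) p).symm)
      ((extChartAt (𝓡 m) p).target ∩
        (x ∘ (extChartAt (𝓡 m) p).symm) ⁻¹' (extChartAt (𝓡 n) q).source) :=
  ((isParamOn_extChartAt_symm p).comp_immersion hx).isImmersionOn (isRiemannianField_inner g) q

omit [IsManifold (𝓡 n) ∞ N] [IsManifold (𝓡 m) ∞ M] in
theorem mem_domain (x : M → N) (p : M) : extChartAt (𝓡 m) p p ∈ (extChartAt (𝓡 m) p).target ∩
    (x ∘ (extChartAt (𝓡 m) p).symm) ⁻¹' (extChartAt (𝓡 n) (x p)).source :=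
  ⟨mem_extChartAt_target p, by
    rw [Set.mem_preimage, Function.comp_apply, extChartAt_to_inv]
    exact mem_extChartAt_source (x p)⟩

omit [IsManifold (𝓡 n) ∞ N] [IsManifold (𝓡 m) ∞ M] in
theorem mfderiv_eq_fderiv_writtenInExtChartAt {x : M → N} (hx : IsSmoothImmersion m n x) (p : M) :
    mfderiv (𝓡 m) (𝓡 n) x p =
      fderiv ℝ (writtenInExtChartAt (𝓡 m) (𝓡 n) p x) (extChartAt (𝓡 m) p p) := by
  rw [(hx.1.mdifferentiable (by simp) p).mfderiv, modelWithCornersSelf_coe, Set.range_id,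
    fderivWithin_univ]

omit [IsManifold (𝓡 n) ∞ N] [IsManifold (𝓡 m) ∞ M] in
theorem writtenInExtChartAt_self (x : M → N) (p : M) :
    writtenInExtChartAt (𝓡 m) (𝓡 n) p x (extChartAt (𝓡 m) p p) =
      extChartAt (𝓡 n) (x p) (x p) := by
  simp [writtenInExtChartAt]

omit [IsManifold (𝓡 m) ∞ M] in
theorem firstForm_eq (g : Metric n N) {x : M → N} (hx : IsSmoothImmersion m n x) (p : M)
    (u v : Euc m) : firstForm m g x p u v =
      pullMetric (inChart g.inner (x p)) (writtenInExtChartAt (𝓡 m) (𝓡 n) p x)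
        (extChartAt (𝓡 m) p p) u v := by
  rw [pullMetric_apply, writtenInExtChartAt_self, inChart_self,
    ← mfderiv_eq_fderiv_writtenInExtChartAt hx]
  rfl

omit [IsManifold (𝓡 m) ∞ M] in
theorem firstFormInv_eq (g : Metric n N) {x : M → N} (hx : IsSmoothImmersion m n x) (p : M) :
    firstFormInv m g x p = (gram (pullMetric (inChart g.inner (x p))
      (writtenInExtChartAt (𝓡 m) (𝓡 n) p x)) (extChartAt (𝓡 m) p p))⁻¹ := by
  rw [firstFormInv, gram]
  congr 2
  ext i j
  exact firstForm_eq g hx p _ _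

/-- The second fundamental form in the preferred charts. -/
theorem secondForm_eq (g : Metric n N) {x : M → N} (hx : IsSmoothImmersion m n x) (p : M)
    (u v : Euc m) : secondForm g x p u v =
      normalHessian (inChart g.inner (x p)) (writtenInExtChartAt (𝓡 m) (𝓡 n) p x)
        (extChartAt (𝓡 m) p p) u v := by
  have hX := isImmersionOn_writtenInExtChartAt g hx p (x p)
  have hy := mem_domain (m := m) (n := n) x p
  set G := inChart g.inner (x p) with hG
  set y := extChartAt (𝓡 m) p p with hydef
  set X := writtenInExtChartAt (𝓡 m) (𝓡 n) p x with hXdef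
  change IsImmersionOn G _ X _ at hX
  have hsum := congrArg (fderiv ℝ X y) (inv_gram_mulVec hX.pullMetric hy
    (christoffel (pullMetric G X) y u v))
  simp only [map_sum, map_smul] at hsum
  have e : mfderiv (𝓡 m) (𝓡 n) x p = fderiv ℝ X y := mfderiv_eq_fderiv_writtenInExtChartAt hx p
  have hw : ∀ j : Fin m, g.inner (x p) (ambientDerivative g x p u v)
      (mfderiv (𝓡 m) (𝓡 n) x p (stdVec j)) =
      pullMetric G X y (christoffel (pullMetric G X) y u v) (stdVec j) := by
    intro j
    rw [← hX.inner_hessianAlong hy]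
    have := inChart_self g.inner (x p) (hessianAlong G X y u v) (fderiv ℝ X y (stdVec j))
    rw [← writtenInExtChartAt_self (m := m) x p, ← hG, ← hXdef, ← hydef] at this
    rw [this, e]
    rfl
  rw [normalHessian, ← hsum, ← firstFormInv_eq g hx]
  simp only [← hw, ← e]
  rfl

end General

section Surface

variable {n : ℕ} {M : Type v} [TopologicalSpace M] [ChartedSpace (Euc 2) M] [IsManifold (𝓡 2) ∞ M]
  {N : Type u} [TopologicalSpace N] [ChartedSpace (Euc n) N] [IsManifold (𝓡 n) ∞ N]

/-- The mean curvature vector of a surface in coordinates. -/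
def coordMeanCurvature (G : Euc n → Euc n →L[ℝ] Euc n →L[ℝ] ℝ) (X : Euc 2 → Euc n) (z : Euc 2) :
    Euc n :=
  (2 * (pullMetric G X z (stdVec 0) (stdVec 0) * pullMetric G X z (stdVec 1) (stdVec 1) -
      pullMetric G X z (stdVec 0) (stdVec 1) ^ 2))⁻¹ •
    (pullMetric G X z (stdVec 1) (stdVec 1) • normalHessian G X z (stdVec 0) (stdVec 0) -
      (2 * pullMetric G X z (stdVec 0) (stdVec 1)) • normalHessian G X z (stdVec 0) (stdVec 1) +
      pullMetric G X z (stdVec 0) (stdVec 0) • normalHessian G X z (stdVec 1) (stdVec 1))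

theorem meanCurvature_eq (g : Metric n N) {x : M → N} (hx : IsSmoothImmersion 2 n x) (p : M) :
    meanCurvature 2 g x p = coordMeanCurvature (inChart g.inner (x p))
      (writtenInExtChartAt (𝓡 2) (𝓡 n) p x) (extChartAt (𝓡 2) p p) := by
  have hX := isImmersionOn_writtenInExtChartAt g hx p (x p)
  have hy := mem_domain (m := 2) (n := n) x p
  have h1 := hX.pullMetric.symm _ hy (stdVec 1) (stdVec 0)
  have h2 := hX.normalHessian_symm hy (stdVec 1) (stdVec 0)
  have hm : meanCurvature 2 g x p = (((2 : ℕ) : ℝ)⁻¹ • ∑ i : Fin 2, ∑ j : Fin 2,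
      firstFormInv 2 g x p i j • normalHessian (inChart g.inner (x p))
        (writtenInExtChartAt (𝓡 2) (𝓡 n) p x) (extChartAt (𝓡 2) p p) (stdVec i) (stdVec j) :
      Euc n) := by
    simp only [← secondForm_eq g hx]
    rfl
  suffices hs : @Eq (Euc n) (((2 : ℕ) : ℝ)⁻¹ • ∑ i : Fin 2, ∑ j : Fin 2,
      firstFormInv 2 g x p i j • normalHessian (inChart g.inner (x p))
        (writtenInExtChartAt (𝓡 2) (𝓡 n) p x) (extChartAt (𝓡 2) p p) (stdVec i) (stdVec j))
      (coordMeanCurvature (inChart g.inner (x p))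
        (writtenInExtChartAt (𝓡 2) (𝓡 n) p x) (extChartAt (𝓡 2) p p)) from hm.trans hs
  rw [coordMeanCurvature, firstFormInv_eq g hx]
  set G := inChart g.inner (x p) with hG
  set y := extChartAt (𝓡 2) p p with hydef
  set X := writtenInExtChartAt (𝓡 2) (𝓡 n) p x with hXdef
  change pullMetric G X y _ _ = pullMetric G X y _ _ at h1
  change normalHessian G X y _ _ = normalHessian G X y _ _ at h2
  have e : (gram (pullMetric G X) y)⁻¹ =
      (pullMetric G X y (stdVec 0) (stdVec 0) * pullMetric G X y (stdVec 1) (stdVec 1) -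
        pullMetric G X y (stdVec 0) (stdVec 1) ^ 2)⁻¹ •
      !![pullMetric G X y (stdVec 1) (stdVec 1), -pullMetric G X y (stdVec 0) (stdVec 1);
        -pullMetric G X y (stdVec 0) (stdVec 1), pullMetric G X y (stdVec 0) (stdVec 0)] := by
    rw [Matrix.inv_def, Matrix.adjugate_fin_two, det_gram, Ring.inverse_eq_inv', h1, ← sq]
    simp only [gram, Matrix.of_apply, h1]
  rw [e]
  generalize pullMetric G X y = B at *
  generalize normalHessian G X y = A at *
  have : ∀ (D E F C : ℝ) (a b c : Euc n), ((2 : ℕ) : ℝ)⁻¹ •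
      (((D⁻¹ * C) • a + (D⁻¹ * -F) • b) + ((D⁻¹ * -F) • b + (D⁻¹ * E) • c)) =
      (2 * D)⁻¹ • (C • a - (2 * F) • b + E • c) := by
    intro D E F C a b c
    rw [mul_inv]
    push_cast
    module
  rw [← this]
  simp [Fin.sum_univ_two, h2]

theorem firstForm_umbilic_iff (g : Metric n N) {x : M → N} (hx : IsSmoothImmersion 2 n x) (p : M) :
    (∀ u v : TangentSpace (𝓡 2) p,
        secondForm g x p u v = firstForm 2 g x p u v • meanCurvature 2 g x p) ↔
      coordDensity (inChart g.inner (x p)) (writtenInExtChartAt (𝓡 2) (𝓡 n) p x)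
        (extChartAt (𝓡 2) p p) = 0 := by
  have hX := isImmersionOn_writtenInExtChartAt g hx p (x p)
  have hy := mem_domain (m := 2) (n := n) x p
  set G := inChart g.inner (x p) with hG
  set y := extChartAt (𝓡 2) p p with hydef
  set X := writtenInExtChartAt (𝓡 2) (𝓡 n) p x with hXdef
  change IsImmersionOn G _ X _ at hX
  rw [coordDensity, umbilicDefect_eq_zero_iff (hX.metric.symm _ (hX.mapsTo hy))
    (hX.metric.pos _ (hX.mapsTo hy)) (hX.pullMetric.pos _ hy _ (by simp)) (hX.pullMetric.det_pos hy)
    (H := coordMeanCurvature G X y) rfl]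
  have key : (∀ u v : TangentSpace (𝓡 2) p,
        secondForm g x p u v = firstForm 2 g x p u v • meanCurvature 2 g x p) ↔
      ∀ u v : Euc 2, normalHessian G X y u v = pullMetric G X y u v • coordMeanCurvature G X y := by
    refine forall₂_congr fun u v => ?_
    rw [secondForm_eq g hx p u v, firstForm_eq g hx p u v, meanCurvature_eq g hx]
    rfl
  rw [key]
  refine ⟨fun h => ⟨h _ _, h _ _, h _ _⟩, ?_⟩
  rintro ⟨ha, hb, hc⟩ u v
  obtain ⟨L, hL⟩ := IsImmersionOn.normalHessianL G X y
  have hb' : L (stdVec 1) (stdVec 0) = pullMetric G X y (stdVec 0) (stdVec 1) •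
      coordMeanCurvature G X y := by rw [← hb, ← hL, hX.normalHessian_symm hy]
  rw [hL] at ha hb hc ⊢
  rw [hX.pullMetric.apply_two hy u v]
  conv_lhs => rw [eq_smul_add_smul u, eq_smul_add_smul v]
  simp only [map_add, map_smul, add_apply, smul_apply, ha, hb, hb', hc]
  module

theorem inChart_firstForm_eventuallyEq (g : Metric n N) {x : M → N} (hx : IsSmoothImmersion 2 n x)
    (p : M) : inChart (firstForm 2 g x) p =ᶠ[𝓝 (extChartAt (𝓡 2) p p)]
      pullMetric (inChart g.inner (x p)) (writtenInExtChartAt (𝓡 2) (𝓡 n) p x) := by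
  have hX := isImmersionOn_writtenInExtChartAt g hx p (x p)
  filter_upwards [hX.mem_nhds (mem_domain (m := 2) (n := n) x p)] with y hy
  exact (paramField_firstForm g (mdifferentiableAt_extChartAt_symm hy.1)
    (hx.1.mdifferentiable (by simp) _)).trans (paramField_eq_pullMetric
    (((isParamOn_extChartAt_symm p).comp_immersion hx).mdifferentiableAt hy.1) hy.2)

theorem gaussCurvature_eq (g : Metric n N) {x : M → N} (hx : IsSmoothImmersion 2 n x) (p : M) :
    gaussCurvature g x p = planeCurvature (pullMetric (inChart g.inner (x p))
      (writtenInExtChartAt (𝓡 2) (𝓡 n) p x)) (extChartAt (𝓡 2) p p) (stdVec 0) (stdVec 1) :=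
  (sectionalCurvature_eq_planeCurvature _ _ _ _).trans
    (planeCurvature_congr (inChart_firstForm_eventuallyEq g hx p) _ _)

/-- The integrand of the Willmore functional is the squared norm of the trace-free part of the
second fundamental form: by the Gauss equation, `K - K̃ = (⟨II₀₀, II₁₁⟩ - |II₀₁|²) / det I`. -/
theorem willmoreDensity_eq (g : Metric n N) {x : M → N} (hx : IsSmoothImmersion 2 n x) (p : M) :
    willmoreDensity g x p = coordDensity (inChart g.inner (x p))
      (writtenInExtChartAt (𝓡 2) (𝓡 n) p x) (extChartAt (𝓡 2) p p) := by
  have hX := isImmersionOn_writtenInExtChartAt g hx p (x p)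
  have hy := mem_domain (m := 2) (n := n) x p
  have hA : ambientCurvature g x p = planeCurvature (inChart g.inner (x p))
      (extChartAt (𝓡 n) (x p) (x p))
      (fderiv ℝ (writtenInExtChartAt (𝓡 2) (𝓡 n) p x) (extChartAt (𝓡 2) p p) (stdVec 0))
      (fderiv ℝ (writtenInExtChartAt (𝓡 2) (𝓡 n) p x) (extChartAt (𝓡 2) p p) (stdVec 1)) := by
    rw [← mfderiv_eq_fderiv_writtenInExtChartAt hx]
    exact sectionalCurvature_eq_planeCurvature g.inner (x p) _ _
  have hH : g.inner (x p) (meanCurvature 2 g x p) (meanCurvature 2 g x p) =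
      inChart g.inner (x p) (extChartAt (𝓡 n) (x p) (x p))
        (coordMeanCurvature (inChart g.inner (x p)) (writtenInExtChartAt (𝓡 2) (𝓡 n) p x)
          (extChartAt (𝓡 2) p p))
        (coordMeanCurvature (inChart g.inner (x p)) (writtenInExtChartAt (𝓡 2) (𝓡 n) p x)
          (extChartAt (𝓡 2) p p)) := by
    rw [inChart_self, meanCurvature_eq g hx]
  rw [willmoreDensity, hA, hH, gaussCurvature_eq g hx, ← writtenInExtChartAt_self (m := 2) x p]
  set G := inChart g.inner (x p) with hG
  set y := extChartAt (𝓡 2) p p with hydef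
  set X := writtenInExtChartAt (𝓡 2) (𝓡 n) p x with hXdef
  change IsImmersionOn G _ X _ at hX
  have hgauss := hX.gauss_equation hy (stdVec 0) (stdVec 1) (stdVec 1) (stdVec 0)
  have hD := (hX.pullMetric.det_pos hy).ne'
  rw [hX.normalHessian_symm hy (stdVec 1) (stdVec 0),
    hX.metric.symm _ (hX.mapsTo hy) (normalHessian G X y (stdVec 1) (stdVec 1))] at hgauss
  rw [planeCurvature, planeCurvature, hgauss, coordDensity, umbilicDefect, coordMeanCurvature]
  simp only [← pullMetric_apply, map_smul, smul_apply, smul_eq_mul]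
  field_simp
  ring

theorem willmoreDensity_nonneg (g : Metric n N) {x : M → N} (hx : IsSmoothImmersion 2 n x)
    (p : M) : 0 ≤ willmoreDensity g x p := by
  have hX := isImmersionOn_writtenInExtChartAt g hx p (x p)
  have hy := mem_domain (m := 2) (n := n) x p
  rw [willmoreDensity_eq g hx]
  exact umbilicDefect_nonneg (hX.metric.symm _ (hX.mapsTo hy))
    (hX.metric.self_nonneg (hX.mapsTo hy)) (hX.pullMetric.pos _ hy _ (by simp))
    (hX.pullMetric.det_pos hy) _ _ _

theorem isTotallyUmbilic_iff (g : Metric n N) {x : M → N} (hx : IsSmoothImmersion 2 n x) :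
    IsTotallyUmbilic 2 g x ↔ ∀ p, willmoreDensity g x p = 0 := by
  refine forall_congr' fun p => ?_
  rw [firstForm_umbilic_iff g hx, willmoreDensity_eq g hx]

theorem gaussCurvature_of_isTotallyUmbilic (g : Metric n N) {x : M → N}
    (hx : IsSmoothImmersion 2 n x) (hu : IsTotallyUmbilic 2 g x) (p : M) :
    gaussCurvature g x p = g.inner (x p) (meanCurvature 2 g x p) (meanCurvature 2 g x p) +
      ambientCurvature g x p := by
  have := (isTotallyUmbilic_iff g hx).1 hu p
  rw [willmoreDensity] at this
  linarith

omit [IsManifold (𝓡 2) ∞ M] [IsManifold (𝓡 n) ∞ N] in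
theorem linearIndependent_mfderiv {x : M → N} (hx : IsSmoothImmersion 2 n x) (p : M) :
    LinearIndependent ℝ ![mfderiv (𝓡 2) (𝓡 n) x p (stdVec 0 : Euc 2),
      mfderiv (𝓡 2) (𝓡 n) x p (stdVec 1 : Euc 2)] := by
  rw [LinearIndependent.pair_iff]
  intro s t hst
  have h1 : mfderiv (𝓡 2) (𝓡 n) x p (s • stdVec 0 + t • stdVec 1 : Euc 2) = 0 := by
    rw [← hst]
    exact ((mfderiv (𝓡 2) (𝓡 n) x p).map_add _ _).trans
      (congrArg₂ (· + ·) ((mfderiv (𝓡 2) (𝓡 n) x p).map_smul _ _)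
        ((mfderiv (𝓡 2) (𝓡 n) x p).map_smul _ _))
  have h2 : (s • stdVec 0 + t • stdVec 1 : Euc 2) = 0 := hx.2 p (h1.trans (map_zero _).symm)
  constructor
  · simpa using congrArg (fun v : Euc 2 => v 0) h2
  · simpa using congrArg (fun v : Euc 2 => v 1) h2

/-- The integrand of the Willmore functional is continuous. -/
theorem continuous_willmoreDensity (g : Metric n N) {x : M → N} (hx : IsSmoothImmersion 2 n x) :
    Continuous (willmoreDensity g x) := by
  rw [continuous_iff_continuousAt]
  intro p
  have hX := isImmersionOn_writtenInExtChartAt g hx p (x p)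
  have hy := mem_domain (m := 2) (n := n) x p
  set G := inChart g.inner (x p) with hG
  set X := extChartAt (𝓡 n) (x p) ∘ x ∘ (extChartAt (𝓡 2) p).symm with hXdef
  have hc : ContinuousAt (fun q => coordDensity G X (extChartAt (𝓡 2) p q)) p :=
    ContinuousAt.comp (g := coordDensity G X) (hX.continuousAt_coordDensity hy)
      (continuousAt_extChartAt p)
  refine hc.congr ?_
  have hs : ∀ᶠ q in 𝓝 p, q ∈ (extChartAt (𝓡 2) p).source ∧ x q ∈ (extChartAt (𝓡 n) (x p)).source :=
    Filter.Eventually.and (extChartAt_source_mem_nhds (I := 𝓡 2) p)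
      (hx.1.continuous.continuousAt.eventually (extChartAt_source_mem_nhds (x p)))
  filter_upwards [hs] with q ⟨hq, hxq⟩
  rw [willmoreDensity_eq g hx]
  -- the transition maps of the two pairs of charts
  have hτ := (isParamOn_extChartAt_symm (m := 2) q).isImmersionOn
    (isRiemannianField_firstForm g hx) p
  have hσ := (isParamOn_extChartAt_symm (m := n) (x q)).isImmersionOn
    (isRiemannianField_inner g) (x p)
  have hXq := isImmersionOn_writtenInExtChartAt g hx q (x q)
  have hyq := mem_domain (m := 2) (n := n) x q
  set τ := extChartAt (𝓡 2) p ∘ (extChartAt (𝓡 2) q).symm with hτdef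
  set σ := extChartAt (𝓡 n) (x p) ∘ (extChartAt (𝓡 n) (x q)).symm with hσdef
  set Xq := writtenInExtChartAt (𝓡 2) (𝓡 n) q x with hXqdef
  set yq := extChartAt (𝓡 2) q q with hyqdef
  change IsImmersionOn _ _ Xq _ at hXq
  have hyτ : yq ∈ (extChartAt (𝓡 2) q).target ∩
      (extChartAt (𝓡 2) q).symm ⁻¹' (extChartAt (𝓡 2) p).source :=
    ⟨mem_extChartAt_target q, by rwa [Set.mem_preimage, hyqdef, extChartAt_to_inv]⟩
  have hτy : τ yq = extChartAt (𝓡 2) p q := by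
    rw [hτdef, Function.comp_apply, hyqdef, extChartAt_to_inv]
  have hXy : Xq yq ∈ (extChartAt (𝓡 n) (x q)).target ∩
      (extChartAt (𝓡 n) (x q)).symm ⁻¹' (extChartAt (𝓡 n) (x p)).source :=
    ⟨hXq.mapsTo hyq, by
      rwa [Set.mem_preimage, hXqdef, hyqdef, writtenInExtChartAt_self, extChartAt_to_inv]⟩
  have hXτ : τ yq ∈ (extChartAt (𝓡 2) p).target ∩
      (x ∘ (extChartAt (𝓡 2) p).symm) ⁻¹' (extChartAt (𝓡 n) (x p)).source := by
    rw [hτy]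
    exact ⟨(extChartAt (𝓡 2) p).map_source hq, by
      rwa [Set.mem_preimage, Function.comp_apply, (extChartAt (𝓡 2) p).left_inv hq]⟩
  have e1 : coordDensity (inChart g.inner (x q)) Xq yq = coordDensity (pullMetric G σ) Xq yq := by
    refine coordDensity_congr Filter.EventuallyEq.rfl (hXq.contDiffAt hyq).continuousAt ?_
    filter_upwards [hσ.mem_nhds hXy] with y hy
    exact paramField_eq_pullMetric (mdifferentiableAt_extChartAt_symm hy.1) hy.2
  have e2 : σ ∘ Xq =ᶠ[𝓝 yq] X ∘ τ := by
    filter_upwards [hXq.mem_nhds hyq, hτ.mem_nhds hyτ] with y hy hy'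
    have h1 : (extChartAt (𝓡 n) (x q)).symm (Xq y) = x ((extChartAt (𝓡 2) q).symm y) :=
      (extChartAt (𝓡 n) (x q)).left_inv hy.2
    have h2 : (extChartAt (𝓡 2) p).symm (τ y) = (extChartAt (𝓡 2) q).symm y :=
      (extChartAt (𝓡 2) p).left_inv hy'.2
    simp only [hσdef, hXdef, Function.comp_apply, h1, h2]
  have e3 := hσ.coordDensity_comp_left (hXq.change_metric hσ.pullMetric) ⟨hyq, hXy⟩
  have e4 := hX.coordDensity_comp_right (hτ.change_metric hX.pullMetric) ⟨hyτ, hXτ⟩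
  rw [e1, ← e3, coordDensity_congr e2 ?_ Filter.EventuallyEq.rfl, e4, hτy]
  exact (hσ.contDiffAt hXy).continuousAt.comp (hXq.contDiffAt hyq).continuousAt

end Surface

/-! ### The Riemannian measure of a compact surface -/

section Volume

open MeasureTheory

theorem det_eq_det2 (A : Euc 2 →L[ℝ] Euc 2) : A.det = det2 (A (stdVec 0)) (A (stdVec 1)) := by
  rw [ContinuousLinearMap.det, ← LinearMap.det_toMatrix (EuclideanSpace.basisFun (Fin 2) ℝ).toBasis,
    Matrix.det_fin_two]
  simp [LinearMap.toMatrix_apply, det2]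
  ring

/-- The transformation law of the area density. -/
theorem IsImmersionOn.areaDensity_pullMetric {G : Euc 2 → Euc 2 →L[ℝ] Euc 2 →L[ℝ] ℝ}
    {U V : Set (Euc 2)} {τ : Euc 2 → Euc 2} {z : Euc 2} (hτ : IsImmersionOn G U τ V) (hz : z ∈ V) :
    areaDensity (Willmore.pullMetric G τ) z = |(fderiv ℝ τ z).det| * areaDensity G (τ z) := by
  rw [areaDensity, areaDensity, ← Real.sqrt_sq_eq_abs, ← Real.sqrt_mul (sq_nonneg _), det_eq_det2,
    det_gram, det_gram]
  congr 1
  have h1 := hτ.metric.symm _ (hτ.mapsTo hz) (stdVec 1) (stdVec 0)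
  simp only [pullMetric_apply]
  rw [hτ.metric.apply_two (hτ.mapsTo hz) (fderiv ℝ τ z (stdVec 0)) (fderiv ℝ τ z (stdVec 0)),
    hτ.metric.apply_two (hτ.mapsTo hz) (fderiv ℝ τ z (stdVec 0)) (fderiv ℝ τ z (stdVec 1)),
    hτ.metric.apply_two (hτ.mapsTo hz) (fderiv ℝ τ z (stdVec 1)) (fderiv ℝ τ z (stdVec 0)),
    hτ.metric.apply_two (hτ.mapsTo hz) (fderiv ℝ τ z (stdVec 1)) (fderiv ℝ τ z (stdVec 1)), h1,
    det2]
  ring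

variable {M : Type u} [TopologicalSpace M] [ChartedSpace (Euc 2) M] [IsManifold (𝓡 2) ∞ M]
  {h : ∀ q : M, TangentSpace (𝓡 2) q →L[ℝ] TangentSpace (𝓡 2) q →L[ℝ] ℝ}

theorem IsMetricOn.continuousOn_areaDensity {G : Euc 2 → Euc 2 →L[ℝ] Euc 2 →L[ℝ] ℝ}
    {U : Set (Euc 2)} (hG : IsMetricOn G U) : ContinuousOn (areaDensity G) U := fun _ hz =>
  (hG.contDiffAt_areaDensity hz).continuousAt.continuousWithinAt

omit [IsManifold (𝓡 2) ∞ M] in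
theorem symm_preimage_inter_target (p : M) (A : Set M) :
    (extChartAt (𝓡 2) p).symm ⁻¹' A ∩ (extChartAt (𝓡 2) p).target =
      extChartAt (𝓡 2) p '' (A ∩ (extChartAt (𝓡 2) p).source) := by
  ext y
  constructor
  · rintro ⟨h1, h2⟩
    exact ⟨_, ⟨h1, (extChartAt (𝓡 2) p).map_target h2⟩, (extChartAt (𝓡 2) p).right_inv h2⟩
  · rintro ⟨q, ⟨h1, h2⟩, rfl⟩
    exact ⟨by rwa [Set.mem_preimage, (extChartAt (𝓡 2) p).left_inv h2],
      (extChartAt (𝓡 2) p).map_source h2⟩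

variable [MeasurableSpace M] [BorelSpace M]

omit [IsManifold (𝓡 2) ∞ M] in
theorem measurableSet_image_extChartAt (p : M) {A : Set M} (hA : MeasurableSet A) :
    MeasurableSet (extChartAt (𝓡 2) p '' (A ∩ (extChartAt (𝓡 2) p).source)) := by
  rw [← symm_preimage_inter_target]
  classical
  have h1 := (continuousOn_extChartAt_symm (I := 𝓡 2) p).measurable_piecewise
    (g := fun _ => p) continuousOn_const (isOpen_extChartAt_target p).measurableSet
  convert (h1 hA).inter (isOpen_extChartAt_target (I := 𝓡 2) p).measurableSet using 1
  ext y
  simp only [Set.mem_inter_iff, Set.mem_preimage]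
  refine and_congr_left fun hy => ?_
  rw [Set.piecewise_eq_of_mem _ _ _ hy]

omit [IsManifold (𝓡 2) ∞ M] in
theorem chartVolume_apply (h : ∀ q : M, TangentSpace (𝓡 2) q →L[ℝ] TangentSpace (𝓡 2) q →L[ℝ] ℝ)
    (p : M) {A : Set M} (hA : MeasurableSet A) : chartVolume h p A =
      ∫⁻ y in extChartAt (𝓡 2) p '' (A ∩ (extChartAt (𝓡 2) p).source),
        ENNReal.ofReal (areaDensity (inChart h p) y) := by
  have hm : AEMeasurable (extChartAt (𝓡 2) p).symm
      ((volume.restrict (extChartAt (𝓡 2) p).target).withDensity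
        (fun y => ENNReal.ofReal (√(gram (inChart h p) y).det))) :=
    ((continuousOn_extChartAt_symm p).aemeasurable
      (isOpen_extChartAt_target p).measurableSet).mono_ac (withDensity_absolutelyContinuous _ _)
  rw [chartVolume, Measure.map_apply_of_aemeasurable hm hA, withDensity_apply',
    Measure.restrict_restrict' (isOpen_extChartAt_target p).measurableSet,
    symm_preimage_inter_target]
  rfl

/-- The chart measures agree on the overlaps of charts, by the change of variables formula. -/
theorem chartVolume_eq_of_subset (hh : IsRiemannianField h) (p q : M) {A : Set M}
    (hA : MeasurableSet A) (hp : A ⊆ (extChartAt (𝓡 2) p).source)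
    (hq : A ⊆ (extChartAt (𝓡 2) q).source) : chartVolume h p A = chartVolume h q A := by
  rw [chartVolume_apply h p hA, chartVolume_apply h q hA]
  have hmeas := measurableSet_image_extChartAt p hA
  rw [Set.inter_eq_left.2 hp] at hmeas ⊢
  rw [Set.inter_eq_left.2 hq]
  have hτ := (isParamOn_extChartAt_symm (m := 2) p).isImmersionOn hh q
  set τ := extChartAt (𝓡 2) q ∘ (extChartAt (𝓡 2) p).symm with hτdef
  have hdom : ∀ y ∈ extChartAt (𝓡 2) p '' A, y ∈ (extChartAt (𝓡 2) p).target ∩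
      (extChartAt (𝓡 2) p).symm ⁻¹' (extChartAt (𝓡 2) q).source := by
    rintro y ⟨r, hr, rfl⟩
    exact ⟨(extChartAt (𝓡 2) p).map_source (hp hr), by
      rw [Set.mem_preimage, (extChartAt (𝓡 2) p).left_inv (hp hr)]
      exact hq hr⟩
  have himg : extChartAt (𝓡 2) q '' A = τ '' (extChartAt (𝓡 2) p '' A) := by
    rw [← Set.image_comp]
    refine Set.image_congr fun r hr => ?_
    rw [Function.comp_apply, hτdef, Function.comp_apply, (extChartAt (𝓡 2) p).left_inv (hp hr)]
  have hinj : Set.InjOn τ (extChartAt (𝓡 2) p '' A) := by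
    rintro _ ⟨r, hr, rfl⟩ _ ⟨s, hs, rfl⟩ hrs
    rw [hτdef, Function.comp_apply, Function.comp_apply, (extChartAt (𝓡 2) p).left_inv (hp hr),
      (extChartAt (𝓡 2) p).left_inv (hp hs)] at hrs
    rw [(extChartAt (𝓡 2) q).injOn (hq hr) (hq hs) hrs]
  rw [himg, lintegral_image_eq_lintegral_abs_det_fderiv_mul volume hmeas
    (fun y hy => (hτ.hasFDerivAt (hdom y hy)).hasFDerivWithinAt) hinj]
  refine setLIntegral_congr_fun hmeas fun y hy => ?_
  have h1 : gram (inChart h p) y = gram (pullMetric (inChart h q) τ) y := by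
    have : inChart h p y = pullMetric (inChart h q) τ y :=
      paramField_eq_pullMetric (h := h) (mdifferentiableAt_extChartAt_symm (hdom y hy).1)
        (hdom y hy).2
    rw [gram, gram, this]
  have h2 := hτ.areaDensity_pullMetric (hdom y hy)
  beta_reduce
  rw [← ENNReal.ofReal_mul (abs_nonneg _), ← h2, areaDensity, areaDensity, h1]

variable [CompactSpace M] [Nonempty M]

theorem riemannianVolume_eq_chartVolume (hh : IsRiemannianField h) (p : M) {A : Set M}
    (hA : MeasurableSet A) (hp : A ⊆ (extChartAt (𝓡 2) p).source) :
    riemannianVolume h A = chartVolume h p A := by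
  set c := (exists_chart_cover 2 M).choose with hc
  have hcov : ⋃ k, (extChartAt (𝓡 2) (c k)).source = Set.univ :=
    (exists_chart_cover 2 M).choose_spec
  set D := disjointed fun j => (extChartAt (𝓡 2) (c j)).source with hD
  have hDm : ∀ k, MeasurableSet (D k) := fun k =>
    MeasurableSet.disjointed (fun j => (isOpen_extChartAt_source (c j)).measurableSet) k
  have hAk : ∀ k, MeasurableSet (A ∩ D k) := fun k => hA.inter (hDm k)
  have hU : ⋃ k, A ∩ D k = A := by
    rw [← Set.inter_iUnion, hD, iUnion_disjointed, hcov, Set.inter_univ]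
  have hdisj : Pairwise (Function.onFun Disjoint fun k => A ∩ D k) := fun i j hij =>
    (disjoint_disjointed (fun j => (extChartAt (𝓡 2) (c j)).source) hij).mono
      Set.inter_subset_right Set.inter_subset_right
  conv_rhs => rw [← hU, measure_iUnion hdisj hAk]
  rw [riemannianVolume, Measure.sum_apply _ hA]
  refine tsum_congr fun k => ?_
  rw [Measure.restrict_apply hA]
  exact chartVolume_eq_of_subset hh _ _ (hAk k)
    (Set.inter_subset_right.trans (disjointed_subset _ _)) (Set.inter_subset_left.trans hp)

theorem isFiniteMeasure_riemannianVolume (hh : IsRiemannianField h) :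
    IsFiniteMeasure (riemannianVolume h) := by
  have : IsLocallyFiniteMeasure (riemannianVolume h) := by
    refine ⟨fun p => ?_⟩
    obtain ⟨r, hr, hball⟩ := Metric.nhds_basis_closedBall.mem_iff.1
      (extChartAt_target_mem_nhds (I := 𝓡 2) p)
    set A := (extChartAt (𝓡 2) p).source ∩
      extChartAt (𝓡 2) p ⁻¹' Metric.ball (extChartAt (𝓡 2) p p) r with hAdef
    have hAo : IsOpen A := (continuousOn_extChartAt p).isOpen_inter_preimage
      (isOpen_extChartAt_source p) Metric.isOpen_ball
    refine ⟨A, hAo.mem_nhds ⟨mem_extChartAt_source p, Metric.mem_ball_self hr⟩, ?_⟩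
    rw [riemannianVolume_eq_chartVolume hh p hAo.measurableSet Set.inter_subset_left,
      chartVolume_apply h p hAo.measurableSet]
    have hint : IntegrableOn (areaDensity (inChart h p))
        (Metric.closedBall (extChartAt (𝓡 2) p p) r) :=
      ((hh p).continuousOn_areaDensity.mono hball).integrableOn_compact
        (isCompact_closedBall _ _)
    refine lt_of_le_of_lt (lintegral_mono_set ?_) hint.lintegral_lt_top
    rintro _ ⟨q, hq, rfl⟩
    exact Metric.ball_subset_closedBall hq.1.2
  infer_instance

theorem isOpenPosMeasure_riemannianVolume (hh : IsRiemannianField h) :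
    (riemannianVolume h).IsOpenPosMeasure := by
  refine ⟨fun U hU ⟨p, hp⟩ h0 => ?_⟩
  set A := U ∩ (extChartAt (𝓡 2) p).source with hAdef
  have hAo : IsOpen A := hU.inter (isOpen_extChartAt_source p)
  have h1 : riemannianVolume h A = 0 := measure_mono_null Set.inter_subset_left h0
  rw [riemannianVolume_eq_chartVolume hh p hAo.measurableSet Set.inter_subset_right,
    chartVolume_apply h p hAo.measurableSet, ← symm_preimage_inter_target] at h1
  set S := (extChartAt (𝓡 2) p).symm ⁻¹' A ∩ (extChartAt (𝓡 2) p).target with hS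
  have hSo : IsOpen S := by
    rw [hS, Set.inter_comm]
    exact (continuousOn_extChartAt_symm p).isOpen_inter_preimage (isOpen_extChartAt_target p) hAo
  have hne : S.Nonempty := ⟨extChartAt (𝓡 2) p p, by
    rw [Set.mem_preimage, extChartAt_to_inv]
    exact ⟨hp, mem_extChartAt_source p⟩, mem_extChartAt_target p⟩
  have hm : AEMeasurable (fun y => ENNReal.ofReal (areaDensity (inChart h p) y))
      (volume.restrict S) :=
    (((hh p).continuousOn_areaDensity.mono Set.inter_subset_right).aemeasurable
      hSo.measurableSet).ennreal_ofReal
  rw [lintegral_eq_zero_iff' hm] at h1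
  have h2 := (ae_restrict_iff' hSo.measurableSet).1 h1
  have h3 : volume S = 0 := by
    refine measure_mono_null (fun y hy => ?_) h2
    intro h4
    have h5 := h4 hy
    simp only [Pi.zero_apply, ENNReal.ofReal_eq_zero] at h5
    exact h5.not_gt ((hh p).areaDensity_pos hy.2)
  exact (hSo.measure_pos volume hne).ne' h3

end Volume

/-! ### The Willmore functional -/

section Functional

open MeasureTheory

variable {n : ℕ} {M : Type v} [TopologicalSpace M] [ChartedSpace (Euc 2) M] [IsManifold (𝓡 2) ∞ M]
  [MeasurableSpace M] [BorelSpace M] [CompactSpace M] [Nonempty M]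
  {N : Type u} [TopologicalSpace N] [ChartedSpace (Euc n) N] [IsManifold (𝓡 n) ∞ N]

theorem integrable_willmoreDensity (g : Metric n N) {x : M → N} (hx : IsSmoothImmersion 2 n x) :
    Integrable (willmoreDensity g x) (inducedVolume g x) := by
  have : IsFiniteMeasure (inducedVolume g x) :=
    isFiniteMeasure_riemannianVolume (isRiemannianField_firstForm g hx)
  exact (continuous_willmoreDensity g hx).integrable_of_hasCompactSupport
    (HasCompactSupport.of_compactSpace _)

omit [BorelSpace M] in
theorem willmore_nonneg (g : Metric n N) {x : M → N} (hx : IsSmoothImmersion 2 n x) :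
    0 ≤ willmore g x :=
  integral_nonneg fun p => willmoreDensity_nonneg g hx p

theorem willmore_eq_zero_iff (g : Metric n N) {x : M → N} (hx : IsSmoothImmersion 2 n x) :
    willmore g x = 0 ↔ IsTotallyUmbilic 2 g x := by
  have := isOpenPosMeasure_riemannianVolume (isRiemannianField_firstForm g hx)
  rw [willmore, integral_eq_zero_iff_of_nonneg (fun p => willmoreDensity_nonneg g hx p)
    (integrable_willmoreDensity g hx), isTotallyUmbilic_iff g hx, inducedVolume,
    (continuous_willmoreDensity g hx).ae_eq_iff_eq _ continuous_zero, funext_iff]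
  rfl

end Functional

/-! ### Tori -/

section Torus

variable {T : Type u} [TopologicalSpace T] [ChartedSpace (Euc 2) T]

theorem contMDiff_coe_circle : ContMDiff (𝓡 1) 𝓘(ℝ, ℂ) ∞ (fun c : Circle => (c : ℂ)) :=
  have : Fact (Module.finrank ℝ ℂ = 1 + 1) := finrank_real_complex_fact'
  contMDiff_coe_sphere (E := ℂ) (n := 1)

/-- The universal cover of a torus: a surjective local diffeomorphism from the plane that is
`2π`-periodic in both coordinates. -/
theorem IsTorus.exists_isParamOn (hT : IsTorus T) : ∃ F : Euc 2 → T, IsParamOn 2 F Set.univ ∧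
    Function.Surjective F ∧ ∀ y i, F (y + (2 * Real.pi) • stdVec i) = F y := by
  obtain ⟨e⟩ := hT
  set c : Euc 2 → Circle × Circle := fun z => (Circle.exp (z 0), Circle.exp (z 1)) with hc
  have hcoord : ∀ i : Fin 2, ContMDiff 𝓘(ℝ, Euc 2) 𝓘(ℝ, ℝ) ∞ fun z : Euc 2 => z i := fun i =>
    (EuclideanSpace.proj (𝕜 := ℝ) i).contMDiff
  have hcs : ContMDiff 𝓘(ℝ, Euc 2) ((𝓡 1).prod (𝓡 1)) ∞ c :=
    (contMDiff_circleExp.comp (hcoord 0)).prodMk (contMDiff_circleExp.comp (hcoord 1))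
  have hF : ContMDiff 𝓘(ℝ, Euc 2) (𝓡 2) ∞ (e.symm ∘ c) := e.symm.contMDiff.comp hcs
  refine ⟨e.symm ∘ c, ⟨isOpen_univ, hF.contMDiffOn, fun z _ => ?_⟩, ?_, ?_⟩
  · have key : ∀ (i : Fin 2) (K : T → ℂ), ContMDiff (𝓡 2) 𝓘(ℝ, ℂ) ∞ K →
        (∀ z, K (e.symm (c z)) = Complex.exp (z i * Complex.I)) → ∀ u : Euc 2,
        mfderiv 𝓘(ℝ, Euc 2) (𝓡 2) (e.symm ∘ c) z u = 0 → u i = 0 := by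
      intro i K hK hKc u hu
      have h1 := mfderiv_comp z (hK.mdifferentiable (by simp) ((e.symm ∘ c) z))
        (hF.mdifferentiable (by simp) z)
      have h2 : K ∘ (e.symm ∘ c) = fun z : Euc 2 => Complex.exp (z i * Complex.I) := funext hKc
      set P : Euc 2 →L[ℝ] ℝ := EuclideanSpace.proj i
      have h3 : HasFDerivAt (fun z : Euc 2 => Complex.exp (z i * Complex.I))
          (Complex.exp (z i * Complex.I) • ((Complex.I : ℂ) •
            (Complex.ofRealCLM.comp P))) z := by
        have h4 : HasFDerivAt (fun z : Euc 2 => (z i : ℂ)) (Complex.ofRealCLM.comp P) z :=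
          (Complex.ofRealCLM.comp P).hasFDerivAt
        exact (h4.mul_const Complex.I).cexp
      rw [h2, mfderiv_eq_fderiv, h3.fderiv] at h1
      have h5 := congrArg (fun L => L u) h1
      have h6 : (mfderiv (𝓡 2) 𝓘(ℝ, ℂ) K ((e.symm ∘ c) z)
          (mfderiv 𝓘(ℝ, Euc 2) (𝓡 2) (e.symm ∘ c) z u) : ℂ) = 0 := by
        rw [hu]
        exact map_zero _
      have h7 : Complex.exp (z i * Complex.I) * (Complex.I * (u i : ℂ)) = 0 := h5.trans h6
      simpa [Complex.exp_ne_zero] using h7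
    have h0 : ∀ u : Euc 2, mfderiv 𝓘(ℝ, Euc 2) (𝓡 2) (e.symm ∘ c) z u = 0 → u = 0 := by
      intro u hu
      ext i
      fin_cases i
      · refine key 0 (fun q => ((e q).1 : ℂ))
          (contMDiff_coe_circle.comp (contMDiff_fst.comp e.contMDiff)) (fun z => ?_) u hu
        simp [hc]
      · refine key 1 (fun q => ((e q).2 : ℂ))
          (contMDiff_coe_circle.comp (contMDiff_snd.comp e.contMDiff)) (fun z => ?_) u hu
        simp [hc]
    exact (injective_iff_map_eq_zero (mfderiv 𝓘(ℝ, Euc 2) (𝓡 2) (e.symm ∘ c) z)).2 h0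
  · refine e.symm.surjective.comp fun w => ?_
    obtain ⟨s, hs⟩ := Circle.exp_surjective w.1
    obtain ⟨t, ht⟩ := Circle.exp_surjective w.2
    exact ⟨!₂[s, t], by simp [hc, hs, ht]⟩
  · intro y i
    simp only [Function.comp_apply]
    congr 1
    fin_cases i <;> simp [hc]

theorem paramField_add_const (h : ∀ q : T, TangentSpace (𝓡 2) q →L[ℝ] TangentSpace (𝓡 2) q →L[ℝ] ℝ)
    {F : Euc 2 → T} (hF : MDifferentiable 𝓘(ℝ, Euc 2) (𝓡 2) F) (w : Euc 2)
    (hw : ∀ y, F (y + w) = F y) (y : Euc 2) : paramField h F (y + w) = paramField h F y := by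
  have h1 : F ∘ (· + w) = F := funext hw
  have h2 := paramField_comp (h := h) (ψ := F) (τ := (· + w)) (z := y) (hF _) (by fun_prop)
  rw [h1] at h2
  rw [h2]
  ext u v
  simp [fderiv_add_const]

/-- A torus of nonnegative Gauss curvature is flat. -/
theorem IsTorus.sectionalCurvature_eq_zero [IsManifold (𝓡 2) ∞ T] (hT : IsTorus T)
    {h : ∀ q : T, TangentSpace (𝓡 2) q →L[ℝ] TangentSpace (𝓡 2) q →L[ℝ] ℝ}
    (hh : IsRiemannianField h)
    (hK : ∀ p, 0 ≤ sectionalCurvature h p (stdVec 0 : Euc 2) (stdVec 1 : Euc 2)) (p : T) :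
    sectionalCurvature h p (stdVec 0 : Euc 2) (stdVec 1 : Euc 2) = 0 := by
  obtain ⟨F, hF, hsurj, hper⟩ := hT.exists_isParamOn
  obtain ⟨y, rfl⟩ := hsurj p
  rw [hF.sectionalCurvature_eq hh (Set.mem_univ y)]
  refine (hF.isMetricOn hh).curvature_eq_zero_of_periodic Real.two_pi_pos (fun y i => ?_)
    (fun y => ?_) y
  · exact paramField_add_const h (fun z => hF.mdifferentiableAt (Set.mem_univ z)) _
      (fun y => hper y i) y
  · rw [← hF.sectionalCurvature_eq hh (Set.mem_univ y)]
    exact hK _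

end Torus

section TorusImmersion

variable {n : ℕ} {T : Type v} [TopologicalSpace T] [ChartedSpace (Euc 2) T] [IsManifold (𝓡 2) ∞ T]
  {N : Type u} [TopologicalSpace N] [ChartedSpace (Euc n) N] [IsManifold (𝓡 n) ∞ N]

theorem inner_self_nonneg (g : Metric n N) (q : N) (v : TangentSpace (𝓡 n) q) :
    0 ≤ g.inner q v v := by
  rcases eq_or_ne v 0 with rfl | hv
  · simp
  · exact (g.pos q v hv).le

/-- On a totally umbilic torus `K = |H|² + K̃ ≥ 0`, hence `K = 0`, which forces `H = 0`. -/
theorem IsTorus.isFlat_and_isTotallyGeodesic (hT : IsTorus T) {g : Metric n N}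
    (hg : NonnegativeSectionalCurvature g) {x : T → N} (hx : IsSmoothImmersion 2 n x)
    (hu : IsTotallyUmbilic 2 g x) : IsFlat g x ∧ IsTotallyGeodesic 2 g x := by
  have hA : ∀ p, 0 ≤ ambientCurvature g x p := fun p =>
    hg _ _ _ (linearIndependent_mfderiv hx p)
  have hK := gaussCurvature_of_isTotallyUmbilic g hx hu
  have hflat : IsFlat g x := fun p =>
    hT.sectionalCurvature_eq_zero (isRiemannianField_firstForm g hx) (fun q => by
      have := hK q
      rw [gaussCurvature] at this
      rw [this]
      exact add_nonneg (inner_self_nonneg g _ _) (hA q)) p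
  refine ⟨hflat, fun p u v => ?_⟩
  have h1 := hK p
  rw [hflat p] at h1
  have h2 : meanCurvature 2 g x p = 0 := by
    by_contra h0
    have := g.pos (x p) _ h0
    linarith [hA p]
  rw [hu p u v, h2, smul_zero]

theorem gaussCurvature_pos_of_isTotallyUmbilic {g : Metric n N}
    (hg : PositiveSectionalCurvature g) {x : T → N} (hx : IsSmoothImmersion 2 n x)
    (hu : IsTotallyUmbilic 2 g x) (p : T) : 0 < gaussCurvature g x p := by
  rw [gaussCurvature_of_isTotallyUmbilic g hx hu]
  exact add_pos_of_nonneg_of_pos (inner_self_nonneg g _ _)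
    (hg _ _ _ (linearIndependent_mfderiv hx p))

theorem IsTorus.not_isTotallyUmbilic [Nonempty T] (hT : IsTorus T) {g : Metric n N}
    (hg : PositiveSectionalCurvature g) {x : T → N} (hx : IsSmoothImmersion 2 n x) :
    ¬ IsTotallyUmbilic 2 g x := fun hu => by
  have hpos := gaussCurvature_pos_of_isTotallyUmbilic hg hx hu
  obtain ⟨p⟩ := ‹Nonempty T›
  exact (hpos p).ne' (hT.sectionalCurvature_eq_zero (isRiemannianField_firstForm g hx)
    (fun q => (hpos q).le) p)

end TorusImmersion

/-! ### Transition maps between parametrizations -/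

section Transition

variable {M : Type u} [TopologicalSpace M] [ChartedSpace (Euc 2) M] [IsManifold (𝓡 2) ∞ M]
  {ψ ψ' : Euc 2 → M} {V V' : Set (Euc 2)} {z z' : Euc 2}

/-- Injectivity of the differential is an open condition. -/
theorem isParamOn_interior {U : Set (Euc 2)} (hU : IsOpen U)
    (hψ : ContMDiffOn 𝓘(ℝ, Euc 2) (𝓡 2) ∞ ψ U) :
    ∃ V ⊆ U, IsParamOn 2 ψ V ∧
      ∀ z ∈ U, Function.Injective (mfderiv 𝓘(ℝ, Euc 2) (𝓡 2) ψ z) → z ∈ V := by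
  refine ⟨U ∩ interior {z | Function.Injective (mfderiv 𝓘(ℝ, Euc 2) (𝓡 2) ψ z)},
    Set.inter_subset_left, ⟨hU.inter isOpen_interior, hψ.mono Set.inter_subset_left,
    fun z hz => interior_subset hz.2⟩, fun z hz hinj => ⟨hz, mem_interior_iff_mem_nhds.2 ?_⟩⟩
  set p := ψ z with hp
  have hO : IsOpen (U ∩ ψ ⁻¹' (extChartAt (𝓡 2) p).source) :=
    hψ.continuousOn.isOpen_inter_preimage hU (isOpen_extChartAt_source p)
  have hX : ContDiffOn ℝ ∞ (extChartAt (𝓡 2) p ∘ ψ)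
      (U ∩ ψ ⁻¹' (extChartAt (𝓡 2) p).source) := by
    rw [← contMDiffOn_iff_contDiffOn]
    exact (contMDiffOn_extChartAt (n := ∞) (x := p)).comp
      (hψ.mono Set.inter_subset_left) fun z hz => by simpa using hz.2
  have hzO : z ∈ U ∩ ψ ⁻¹' (extChartAt (𝓡 2) p).source := ⟨hz, mem_extChartAt_source p⟩
  have hψd : ∀ y ∈ U, MDifferentiableAt 𝓘(ℝ, Euc 2) (𝓡 2) ψ y := fun y hy =>
    (hψ.contMDiffAt (hU.mem_nhds hy)).mdifferentiableAt (by simp)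
  have hXi : Function.Injective (fderiv ℝ (extChartAt (𝓡 2) p ∘ ψ) z) := by
    intro u v huv
    apply hinj
    rw [mfderiv_eq_comp_extChartAt (hψd z hz) hzO.2, mfderiv_eq_comp_extChartAt (hψd z hz) hzO.2,
      huv]
  have hc := (hX.continuousOn_fderiv_of_isOpen hO (by simp)).continuousAt (hO.mem_nhds hzO)
  have hdet : ContinuousAt (fun y => (fderiv ℝ (extChartAt (𝓡 2) p ∘ ψ) y).det) z :=
    ContinuousAt.comp (g := ContinuousLinearMap.det) ContinuousLinearMap.continuous_det.continuousAt
      hc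
  have hne : (fderiv ℝ (extChartAt (𝓡 2) p ∘ ψ) z).det ≠ 0 := by
    rw [det_eq_det2]
    exact det2_ne_zero_of_injective hXi
  filter_upwards [hdet.eventually_ne hne, hO.mem_nhds hzO] with y hy hyO
  have h1 : Function.Injective (fderiv ℝ (extChartAt (𝓡 2) p ∘ ψ) y) :=
    (ContinuousLinearMap.toContinuousLinearEquivOfDetNeZero _ hy).injective
  intro u v huv
  apply h1
  apply injective_mfderiv_extChartAt_symm ((extChartAt (𝓡 2) p).map_source hyO.2)
  exact (mfderiv_eq_comp_extChartAt (hψd y hyO.1) hyO.2 u).symm.trans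
    (huv.trans (mfderiv_eq_comp_extChartAt (hψd y hyO.1) hyO.2 v))

/-- Two parametrizations with a common value differ by a local diffeomorphism `τ`. The last
property makes `τ` the only way to match points near `z` with points near `z'`; for `ψ' = ψ` it
gives local injectivity. -/
theorem IsParamOn.exists_transition
    {h : ∀ q : M, TangentSpace (𝓡 2) q →L[ℝ] TangentSpace (𝓡 2) q →L[ℝ] ℝ}
    (hh : IsRiemannianField h) (hψ : IsParamOn 2 ψ V) (hψ' : IsParamOn 2 ψ' V') (hz : z ∈ V)
    (hz' : z' ∈ V') (heq : ψ z = ψ' z') :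
    ∃ (τ : Euc 2 → Euc 2) (W O : Set (Euc 2)), z ∈ W ∧ W ⊆ V ∧ IsOpen O ∧ z' ∈ O ∧
      IsImmersionOn (paramField h ψ') V' τ W ∧ τ z = z' ∧ (∀ y ∈ W, ψ' (τ y) = ψ y) ∧
      ∀ y ∈ W, ∀ y' ∈ O, ψ y = ψ' y' → τ y = y' := by
  set p := ψ' z' with hp
  set X := extChartAt (𝓡 2) p ∘ ψ with hXdef
  set X' := extChartAt (𝓡 2) p ∘ ψ' with hX'def
  have hX := hψ.isImmersionOn hh p
  have hX' := hψ'.isImmersionOn hh p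
  have hz0 : z ∈ V ∩ ψ ⁻¹' (extChartAt (𝓡 2) p).source :=
    ⟨hz, by rw [Set.mem_preimage, heq]; exact mem_extChartAt_source p⟩
  have hz0' : z' ∈ V' ∩ ψ' ⁻¹' (extChartAt (𝓡 2) p).source := ⟨hz', mem_extChartAt_source p⟩
  have hequiv : ∀ y ∈ V' ∩ ψ' ⁻¹' (extChartAt (𝓡 2) p).source, ∃ A : Euc 2 ≃L[ℝ] Euc 2,
      HasFDerivAt X' (A : Euc 2 →L[ℝ] Euc 2) y := by
    intro y hy
    refine ⟨ContinuousLinearMap.toContinuousLinearEquivOfDetNeZero (fderiv ℝ X' y)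
      ((det_eq_det2 _).trans_ne (det2_ne_zero_of_injective (hX'.injective y hy))), ?_⟩
    exact hX'.hasFDerivAt hy
  obtain ⟨A, hA⟩ := hequiv z' hz0'
  set e := (hX'.contDiffAt hz0').toOpenPartialHomeomorph X' hA (by simp) with he
  have hecoe : ∀ y, e y = X' y := fun y => rfl
  have hes : z' ∈ e.source := (hX'.contDiffAt hz0').mem_toOpenPartialHomeomorph_source hA (by simp)
  set D' := V' ∩ ψ' ⁻¹' (extChartAt (𝓡 2) p).source with hD'
  set O := e.source ∩ D' with hO
  have hOo : IsOpen O := e.open_source.inter hX'.isOpen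
  have hXz : X z = e z' := by rw [hecoe, hXdef, hX'def, Function.comp_apply, heq]; rfl
  -- the open set on which the local inverse of `X'` can be applied to `X`
  set T := e.target ∩ e.symm ⁻¹' D' with hT
  have hTo : IsOpen T := e.continuousOn_symm.isOpen_inter_preimage e.open_target hX'.isOpen
  set W := (V ∩ ψ ⁻¹' (extChartAt (𝓡 2) p).source) ∩ X ⁻¹' T with hW
  have hWo : IsOpen W := hX.contDiffOn.continuousOn.isOpen_inter_preimage hX.isOpen hTo
  have hzW : z ∈ W := by
    refine ⟨hz0, ?_⟩
    rw [Set.mem_preimage, hXz]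
    refine ⟨e.map_source hes, ?_⟩
    rw [Set.mem_preimage, e.left_inv hes]
    exact hz0'
  have hτψ : ∀ y ∈ W, ψ' (e.symm (X y)) = ψ y := by
    intro y hy
    have h1 : X' (e.symm (X y)) = X y := (hecoe _).symm.trans (e.right_inv hy.2.1)
    exact (extChartAt (𝓡 2) p).injOn hy.2.2.2 hy.1.2 h1
  have hsmooth : ContDiffOn ℝ ∞ (e.symm ∘ X) W := by
    intro y hy
    obtain ⟨A', hA'⟩ := hequiv _ hy.2.2
    have h1 : ContDiffAt ℝ ∞ e.symm (X y) :=
      e.contDiffAt_symm hy.2.1 (f₀' := A') hA' (hX'.contDiffAt hy.2.2)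
    exact (h1.comp y (hX.contDiffAt hy.1)).contDiffWithinAt
  have hmaps : Set.MapsTo (e.symm ∘ X) W V' := fun y hy => hy.2.2.1
  refine ⟨e.symm ∘ X, W, O, hzW, fun y hy => hy.1.1, hOo, ⟨hes, hz0'⟩,
    ⟨hψ'.isMetricOn hh, hWo, hsmooth, hmaps, fun y hy => ?_⟩, ?_, hτψ, ?_⟩
  · have h1 : ψ' ∘ (e.symm ∘ X) =ᶠ[𝓝 y] ψ := by
      filter_upwards [hWo.mem_nhds hy] with y' hy' using hτψ y' hy'
    have h2 := hψ.injective y hy.1.1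
    have h3 := mfderiv_comp y (hψ'.mdifferentiableAt (hmaps hy))
      ((hsmooth.contDiffAt (hWo.mem_nhds hy)).differentiableAt (by simp)).mdifferentiableAt
    rw [mfderiv_eq_fderiv, h1.mfderiv_eq] at h3
    intro u v huv
    apply h2
    refine (congrArg (fun L => L u) h3).trans (Eq.trans ?_ (congrArg (fun L => L v) h3).symm)
    exact congrArg (mfderiv 𝓘(ℝ, Euc 2) (𝓡 2) ψ' ((e.symm ∘ X) y)) huv
  · rw [Function.comp_apply, hXz, e.left_inv hes]
  · intro y _ y' hy' hyy
    have : X y = e y' := by rw [hecoe, hXdef, hX'def, Function.comp_apply, hyy]; rfl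
    rw [Function.comp_apply, this, e.left_inv hy'.1]

theorem IsParamOn.exists_injOn
    {h : ∀ q : M, TangentSpace (𝓡 2) q →L[ℝ] TangentSpace (𝓡 2) q →L[ℝ] ℝ}
    (hh : IsRiemannianField h) (hψ : IsParamOn 2 ψ V) (hz : z ∈ V) :
    ∃ O : Set (Euc 2), IsOpen O ∧ z ∈ O ∧ Set.InjOn ψ O := by
  obtain ⟨τ, W, O, hzW, -, hO, hzO, hτ, -, -, hloc⟩ := hψ.exists_transition hh hψ hz hz rfl
  refine ⟨W ∩ O, hτ.isOpen.inter hO, ⟨hzW, hzO⟩, fun y hy y' hy' hyy => ?_⟩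
  rw [← hloc y hy.1 y hy.2 rfl, hloc y hy.1 y' hy'.2 hyy]

/-- The transformation law of the geodesic curvature of a curve that is a straight line in both
parametrizations. -/
theorem IsImmersionOn.connForm_pullMetric {G : Euc 2 → Euc 2 →L[ℝ] Euc 2 →L[ℝ] ℝ}
    {U : Set (Euc 2)} {τ : Euc 2 → Euc 2} (hτ : IsImmersionOn G U τ V) (hz : z ∈ V) {w w' : Euc 2}
    (hline : ∀ᶠ r : ℝ in 𝓝 0, τ (z + r • w) = τ z + r • w') :
    fderiv ℝ τ z w = w' ∧ connForm (Willmore.pullMetric G τ) z w w =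
      SignType.sign (fderiv ℝ τ z).det * connForm G (τ z) w' w' := by
  have hγ : ∀ r : ℝ, HasDerivAt (fun r : ℝ => z + r • w) w r := fun r => by
    simpa using ((hasDerivAt_id r).smul_const w).const_add z
  have hγ' : ∀ r : ℝ, HasDerivAt (fun r : ℝ => τ z + r • w') w' r := fun r => by
    simpa using ((hasDerivAt_id r).smul_const w').const_add (τ z)
  have hV : ∀ᶠ r : ℝ in 𝓝 0, z + r • w ∈ V := by
    have := (hγ 0).continuousAt
    rw [ContinuousAt, zero_smul, add_zero] at this
    exact this.eventually (hτ.mem_nhds hz)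
  have h1 : ∀ᶠ r : ℝ in 𝓝 0, fderiv ℝ τ (z + r • w) w = w' := by
    filter_upwards [hV, hline.eventually_nhds] with r hr hr'
    exact (((hτ.hasFDerivAt hr).comp_hasDerivAt r (hγ r)).congr_of_eventuallyEq
      (hr'.mono fun _ h => h.symm)).unique (hγ' r)
  have h2 : fderiv ℝ τ z w = w' := by simpa using h1.self_of_nhds
  have h3 : fderiv ℝ (fderiv ℝ τ) z w w = 0 := by
    have e1 : HasFDerivAt (fun y => fderiv ℝ τ y w) ((fderiv ℝ (fderiv ℝ τ) z).flip w) z := by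
      refine ((hτ.hasFDerivAt_fderiv hz).clm_apply (hasFDerivAt_const w z)).congr_fderiv ?_
      ext w; simp
    have e2 : HasFDerivAt (fun y => fderiv ℝ τ y w) ((fderiv ℝ (fderiv ℝ τ) z).flip w)
        (z + (0 : ℝ) • w) := by rwa [zero_smul, add_zero]
    have e3 : HasDerivAt (fun r : ℝ => fderiv ℝ τ (z + r • w) w)
        ((fderiv ℝ (fderiv ℝ τ) z).flip w w) 0 :=
      HasFDerivAt.comp_hasDerivAt (l := fun y => fderiv ℝ τ y w) (0 : ℝ) e2 (hγ 0)
    exact e3.unique ((hasDerivAt_const (0 : ℝ) w').congr_of_eventuallyEq h1)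
  refine ⟨h2, ?_⟩
  have h4 := hτ.normalHessian_eq_zero hz w w
  rw [normalHessian, hessianAlong, h3, h2, zero_add, sub_eq_zero] at h4
  have hinj := det2_ne_zero_of_injective (hτ.injective z hz)
  have h6 : ∀ v, det2 w' (fderiv ℝ τ z v) =
      det2 (fderiv ℝ τ z (stdVec 0)) (fderiv ℝ τ z (stdVec 1)) * det2 w v := fun v => by
    rw [← h2, det2_map]
  rw [connForm, connForm, hτ.areaDensity_pullMetric hz, h4, pullMetric_apply, h2, det_eq_det2, h6]
  rcases lt_or_gt_of_ne hinj with h5 | h5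
  · rw [abs_of_neg h5, sign_neg h5]
    simp
    ring
  · rw [abs_of_pos h5, sign_pos h5]
    simp
    ring

end Transition

/-! ### Disjoint sectors in the plane -/

section Sectors

open MeasureTheory Real

/-- Disjoint open arcs of the unit circle have total length at most `2π`. -/
theorem sum_arc_le_two_pi {ι : Type*} (J : Finset ι) (α γ : ι → ℝ)
    (hγ : ∀ j ∈ J, 0 ≤ γ j ∧ γ j ≤ 2 * π)
    (hdisj : ∀ j ∈ J, ∀ j' ∈ J, j ≠ j' → ∀ s ∈ Set.Ioo 0 (γ j), ∀ s' ∈ Set.Ioo 0 (γ j'),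
      Circle.exp (α j + s) ≠ Circle.exp (α j' + s')) : ∑ j ∈ J, γ j ≤ 2 * π := by
  -- the periodic preimages of the arcs on the line, whose lengths are compared over one period
  set S : ι → Set ℝ := fun j => ⋃ n : ℤ, Set.Ioo (α j + n * (2 * π)) (α j + γ j + n * (2 * π))
    with hS
  have hSm : ∀ j, MeasurableSet (S j) := fun j => MeasurableSet.iUnion fun n => measurableSet_Ioo
  have hmem : ∀ j θ, θ ∈ S j → ∃ s ∈ Set.Ioo 0 (γ j), Circle.exp (α j + s) = Circle.exp θ := by
    intro j θ hθ
    obtain ⟨n, hn⟩ := Set.mem_iUnion.1 hθ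
    refine ⟨θ - α j - n * (2 * π), ⟨by linarith [hn.1], by linarith [hn.2]⟩, ?_⟩
    exact Circle.exp_eq_exp.2 ⟨-n, by push_cast; ring⟩
  have hper : ∀ j, Function.Periodic ((S j).indicator (1 : ℝ → ℝ)) (2 * π) := by
    intro j θ
    have : θ + 2 * π ∈ S j ↔ θ ∈ S j := by
      constructor
      · intro h
        obtain ⟨n, hn⟩ := Set.mem_iUnion.1 h
        refine Set.mem_iUnion.2 ⟨n - 1, ?_⟩
        push_cast
        exact ⟨by linarith [hn.1], by linarith [hn.2]⟩
      · intro h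
        obtain ⟨n, hn⟩ := Set.mem_iUnion.1 h
        refine Set.mem_iUnion.2 ⟨n + 1, ?_⟩
        push_cast
        exact ⟨by linarith [hn.1], by linarith [hn.2]⟩
    by_cases h : θ ∈ S j
    · rw [Set.indicator_of_mem h, Set.indicator_of_mem (this.2 h)]
      rfl
    · rw [Set.indicator_of_notMem h, Set.indicator_of_notMem fun h' => h (this.1 h')]
  have hint : ∀ (A : Set ℝ), MeasurableSet A → ∀ a b : ℝ,
      IntervalIntegrable (A.indicator (1 : ℝ → ℝ)) volume a b := by
    intro A hA a b
    rw [intervalIntegrable_iff]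
    exact Integrable.indicator (integrableOn_const (by simp)) hA
  have hlow : ∀ j ∈ J, γ j ≤ ∫ θ in (0 : ℝ)..(0 + 2 * π), (S j).indicator (1 : ℝ → ℝ) θ := by
    intro j hj
    rw [(hper j).intervalIntegral_add_eq 0 (α j)]
    have h1 : ∫ θ in (α j)..(α j + 2 * π),
        (Set.Ioo (α j) (α j + γ j)).indicator (1 : ℝ → ℝ) θ = γ j := by
      rw [intervalIntegral.integral_of_le (by linarith [pi_pos]),
        setIntegral_indicator measurableSet_Ioo, Set.inter_eq_right.2]
      · simp [(hγ j hj).1]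
      · exact fun θ hθ => ⟨hθ.1, by linarith [hθ.2, (hγ j hj).2]⟩
    conv_lhs => rw [← h1]
    refine intervalIntegral.integral_mono_on (by linarith [pi_pos])
      (hint _ measurableSet_Ioo _ _) (hint _ (hSm j) _ _) fun θ _ => ?_
    refine Set.indicator_le_indicator_of_subset (fun θ hθ => ?_) (fun _ => zero_le_one) θ
    exact Set.mem_iUnion.2 ⟨0, by simpa using hθ⟩
  calc ∑ j ∈ J, γ j ≤ ∑ j ∈ J, ∫ θ in (0 : ℝ)..(0 + 2 * π), (S j).indicator (1 : ℝ → ℝ) θ :=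
        Finset.sum_le_sum hlow
    _ = ∫ θ in (0 : ℝ)..(0 + 2 * π), ∑ j ∈ J, (S j).indicator (1 : ℝ → ℝ) θ :=
        (intervalIntegral.integral_finsetSum fun j _ => hint _ (hSm j) _ _).symm
    _ ≤ ∫ θ in (0 : ℝ)..(0 + 2 * π), (1 : ℝ) := by
        refine intervalIntegral.integral_mono_on (by linarith [pi_pos]) ?_
          intervalIntegrable_const fun θ _ => ?_
        · have := IntervalIntegrable.sum (μ := volume) (a := 0) (b := 0 + 2 * π) J
            (f := fun j => (S j).indicator (1 : ℝ → ℝ)) fun j _ => hint _ (hSm j) _ _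
          refine this.congr fun θ _ => ?_
          simp
        · by_cases h : ∃ j ∈ J, θ ∈ S j
          · obtain ⟨j, hj, hθ⟩ := h
            rw [Finset.sum_eq_single_of_mem j hj, Set.indicator_of_mem hθ]
            · rfl
            · intro j' hj' hne
              refine Set.indicator_of_notMem (fun hθ' => ?_) _
              obtain ⟨s, hs, h1⟩ := hmem j θ hθ
              obtain ⟨s', hs', h2⟩ := hmem j' θ hθ'
              exact hdisj j hj j' hj' hne.symm s hs s' hs' (h1.trans h2.symm)
          · push Not at h
            rw [Finset.sum_eq_zero fun j hj => Set.indicator_of_notMem (h j hj) _]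
            exact zero_le_one
    _ = 2 * π := by simp

/-- The open sector spanned by two independent vectors contains an arc of the unit circle whose
length is the angle between the vectors. -/
theorem exists_arc_subset_sector {a b : ℂ} (hab : (b / a).im ≠ 0) :
    ∃ α : ℝ, ∀ s ∈ Set.Ioo 0 (InnerProductGeometry.angle a b), ∃ r t : ℝ, 0 < r ∧ 0 < t ∧
      (Circle.exp (α + s) : ℂ) = r • a + t • b := by
  have main : ∀ a b : ℂ, 0 < (b / a).im → ∃ α : ℝ,
      ∀ s ∈ Set.Ioo 0 (InnerProductGeometry.angle a b), ∃ r t : ℝ, 0 < r ∧ 0 < t ∧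
      (Circle.exp (α + s) : ℂ) = r • a + t • b := by
    intro a b h
    have ha : a ≠ 0 := by rintro rfl; simp at h
    have hb : b ≠ 0 := by rintro rfl; simp at h
    set γ := (b / a).arg with hγ
    have hγ0 : 0 < γ := lt_of_le_of_ne (Complex.arg_nonneg_iff.2 h.le) fun h0 =>
      h.ne' (Complex.arg_eq_zero_iff.1 h0.symm).2
    have hγπ : γ < π := lt_of_le_of_ne (Complex.arg_le_pi _) fun h0 =>
      h.ne' (Complex.arg_eq_pi_iff.1 h0).2
    have hang : InnerProductGeometry.angle a b = γ := by
      rw [InnerProductGeometry.angle_comm, Complex.angle_eq_abs_arg hb ha, abs_of_pos hγ0]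
    have hsin : 0 < sin γ := sin_pos_of_pos_of_lt_pi hγ0 hγπ
    refine ⟨a.arg, fun s hs => ?_⟩
    rw [hang] at hs
    have h1 : 0 < sin (γ - s) :=
      sin_pos_of_pos_of_lt_pi (by linarith [hs.2]) (by linarith [hs.1])
    have h2 : 0 < sin s := sin_pos_of_pos_of_lt_pi hs.1 (by linarith [hs.2])
    have hna : 0 < ‖a‖ := norm_pos_iff.2 ha
    have hnb : 0 < ‖b / a‖ := norm_pos_iff.2 (div_ne_zero hb ha)
    refine ⟨sin (γ - s) / (sin γ * ‖a‖), sin s / (sin γ * ‖a‖ * ‖b / a‖), by positivity,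
      by positivity, ?_⟩
    have e1 : (‖a‖ : ℂ) * Complex.exp (a.arg * Complex.I) = a := Complex.norm_mul_exp_arg_mul_I a
    have e2 : (‖b / a‖ : ℂ) * Complex.exp (γ * Complex.I) = b / a :=
      Complex.norm_mul_exp_arg_mul_I (b / a)
    have e3 : (Complex.exp (s * Complex.I)) * sin γ =
        sin (γ - s) + sin s * Complex.exp (γ * Complex.I) := by
      rw [Complex.exp_mul_I, Complex.exp_mul_I, sin_sub]
      push_cast
      ring
    have e4 : b = a * (‖b / a‖ * Complex.exp (γ * Complex.I)) := by rw [e2]; field_simp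
    have hsin' : (sin γ : ℂ) ≠ 0 := by exact_mod_cast hsin.ne'
    have hna' : (‖a‖ : ℂ) ≠ 0 := by exact_mod_cast hna.ne'
    have hnb' : (‖b / a‖ : ℂ) ≠ 0 := by exact_mod_cast hnb.ne'
    have e5 : Complex.exp (a.arg * Complex.I) = a / ‖a‖ := by
      rw [eq_div_iff hna', mul_comm]; exact e1
    have e6 : Complex.exp (s * Complex.I) =
        (sin (γ - s) + sin s * Complex.exp (γ * Complex.I)) / sin γ := by
      rw [eq_div_iff hsin']; exact e3
    rw [Circle.coe_exp, Complex.ofReal_add, add_mul, Complex.exp_add, e5, e6]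
    generalize hn : (‖b / a‖ : ℝ) = nb at *
    generalize Complex.exp (γ * Complex.I) = E at *
    rw [e4, Complex.real_smul, Complex.real_smul]
    push_cast
    field_simp
  rcases lt_or_gt_of_ne hab with h | h
  · have h' : 0 < (a / b).im := by
      have : (a / b) = (b / a)⁻¹ := (inv_div _ _).symm
      rw [this, Complex.inv_im]
      have h0 : 0 < Complex.normSq (b / a) := Complex.normSq_pos.2 fun h0 => by
        rw [h0] at h; simp at h
      exact div_pos (by linarith) h0
    obtain ⟨α, hα⟩ := main b a h'
    refine ⟨α, fun s hs => ?_⟩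
    rw [InnerProductGeometry.angle_comm] at hs
    obtain ⟨r, t, hr, ht, e⟩ := hα s hs
    exact ⟨t, r, ht, hr, by rw [e, add_comm]⟩
  · exact main a b h

/-- The angles of disjoint open sectors of the plane add up to at most `2π`. -/
theorem sum_metricAngle_le_two_pi {B : Euc 2 →L[ℝ] Euc 2 →L[ℝ] ℝ} (hs : ∀ u v, B u v = B v u)
    (hp : ∀ v, v ≠ 0 → 0 < B v v) {ι : Type*} (J : Finset ι) (a b : ι → Euc 2)
    (hab : ∀ j ∈ J, det2 (a j) (b j) ≠ 0)
    (hdisj : ∀ j ∈ J, ∀ j' ∈ J, j ≠ j' → ∀ r t r' t' : ℝ, 0 < r → 0 < t → 0 < r' → 0 < t' →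
      r • a j + t • b j ≠ r' • a j' + t' • b j') :
    ∑ j ∈ J, metricAngle B (a j) (b j) ≤ 2 * π := by
  obtain ⟨L, hL, hLB⟩ := exists_isometry_complex hs hp
  have him : ∀ j ∈ J, (L (b j) / L (a j)).im ≠ 0 := by
    intro j hj h0
    have ha : L (a j) ≠ 0 := fun h => hab j hj (by
      rw [(map_eq_zero_iff L hL.1).1 h]
      simp [det2])
    have h1 : L (b j) = L ((L (b j) / L (a j)).re • a j) := by
      rw [map_smul, Complex.real_smul]
      have : ((L (b j) / L (a j)).re : ℂ) = L (b j) / L (a j) :=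
        Complex.ext (by simp) (by simp [h0])
      rw [this]
      field_simp
    have h2 := hL.1 h1
    apply hab j hj
    rw [h2, det2]
    simp
    ring
  simp only [metricAngle_eq_angle hLB]
  choose! α hα using fun j (hj : j ∈ J) => exists_arc_subset_sector (him j hj)
  refine sum_arc_le_two_pi J α _ (fun j _ => ⟨InnerProductGeometry.angle_nonneg _ _,
    (InnerProductGeometry.angle_le_pi _ _).trans (by linarith [pi_pos])⟩) ?_
  intro j hj j' hj' hne s hs s' hs' heq
  obtain ⟨r, t, hr, ht, e⟩ := hα j hj s hs
  obtain ⟨r', t', hr', ht', e'⟩ := hα j' hj' s' hs'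
  refine hdisj j hj j' hj' hne r t r' t' hr ht hr' ht' (hL.1 ?_)
  simp only [map_add, map_smul]
  rw [← e, ← e', heq]

end Sectors

/-! ### Barycentric coordinates -/

section Barycentric

/-- The linear parts of the barycentric coordinates on the standard triangle. -/
def baryLin : Fin 3 → Euc 2 →L[ℝ] ℝ :=
  ![-(EuclideanSpace.proj 0 + EuclideanSpace.proj 1), EuclideanSpace.proj 0, EuclideanSpace.proj 1]

/-- The barycentric coordinates with respect to the vertices of the standard triangle. -/
def bary (j : Fin 3) (z : Euc 2) : ℝ := (![1, 0, 0] : Fin 3 → ℝ) j + baryLin j z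

theorem bary_add (j : Fin 3) (z w : Euc 2) : bary j (z + w) = bary j z + baryLin j w := by
  rw [bary, bary, map_add, add_assoc]

theorem mem_stdTriangle_iff {z : Euc 2} : z ∈ stdTriangle ↔ ∀ j, 0 ≤ bary j z := by
  simp only [stdTriangle, Set.mem_ofPred_eq, Fin.forall_fin_succ, bary, baryLin]
  simp
  constructor
  · rintro ⟨h1, h2, h3⟩
    exact ⟨by linarith, h1, h2⟩
  · rintro ⟨h1, h2, h3⟩
    exact ⟨h2, h3, by linarith⟩

theorem sum_bary (z : Euc 2) : ∑ j, bary j z = 1 := by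
  simp [Fin.sum_univ_three, bary, baryLin]
  ring

theorem bary_triVertex (j i : Fin 3) : bary j (triVertex i) = if j = i then 1 else 0 := by
  fin_cases i <;> fin_cases j <;> simp [bary, baryLin, triVertex]

theorem baryLin_sub (j b c : Fin 3) : baryLin j (triVertex c - triVertex b) =
    (if j = c then 1 else 0) - if j = b then 1 else 0 := by
  rw [map_sub, ← bary_triVertex, ← bary_triVertex, bary, bary]
  ring

theorem continuous_bary (j : Fin 3) : Continuous (bary j) := by
  unfold bary; fun_prop

theorem isCompact_stdTriangle : IsCompact stdTriangle := by
  refine Metric.isCompact_of_isClosed_isBounded ?_ ?_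
  · have : stdTriangle = ⋂ j, {z | 0 ≤ bary j z} := by
      ext z; simp [mem_stdTriangle_iff]
    rw [this]
    exact isClosed_iInter fun j => isClosed_le continuous_const (continuous_bary j)
  · refine (Metric.isBounded_closedBall (x := (0 : Euc 2)) (r := 2)).subset fun z hz => ?_
    obtain ⟨h1, h2, h3⟩ := hz
    rw [mem_closedBall_zero_iff, EuclideanSpace.norm_eq, Fin.sum_univ_two]
    refine Real.sqrt_le_iff.2 ⟨by norm_num, ?_⟩
    simp only [Real.norm_eq_abs, sq_abs]
    nlinarith

/-- The point with parameter `s` on the side from the vertex `b` to the vertex `c`. -/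
def sidePoint (b c : Fin 3) (s : ℝ) : Euc 2 := triVertex b + s • (triVertex c - triVertex b)

theorem bary_sidePoint (j b c : Fin 3) (s : ℝ) :
    bary j (sidePoint b c s) = (1 - s) * (if j = b then 1 else 0) + s * if j = c then 1 else 0 := by
  rw [sidePoint, bary_add, map_smul, baryLin_sub, bary_triVertex, smul_eq_mul]
  ring

theorem sidePoint_mem {b c : Fin 3} {s : ℝ} (hs : s ∈ Set.Icc (0 : ℝ) 1) :
    sidePoint b c s ∈ stdTriangle := by
  rw [mem_stdTriangle_iff]
  intro j
  rw [bary_sidePoint]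
  have := hs.1
  have : 0 ≤ 1 - s := by linarith [hs.2]
  positivity

theorem det2_sideVec_sq {i b c : Fin 3} (hb : i ≠ b) (hc : i ≠ c) (hbc : b ≠ c) :
    det2 (triVertex c - triVertex b) (triVertex i - triVertex b) ^ 2 = 1 := by
  fin_cases i <;> fin_cases b <;> fin_cases c <;> simp_all [det2, triVertex]

/-- The barycentric coordinate that vanishes on a side. -/
theorem baryLin_eq_det2 {i b c : Fin 3} (hb : i ≠ b) (hc : i ≠ c) (hbc : b ≠ c) (u : Euc 2) :
    baryLin i u = det2 (triVertex c - triVertex b) (triVertex i - triVertex b) *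
      det2 (triVertex c - triVertex b) u := by
  fin_cases i <;> fin_cases b <;> fin_cases c <;> simp_all [det2, triVertex, baryLin] <;> ring

variable {k : ℕ} {a : Fin 3 → Fin k}

theorem triangleMap_eq_sum (a : Fin 3 → Fin k) (z : Euc 2) :
    triangleMap a z = ∑ j, bary j z • Pi.single (a j) 1 := by
  simp only [triangleMap, Fin.sum_univ_three, bary, baryLin]
  simp [sub_eq_add_neg, add_assoc, add_comm]

theorem triangleMap_apply (ha : Function.Injective a) (z : Euc 2) (j : Fin 3) :
    triangleMap a z (a j) = bary j z := by
  rw [triangleMap_eq_sum, Finset.sum_apply, Finset.sum_eq_single j]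
  · simp
  · intro i _ hij
    simp [ha.ne hij.symm]
  · simp

theorem exists_of_triangleMap_ne_zero {z : Euc 2} {l : Fin k} (hl : triangleMap a z l ≠ 0) :
    ∃ j, a j = l := by
  by_contra h
  push Not at h
  apply hl
  rw [triangleMap_eq_sum, Finset.sum_apply]
  refine Finset.sum_eq_zero fun j _ => ?_
  simp [(h j).symm]

theorem triangleMap_mem_stdSimplex {z : Euc 2} (hz : z ∈ stdTriangle) :
    triangleMap a z ∈ stdSimplex ℝ (Fin k) := by
  rw [mem_stdTriangle_iff] at hz
  rw [triangleMap_eq_sum]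
  have := (convex_stdSimplex ℝ (Fin k)).sum_mem (t := Finset.univ) (w := fun j => bary j z)
    (z := fun j => Pi.single (a j) 1) (fun j _ => hz j) (sum_bary z)
    (fun j _ => single_mem_stdSimplex ℝ (a j))
  exact this

theorem exists_triangleMap_eq (ha : Function.Injective a) {w : Fin k → ℝ}
    (hw : w ∈ stdSimplex ℝ (Fin k)) (hsupp : ∀ l, w l ≠ 0 → l ∈ Finset.univ.image a) :
    ∃ z ∈ stdTriangle, triangleMap a z = w := by
  have hsum : ∑ j, w (a j) = 1 := by
    rw [← hw.2, ← Finset.sum_image (s := Finset.univ) (g := a) (f := w) ha.injOn]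
    exact Finset.sum_subset (Finset.subset_univ _) fun l _ hl => by
      by_contra h0
      exact hl (hsupp l h0)
  rw [Fin.sum_univ_three] at hsum
  have hb : ∀ j, bary j !₂[w (a 1), w (a 2)] = w (a j) := by
    intro j
    fin_cases j <;> simp [bary, baryLin]
    linarith
  refine ⟨!₂[w (a 1), w (a 2)], mem_stdTriangle_iff.2 fun j => by rw [hb]; exact hw.1 _, ?_⟩
  ext l
  by_cases hl : ∃ j, a j = l
  · obtain ⟨j, rfl⟩ := hl
    rw [triangleMap_apply ha, hb]
  · have h1 : triangleMap a !₂[w (a 1), w (a 2)] l = 0 := by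
      by_contra h0
      exact hl (exists_of_triangleMap_ne_zero h0)
    rw [h1]
    by_contra h0
    obtain ⟨j, -, hj⟩ := Finset.mem_image.1 (hsupp l (Ne.symm h0))
    exact hl ⟨j, hj⟩

theorem triangleMap_sidePoint (a : Fin 3 → Fin k) (b c : Fin 3) (s : ℝ) :
    triangleMap a (sidePoint b c s) = (1 - s) • Pi.single (a b) 1 + s • Pi.single (a c) 1 := by
  simp only [triangleMap_eq_sum, bary_sidePoint, add_smul, Finset.sum_add_distrib]
  simp

/-- A curve that leaves a point of the triangle in a direction pointing strictly into all sides
through that point enters the interior. -/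
theorem eventually_bary_pos {z w : Euc 2} (hz : z ∈ stdTriangle)
    (hw : ∀ j, bary j z = 0 → 0 < baryLin j w) {c : ℝ → Euc 2} (hc : HasDerivAt c w 0)
    (hc0 : c 0 = z) : ∀ᶠ s in 𝓝[>] (0 : ℝ), ∀ j, 0 < bary j (c s) := by
  rw [Filter.eventually_all]
  intro j
  have hd : HasDerivAt (fun s => bary j (c s)) (baryLin j w) 0 := by
    simpa [bary] using ((baryLin j).hasFDerivAt.comp_hasDerivAt (0 : ℝ) hc).const_add
      ((![1, 0, 0] : Fin 3 → ℝ) j)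
  rcases (mem_stdTriangle_iff.1 hz j).eq_or_lt with h0 | h0
  · have h1 := eventually_nhdsWithin_sign_eq_of_deriv_pos (f := fun s => bary j (c s)) (x₀ := 0)
      (by rw [hd.deriv]; exact hw j h0.symm) (by rw [hc0, ← h0])
    filter_upwards [nhdsWithin_le_nhds h1, self_mem_nhdsWithin] with s hs hs0
    rw [sub_zero, sign_pos (a := s) hs0] at hs
    exact sign_eq_one_iff.1 hs
  · have h1 : ∀ᶠ s in 𝓝 (0 : ℝ), 0 < bary j (c s) :=
      hd.continuousAt.eventually (lt_mem_nhds (by simpa [hc0] using h0))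
    exact nhdsWithin_le_nhds h1

end Barycentric

/-! ### Adjacent triangles of a smooth triangulation -/

section Faces

variable {k : ℕ} {M : Type u} [TopologicalSpace M] [ChartedSpace (Euc 2) M]

/-- A smooth parametrization, near the closed standard triangle, of a triangle of a smooth
triangulation, by an enumeration `a` of its vertices. -/
structure IsFace (Δ : Finset (Finset (Fin k))) (Φ : (Fin k → ℝ) → M) (a : Fin 3 → Fin k)
    (ψ : Euc 2 → M) (V : Set (Euc 2)) : Prop where
  injective : Function.Injective a
  image_mem : Finset.univ.image a ∈ Δ
  isParamOn : IsParamOn 2 ψ V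
  subset : stdTriangle ⊆ V
  eq : ∀ z ∈ stdTriangle, ψ z = Φ (triangleMap a z)

variable {Δ : Finset (Finset (Fin k))} {Φ : (Fin k → ℝ) → M} {a a' : Fin 3 → Fin k}
  {ψ ψ' : Euc 2 → M} {V V' : Set (Euc 2)} {z z' : Euc 2}

theorem IsFace.triangleMap_mem (hf : IsFace Δ Φ a ψ V) (hz : z ∈ stdTriangle) :
    triangleMap a z ∈ polyhedron Δ := by
  refine ⟨triangleMap_mem_stdSimplex hz, _, hf.image_mem, fun l hl => ?_⟩
  obtain ⟨j, rfl⟩ := exists_of_triangleMap_ne_zero hl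
  exact Finset.mem_image_of_mem a (Finset.mem_univ j)

theorem IsFace.triangleMap_eq (hΦ : IsSmoothTriangulation M Δ Φ) (hf : IsFace Δ Φ a ψ V)
    (hf' : IsFace Δ Φ a' ψ' V') (hz : z ∈ stdTriangle) (hz' : z' ∈ stdTriangle)
    (heq : ψ z = ψ' z') : triangleMap a z = triangleMap a' z' := by
  rw [hf.eq z hz, hf'.eq z' hz'] at heq
  exact hΦ.bijOn.injOn (hf.triangleMap_mem hz) (hf'.triangleMap_mem hz') heq

/-- Triangles with a common interior point coincide. -/
theorem IsFace.image_eq (hΦ : IsSmoothTriangulation M Δ Φ) (hf : IsFace Δ Φ a ψ V)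
    (hf' : IsFace Δ Φ a' ψ' V') (hz : ∀ j, 0 < bary j z) (hz' : z' ∈ stdTriangle)
    (heq : ψ z = ψ' z') : Finset.univ.image a = Finset.univ.image a' := by
  have h1 := hf.triangleMap_eq hΦ hf' (mem_stdTriangle_iff.2 fun j => (hz j).le) hz' heq
  refine Finset.eq_of_subset_of_card_le (fun l hl => ?_) ?_
  · obtain ⟨j, -, rfl⟩ := Finset.mem_image.1 hl
    have h2 : triangleMap a' z' (a j) ≠ 0 := by
      rw [← h1, triangleMap_apply hf.injective]
      exact (hz j).ne'
    obtain ⟨i, hi⟩ := exists_of_triangleMap_ne_zero h2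
    exact Finset.mem_image.2 ⟨i, Finset.mem_univ i, hi⟩
  · rw [Finset.card_image_of_injective _ hf.injective,
      Finset.card_image_of_injective _ hf'.injective]

/-- If a tangent vector points into the interiors of two triangles, the triangles coincide. -/
theorem IsFace.image_eq_of_fderiv (hΦ : IsSmoothTriangulation M Δ Φ) (hf : IsFace Δ Φ a ψ V)
    (hf' : IsFace Δ Φ a' ψ' V') (hz : z ∈ stdTriangle) (hz' : z' ∈ stdTriangle)
    {τ : Euc 2 → Euc 2} {W : Set (Euc 2)} (hW : W ∈ 𝓝 z) (hτ : DifferentiableAt ℝ τ z)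
    (hτz : τ z = z') (hτψ : ∀ y ∈ W, ψ' (τ y) = ψ y) {w : Euc 2}
    (hw : ∀ j, bary j z = 0 → 0 < baryLin j w)
    (hw' : ∀ j, bary j z' = 0 → 0 < baryLin j (fderiv ℝ τ z w)) :
    Finset.univ.image a = Finset.univ.image a' := by
  have hγ : HasDerivAt (fun r : ℝ => z + r • w) w 0 := by
    simpa using ((hasDerivAt_id (0 : ℝ)).smul_const w).const_add z
  have e0 : z + (0 : ℝ) • w = z := by simp
  have h1 := eventually_bary_pos hz hw hγ e0
  have hτ' : HasFDerivAt τ (fderiv ℝ τ z) (z + (0 : ℝ) • w) := by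
    rw [e0]; exact hτ.hasFDerivAt
  have h2 : HasDerivAt (fun r : ℝ => τ (z + r • w)) (fderiv ℝ τ z w) 0 :=
    HasFDerivAt.comp_hasDerivAt (l := τ) (0 : ℝ) hτ' hγ
  have h3 := eventually_bary_pos hz' hw' h2 (by rw [e0, hτz])
  have h4 : ∀ᶠ r in 𝓝[>] (0 : ℝ), z + r • w ∈ W := by
    refine nhdsWithin_le_nhds (hγ.continuousAt.eventually ?_)
    simpa using hW
  obtain ⟨r, hr1, hr2, hr3⟩ := (h1.and (h3.and h4)).exists
  exact hf.image_eq hΦ hf' hr1 (mem_stdTriangle_iff.2 fun j => (hr2 j).le) (hτψ _ hr3).symm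

end Faces

section Sides

variable {k : ℕ} {M : Type u} [TopologicalSpace M] [ChartedSpace (Euc 2) M]
  [IsManifold (𝓡 2) ∞ M]
  {Δ : Finset (Finset (Fin k))} {Φ : (Fin k → ℝ) → M} {a a' : Fin 3 → Fin k}
  {ψ ψ' : Euc 2 → M} {V V' : Set (Euc 2)} {i b c i' b' c' : Fin 3}
  {h : ∀ q : M, TangentSpace (𝓡 2) q →L[ℝ] TangentSpace (𝓡 2) q →L[ℝ] ℝ}

omit [IsManifold (𝓡 2) ∞ M] in
theorem IsFace.sidePoint_eq (hf : IsFace Δ Φ a ψ V) (hf' : IsFace Δ Φ a' ψ' V')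
    (hb : a b = a' b') (hc : a c = a' c') {s : ℝ} (hs : s ∈ Set.Icc (0 : ℝ) 1) :
    ψ (sidePoint b c s) = ψ' (sidePoint b' c' s) := by
  rw [hf.eq _ (sidePoint_mem hs), hf'.eq _ (sidePoint_mem hs), triangleMap_sidePoint,
    triangleMap_sidePoint, hb, hc]

theorem connForm_congr {G G' : Euc 2 → Euc 2 →L[ℝ] Euc 2 →L[ℝ] ℝ} {z : Euc 2} (hG : G =ᶠ[𝓝 z] G')
    (u w : Euc 2) : connForm G z u w = connForm G' z u w := by
  simp only [connForm, areaDensity, gram, christoffel_congr hG, hG.eq_of_nhds]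

omit [IsManifold (𝓡 2) ∞ M] in
theorem paramField_congr (h : ∀ q : M, TangentSpace (𝓡 2) q →L[ℝ] TangentSpace (𝓡 2) q →L[ℝ] ℝ)
    {z : Euc 2} (hψ : ψ =ᶠ[𝓝 z] ψ') : paramField h ψ z = paramField h ψ' z := by
  ext u v
  have e := hψ.mfderiv_eq (I := 𝓘(ℝ, Euc 2)) (I' := 𝓡 2)
  exact formAt_congr hψ.eq_of_nhds (congrArg (fun L => L u) e) (congrArg (fun L => L v) e)

theorem eq_or_eq_of_ne : ∀ i b c j : Fin 3, i ≠ b → i ≠ c → b ≠ c → j ≠ i → j = b ∨ j = c := by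
  decide

/-- The transition map between two distinct triangles at an interior point of a common side: it is
affine along the side and maps the two inner sides to opposite sides. -/
theorem IsFace.exists_side_transition (hΦ : IsSmoothTriangulation M Δ Φ)
    (hh : IsRiemannianField h) (hf : IsFace Δ Φ a ψ V) (hf' : IsFace Δ Φ a' ψ' V')
    (hne : Finset.univ.image a ≠ Finset.univ.image a')
    (hib : i ≠ b) (hic : i ≠ c) (hbc : b ≠ c) (hib' : i' ≠ b') (hic' : i' ≠ c') (hbc' : b' ≠ c')
    (hb : a b = a' b') (hc : a c = a' c') {s : ℝ} (hs : s ∈ Set.Ioo (0 : ℝ) 1) :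
    ∃ (τ : Euc 2 → Euc 2) (W : Set (Euc 2)), sidePoint b c s ∈ W ∧ W ∈ 𝓝 (sidePoint b c s) ∧
      DifferentiableAt ℝ τ (sidePoint b c s) ∧ τ (sidePoint b c s) = sidePoint b' c' s ∧
      (∀ y ∈ W, ψ' (τ y) = ψ y) ∧
      connForm (paramField h ψ) (sidePoint b c s) (triVertex c - triVertex b)
          (triVertex c - triVertex b) =
        SignType.sign (fderiv ℝ τ (sidePoint b c s)).det *
          connForm (paramField h ψ') (sidePoint b' c' s) (triVertex c' - triVertex b')
            (triVertex c' - triVertex b') ∧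
      (fderiv ℝ τ (sidePoint b c s)).det *
        det2 (triVertex c - triVertex b) (triVertex i - triVertex b) *
        det2 (triVertex c' - triVertex b') (triVertex i' - triVertex b') < 0 := by
  have hs' : s ∈ Set.Icc (0 : ℝ) 1 := ⟨hs.1.le, hs.2.le⟩
  set z := sidePoint b c s with hz
  set z' := sidePoint b' c' s with hz'
  set w := triVertex c - triVertex b with hw
  set w' := triVertex c' - triVertex b' with hw'
  have hzm : z ∈ stdTriangle := sidePoint_mem hs'
  have hzm' : z' ∈ stdTriangle := sidePoint_mem hs'
  obtain ⟨τ, W, O, hzW, hWV, hO, hzO, hτ, hτz, hτψ, hloc⟩ :=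
    hf.isParamOn.exists_transition hh hf'.isParamOn (hf.subset hzm) (hf'.subset hzm')
      (hf.sidePoint_eq hf' hb hc hs')
  have hWn : W ∈ 𝓝 z := hτ.mem_nhds hzW
  have hline : ∀ (b c : Fin 3) (r : ℝ), sidePoint b c s + r • (triVertex c - triVertex b) =
      sidePoint b c (s + r) := fun b c r => by
    rw [sidePoint, sidePoint, add_smul, add_assoc]
  have hcont : ∀ b c : Fin 3, Filter.Tendsto
      (fun r : ℝ => sidePoint b c s + r • (triVertex c - triVertex b)) (𝓝 0)
      (𝓝 (sidePoint b c s)) := fun b c => by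
    have : Continuous fun r : ℝ => sidePoint b c s + r • (triVertex c - triVertex b) := by fun_prop
    simpa using this.tendsto 0
  have haff : ∀ᶠ r : ℝ in 𝓝 0, τ (z + r • w) = τ z + r • w' := by
    have hsr : ∀ᶠ r : ℝ in 𝓝 0, s + r ∈ Set.Ioo (0 : ℝ) 1 := by
      have : Continuous fun r : ℝ => s + r := by fun_prop
      refine this.tendsto 0 (Ioo_mem_nhds ?_ ?_)
      · simpa using hs.1
      · simpa using hs.2
    filter_upwards [hsr, (hcont b c).eventually hWn, (hcont b' c').eventually (hO.mem_nhds hzO)]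
      with r hr h1 h2
    rw [hτz]
    refine hloc _ h1 _ h2 ?_
    change ψ (sidePoint b c s + r • (triVertex c - triVertex b)) =
      ψ' (sidePoint b' c' s + r • (triVertex c' - triVertex b'))
    rw [hline, hline]
    exact hf.sidePoint_eq hf' hb hc ⟨hr.1.le, hr.2.le⟩
  obtain ⟨hDw, hconn⟩ := hτ.connForm_pullMetric hzW haff
  have hfield : paramField h ψ =ᶠ[𝓝 z] pullMetric (paramField h ψ') τ := by
    filter_upwards [hτ.isOpen.mem_nhds hzW] with y hy
    have h1 : ψ' ∘ τ =ᶠ[𝓝 y] ψ := by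
      filter_upwards [hτ.isOpen.mem_nhds hy] with y' hy' using hτψ y' hy'
    rw [← paramField_comp (hf'.isParamOn.mdifferentiableAt (hτ.mapsTo hy))
      (hτ.hasFDerivAt hy).differentiableAt]
    exact (paramField_congr h h1).symm
  refine ⟨τ, W, hzW, hWn, (hτ.hasFDerivAt hzW).differentiableAt, hτz, hτψ, ?_, ?_⟩
  · rw [connForm_congr hfield, hconn, hτz]
  set ν := triVertex i - triVertex b with hν
  set ν' := triVertex i' - triVertex b' with hν'
  have hdet : det2 w' (fderiv ℝ τ z ν) = (fderiv ℝ τ z).det * det2 w ν := by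
    rw [← hDw, det2_map, det_eq_det2]
  have hne0 : (fderiv ℝ τ z).det * det2 w ν * det2 w' ν' ≠ 0 := by
    refine mul_ne_zero (mul_ne_zero ?_ ?_) ?_
    · rw [det_eq_det2]
      exact det2_ne_zero_of_injective (hτ.injective z hzW)
    · have := det2_sideVec_sq hib hic hbc
      intro h0
      rw [← hw, ← hν, h0] at this
      norm_num at this
    · have := det2_sideVec_sq hib' hic' hbc'
      intro h0
      rw [← hw', ← hν', h0] at this
      norm_num at this
  by_contra hpos
  have hpos' := lt_of_le_of_ne (not_lt.1 hpos) hne0.symm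
  -- only the coordinate opposite to the side vanishes at its interior points
  have hvan : ∀ (i b c j : Fin 3), i ≠ b → i ≠ c → b ≠ c →
      bary j (sidePoint b c s) = 0 → j = i := by
    intro i b c j h1 h2 h3 h0
    rw [bary_sidePoint] at h0
    by_contra hj
    have h4 := hs.1
    have h5 := hs.2
    rcases eq_or_eq_of_ne i b c j h1 h2 h3 hj with rfl | rfl
    · simp [h3] at h0
      linarith
    · simp [Ne.symm h3] at h0
      linarith
  refine hne (hf.image_eq_of_fderiv hΦ hf' hzm hzm' hWn (hτ.hasFDerivAt hzW).differentiableAt hτz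
    hτψ (w := ν) (fun j hj => ?_) fun j hj => ?_)
  · rw [hvan i b c j hib hic hbc hj, hν, baryLin_sub]
    simp [hib]
  · rw [hvan i' b' c' j hib' hic' hbc' hj, baryLin_eq_det2 hib' hic' hbc', hdet]
    linarith

theorem sideTurning_eq (G : Euc 2 → Euc 2 →L[ℝ] Euc 2 →L[ℝ] ℝ) (hib : i ≠ b) (hic : i ≠ c)
    (hbc : b ≠ c) : sideTurning G i =
      det2 (triVertex c - triVertex b) (triVertex i - triVertex b) *
        ∫ s in (0 : ℝ)..1, connForm G (sidePoint b c s) (triVertex c - triVertex b)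
          (triVertex c - triVertex b) := by
  have hcase : (b = i + 1 ∧ c = i + 2) ∨ (c = i + 1 ∧ b = i + 2) := by
    fin_cases i <;> fin_cases b <;> fin_cases c <;> simp_all
  have h1 : det2 (triVertex (i + 2) - triVertex (i + 1)) (triVertex i - triVertex (i + 1)) = 1 := by
    fin_cases i <;> simp [det2, triVertex]
  have h2 : det2 (triVertex (i + 1) - triVertex (i + 2))
      (triVertex i - triVertex (i + 2)) = -1 := by
    fin_cases i <;> simp [det2, triVertex]
  rcases hcase with ⟨rfl, rfl⟩ | ⟨rfl, rfl⟩
  · rw [h1, one_mul]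
    rfl
  · rw [h2, neg_one_mul, ← intervalIntegral.integral_neg]
    have h3 := intervalIntegral.integral_comp_sub_left (a := 0) (b := 1) (fun s : ℝ =>
      connForm G (triVertex (i + 1) + s • sideVec i) (sideVec i) (sideVec i)) 1
    rw [sub_self, sub_zero] at h3
    rw [sideTurning, ← h3]
    refine intervalIntegral.integral_congr fun s _ => ?_
    have e1 : triVertex (i + 1) - triVertex (i + 2) = (-1 : ℝ) • sideVec i := by
      rw [sideVec, neg_one_smul, neg_sub]
    have e2 : sidePoint (i + 2) (i + 1) s = triVertex (i + 1) + (1 - s) • sideVec i := by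
      rw [sidePoint, sideVec]
      module
    have e3 := connForm_add G (triVertex (i + 1) + (1 - s) • sideVec i) (sideVec i) (sideVec i) 0
      (-1) 0
    rw [zero_smul, add_zero, zero_mul, add_zero] at e3
    beta_reduce
    rw [e2, e1, connForm_smul_left _ _ _ _ (by norm_num), e3]
    ring

/-- The total geodesic curvatures of a common side of two triangles cancel. -/
theorem IsFace.sideTurning_add (hΦ : IsSmoothTriangulation M Δ Φ)
    (hh : IsRiemannianField h) (hf : IsFace Δ Φ a ψ V) (hf' : IsFace Δ Φ a' ψ' V')
    (hne : Finset.univ.image a ≠ Finset.univ.image a')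
    (hib : i ≠ b) (hic : i ≠ c) (hbc : b ≠ c) (hib' : i' ≠ b') (hic' : i' ≠ c') (hbc' : b' ≠ c')
    (hb : a b = a' b') (hc : a c = a' c') :
    sideTurning (paramField h ψ) i + sideTurning (paramField h ψ') i' = 0 := by
  rw [sideTurning_eq _ hib hic hbc, sideTurning_eq _ hib' hic' hbc',
    ← intervalIntegral.integral_const_mul, ← intervalIntegral.integral_const_mul,
    ← eq_neg_iff_add_eq_zero, ← intervalIntegral.integral_neg]
  refine intervalIntegral.integral_congr_Ioo_of_le zero_le_one fun s hs => ?_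
  obtain ⟨τ, W, -, -, -, -, -, h1, h2⟩ := hf.exists_side_transition hΦ hh hf' hne hib hic hbc hib'
    hic' hbc' hb hc hs
  beta_reduce
  rw [h1]
  have e1 := det2_sideVec_sq hib hic hbc
  have e2 := det2_sideVec_sq hib' hic' hbc'
  generalize det2 (triVertex c - triVertex b) (triVertex i - triVertex b) = ε at *
  generalize det2 (triVertex c' - triVertex b') (triVertex i' - triVertex b') = ε' at *
  generalize (fderiv ℝ τ (sidePoint b c s)).det = d at *
  rw [sq] at e1 e2
  rcases mul_self_eq_one_iff.1 e1 with rfl | rfl <;> rcases mul_self_eq_one_iff.1 e2 with rfl | rfl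
  · rw [sign_neg (a := d) (by linarith)]
    simp
  · rw [sign_pos (a := d) (by linarith)]
    simp
  · rw [sign_pos (a := d) (by linarith)]
    simp
  · rw [sign_neg (a := d) (by linarith)]
    simp

/-- At most two triangles share a side: the sign distinguishes the two inner sides. -/
theorem IsFace.side_sign (hΦ : IsSmoothTriangulation M Δ Φ)
    (hh : IsRiemannianField h) (hf : IsFace Δ Φ a ψ V) (hf' : IsFace Δ Φ a' ψ' V')
    (hne : Finset.univ.image a ≠ Finset.univ.image a')
    (hib : i ≠ b) (hic : i ≠ c) (hbc : b ≠ c) (hib' : i' ≠ b') (hic' : i' ≠ c') (hbc' : b' ≠ c')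
    (hb : a b = a' b') (hc : a c = a' c') {p : M} (hp : ψ (sidePoint b c (1 / 2)) = p) :
    ((fderiv ℝ (extChartAt (𝓡 2) p ∘ ψ) (sidePoint b c (1 / 2))).det *
      det2 (triVertex c - triVertex b) (triVertex i - triVertex b)) *
    ((fderiv ℝ (extChartAt (𝓡 2) p ∘ ψ') (sidePoint b' c' (1 / 2))).det *
      det2 (triVertex c' - triVertex b') (triVertex i' - triVertex b')) < 0 := by
  have hs : (1 / 2 : ℝ) ∈ Set.Ioo (0 : ℝ) 1 := by norm_num
  have hs' : (1 / 2 : ℝ) ∈ Set.Icc (0 : ℝ) 1 := by norm_num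
  obtain ⟨τ, W, hzW, hW, hτ, hτz, hτψ, -, h2⟩ := hf.exists_side_transition hΦ hh hf' hne hib hic
    hbc hib' hic' hbc' hb hc hs
  have hX := hf.isParamOn.isImmersionOn hh p
  have hX' := hf'.isParamOn.isImmersionOn hh p
  have hp' : ψ' (sidePoint b' c' (1 / 2)) = p := by rw [← hf.sidePoint_eq hf' hb hc hs', hp]
  have hz' : sidePoint b' c' (1 / 2) ∈ V' ∩ ψ' ⁻¹' (extChartAt (𝓡 2) p).source :=
    ⟨hf'.subset (sidePoint_mem hs'), by
      rw [Set.mem_preimage, hp']; exact mem_extChartAt_source p⟩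
  have h3 : extChartAt (𝓡 2) p ∘ ψ =ᶠ[𝓝 (sidePoint b c (1 / 2))]
      (extChartAt (𝓡 2) p ∘ ψ') ∘ τ := by
    filter_upwards [hW] with y hy
    simp [hτψ y hy]
  have h4 := hX'.hasFDerivAt hz'
  rw [← hτz] at h4
  have h5 := h4.comp _ hτ.hasFDerivAt
  rw [hτz] at h5
  rw [h3.fderiv_eq, h5.fderiv]
  have h6 : ∀ A B : Euc 2 →L[ℝ] Euc 2, (A.comp B).det = A.det * B.det := fun A B => by
    rw [ContinuousLinearMap.det, ContinuousLinearMap.det, ContinuousLinearMap.det,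
      ← LinearMap.det_comp]
    rfl
  have h7 : (fderiv ℝ (extChartAt (𝓡 2) p ∘ ψ') (sidePoint b' c' (1 / 2))).det ≠ 0 := by
    rw [det_eq_det2]
    exact det2_ne_zero_of_injective (hX'.injective _ hz')
  rw [h6]
  have h8 := mul_neg_of_pos_of_neg (sq_pos_of_ne_zero h7) h2
  nlinarith

omit [IsManifold (𝓡 2) ∞ M] in
theorem isCompact_closedFace (t : Finset (Fin k)) :
    IsCompact {w | w ∈ stdSimplex ℝ (Fin k) ∧ ∀ l, w l ≠ 0 → l ∈ t} := by
  have : {w | w ∈ stdSimplex ℝ (Fin k) ∧ ∀ l, w l ≠ 0 → l ∈ t} =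
      stdSimplex ℝ (Fin k) ∩ ⋂ l, {w | l ∉ t → w l = 0} := by
    ext w
    simp only [Set.mem_ofPred_eq, Set.mem_inter_iff, Set.mem_iInter]
    refine and_congr_right fun _ => forall_congr' fun l => ?_
    tauto
  rw [this]
  refine (isCompact_stdSimplex ℝ (Fin k)).inter_right (isClosed_iInter fun l => ?_)
  by_cases hl : l ∈ t
  · simp [hl]
  · simpa [hl] using isClosed_eq (continuous_apply l) continuous_const

/-- Each side belongs to at least two triangles. Otherwise all points near the image of its midpoint
lie in the image of the single triangle; but the parametrization, which extends injectively beyond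
the side, also reaches points near it from outside of the triangle. -/
theorem IsFace.exists_adjacent [T2Space M] (hΦ : IsSmoothTriangulation M Δ Φ)
    (hh : IsRiemannianField h) (hf : IsFace Δ Φ a ψ V) (hib : i ≠ b) (hic : i ≠ c) (hbc : b ≠ c) :
    ∃ t ∈ Δ, t ≠ Finset.univ.image a ∧ a b ∈ t ∧ a c ∈ t := by
  by_contra hcon
  push Not at hcon
  have hs' : (1 / 2 : ℝ) ∈ Set.Icc (0 : ℝ) 1 := by norm_num
  set z := sidePoint b c (1 / 2) with hz
  have hzm : z ∈ stdTriangle := sidePoint_mem hs'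
  obtain ⟨O, hO, hzO, hinj⟩ := hf.isParamOn.exists_injOn hh (hf.subset hzm)
  -- the other triangles stay away from the midpoint of the side
  have h1 : ∀ t ∈ Δ, t ≠ Finset.univ.image a → ∀ᶠ q in 𝓝 (ψ z),
      q ∉ Φ '' {w | w ∈ stdSimplex ℝ (Fin k) ∧ ∀ l, w l ≠ 0 → l ∈ t} := by
    intro t ht hta
    have hcl := ((isCompact_closedFace t).image_of_continuousOn (hΦ.continuousOn.mono
      fun w hw => ⟨hw.1, t, ht, hw.2⟩)).isClosed
    refine hcl.isOpen_compl.mem_nhds ?_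
    rintro ⟨w, hw, hwz⟩
    rw [hf.eq z hzm] at hwz
    have := hΦ.bijOn.injOn ⟨hw.1, t, ht, hw.2⟩ (hf.triangleMap_mem hzm) hwz
    rw [this] at hw
    refine hcon t ht hta (hw.2 _ ?_) (hw.2 _ ?_)
    · rw [triangleMap_apply hf.injective, hz, bary_sidePoint]
      norm_num [hbc]
    · rw [triangleMap_apply hf.injective, hz, bary_sidePoint]
      simp [hbc.symm]
  have h2 : ∀ᶠ q in 𝓝 (ψ z), q ∉ ψ '' (stdTriangle \ O) := by
    have hcl := ((isCompact_stdTriangle.diff hO).image_of_continuousOn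
      (hf.isParamOn.contMDiffOn.continuousOn.mono
        (Set.sdiff_subset.trans hf.subset))).isClosed
    refine hcl.isOpen_compl.mem_nhds ?_
    rintro ⟨y, hy, hyz⟩
    have h3 := hf.triangleMap_eq hΦ hf hy.1 hzm hyz
    have h4 : y = z := by
      have e : ∀ j, bary j y = bary j z := fun j => by
        rw [← triangleMap_apply hf.injective, ← triangleMap_apply hf.injective, h3]
      ext j
      have e1 := e 1
      have e2 := e 2
      fin_cases j
      · simpa [bary, baryLin] using e1
      · simpa [bary, baryLin] using e2
    exact hy.2 (h4 ▸ hzO)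
  have h3 : ∀ᶠ q in 𝓝 (ψ z), q ∈ ψ '' (stdTriangle ∩ O) := by
    have h1' : ∀ᶠ q in 𝓝 (ψ z), ∀ t ∈ Δ, t ≠ Finset.univ.image a →
        q ∉ Φ '' {w | w ∈ stdSimplex ℝ (Fin k) ∧ ∀ l, w l ≠ 0 → l ∈ t} := by
      rw [Filter.eventually_all_finset]
      intro t ht
      rw [Filter.eventually_all]
      exact h1 t ht
    filter_upwards [h1', h2] with q hq1 hq2
    obtain ⟨w, ⟨hw, t, ht, hwt⟩, rfl⟩ := hΦ.bijOn.surjOn (Set.mem_univ q)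
    have hta : t = Finset.univ.image a := by
      by_contra hta
      exact hq1 t ht hta ⟨w, ⟨hw, hwt⟩, rfl⟩
    obtain ⟨y, hy, rfl⟩ := exists_triangleMap_eq hf.injective hw (hta ▸ hwt)
    rw [← hf.eq y hy] at hq2 ⊢
    by_cases hyO : y ∈ O
    · exact ⟨y, ⟨hy, hyO⟩, rfl⟩
    · exact absurd ⟨y, ⟨hy, hyO⟩, rfl⟩ hq2
  -- move out of the triangle across the side, against the direction of the opposite vertex
  set ν := triVertex i - triVertex b with hν
  have hcurve : Filter.Tendsto (fun r : ℝ => z - r • ν) (𝓝[>] 0) (𝓝 z) := by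
    have : Continuous fun r : ℝ => z - r • ν := by fun_prop
    simpa using (this.tendsto 0).mono_left nhdsWithin_le_nhds
  have hψc : ContinuousAt ψ z := (hf.isParamOn.contMDiffAt (hf.subset hzm)).continuousAt
  obtain ⟨r, hr1, hr2, hr3⟩ := (((hψc.tendsto.comp hcurve).eventually h3).and
    ((hcurve.eventually (hO.mem_nhds hzO)).and self_mem_nhdsWithin)).exists
  obtain ⟨y, ⟨hy, hyO⟩, hyr⟩ := hr1
  have := hinj hyO hr2 hyr
  have h4 := mem_stdTriangle_iff.1 hy i
  rw [this, sub_eq_add_neg, ← smul_neg, bary_add, map_smul, map_neg, hν, baryLin_sub, hz,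
    bary_sidePoint] at h4
  simp [hib, hic] at h4
  exact absurd hr3 (not_lt.2 h4)

end Sides

/-! ### The angles around a vertex -/

section Vertices

variable {k : ℕ} {M : Type u} [TopologicalSpace M] [ChartedSpace (Euc 2) M]
  [IsManifold (𝓡 2) ∞ M]
  {Δ : Finset (Finset (Fin k))} {Φ : (Fin k → ℝ) → M} {a a' : Fin 3 → Fin k}
  {ψ ψ' : Euc 2 → M} {V V' : Set (Euc 2)} {i i' : Fin 3}
  {h : ∀ q : M, TangentSpace (𝓡 2) q →L[ℝ] TangentSpace (𝓡 2) q →L[ℝ] ℝ}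

theorem triVertex_mem (i : Fin 3) : triVertex i ∈ stdTriangle := by
  rw [mem_stdTriangle_iff]
  intro j
  rw [bary_triVertex]
  positivity

theorem triangleMap_triVertex (a : Fin 3 → Fin k) (i : Fin 3) :
    triangleMap a (triVertex i) = Pi.single (a i) 1 := by
  simp [triangleMap_eq_sum, bary_triVertex]

omit [IsManifold (𝓡 2) ∞ M] in
theorem IsFace.apply_triVertex (hf : IsFace Δ Φ a ψ V) (i : Fin 3) :
    ψ (triVertex i) = Φ (Pi.single (a i) 1) := by
  rw [hf.eq _ (triVertex_mem i), triangleMap_triVertex]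

omit [IsManifold (𝓡 2) ∞ M] in
theorem IsFace.triVertex_mem_inter (hf : IsFace Δ Φ a ψ V) {p : M}
    (hp : Φ (Pi.single (a i) 1) = p) :
    triVertex i ∈ V ∩ ψ ⁻¹' (extChartAt (𝓡 2) p).source :=
  ⟨hf.subset (triVertex_mem i), by
    rw [Set.mem_preimage, hf.apply_triVertex, hp]; exact mem_extChartAt_source p⟩

theorem IsFace.vertexAngle_eq (hf : IsFace Δ Φ a ψ V) {p : M} (hp : Φ (Pi.single (a i) 1) = p) :
    vertexAngle (paramField h ψ) i = metricAngle (inChart h p (extChartAt (𝓡 2) p p))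
      (fderiv ℝ (extChartAt (𝓡 2) p ∘ ψ) (triVertex i) (triVertex (i + 1) - triVertex i))
      (fderiv ℝ (extChartAt (𝓡 2) p ∘ ψ) (triVertex i) (triVertex (i + 2) - triVertex i)) := by
  have hm := hf.triVertex_mem_inter hp
  have hv : (extChartAt (𝓡 2) p ∘ ψ) (triVertex i) = extChartAt (𝓡 2) p p := by
    rw [Function.comp_apply, hf.apply_triVertex, hp]
  rw [vertexAngle, paramField_eq_pullMetric (hf.isParamOn.mdifferentiableAt hm.1) hm.2,
    metricAngle, metricAngle]
  simp only [pullMetric_apply, hv]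

theorem IsFace.det2_sectors_ne_zero (hh : IsRiemannianField h) (hf : IsFace Δ Φ a ψ V) {p : M}
    (hp : Φ (Pi.single (a i) 1) = p) :
    det2 (fderiv ℝ (extChartAt (𝓡 2) p ∘ ψ) (triVertex i) (triVertex (i + 1) - triVertex i))
      (fderiv ℝ (extChartAt (𝓡 2) p ∘ ψ) (triVertex i) (triVertex (i + 2) - triVertex i)) ≠ 0 := by
  rw [det2_map]
  refine mul_ne_zero (det2_ne_zero_of_injective
    ((hf.isParamOn.isImmersionOn hh p).injective _ (hf.triVertex_mem_inter hp))) ?_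
  fin_cases i <;> simp [det2, triVertex]

theorem baryLin_sector {j : Fin 3} (hj : bary j (triVertex i) = 0) {r t : ℝ} (hr : 0 < r)
    (ht : 0 < t) : 0 < baryLin j (r • (triVertex (i + 1) - triVertex i) +
      t • (triVertex (i + 2) - triVertex i)) := by
  rw [map_add, map_smul, map_smul, baryLin_sub, baryLin_sub]
  rw [bary_triVertex] at hj
  fin_cases i <;> fin_cases j <;> simp_all

/-- The tangent sectors of distinct triangles at a common vertex are disjoint, because a vector in
both sectors would point into the interiors of both triangles. -/
theorem IsFace.image_eq_of_sectors (hΦ : IsSmoothTriangulation M Δ Φ) (hh : IsRiemannianField h)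
    (hf : IsFace Δ Φ a ψ V) (hf' : IsFace Δ Φ a' ψ' V') {p : M} (hp : Φ (Pi.single (a i) 1) = p)
    (hp' : Φ (Pi.single (a' i') 1) = p) {r t r' t' : ℝ} (hr : 0 < r) (ht : 0 < t) (hr' : 0 < r')
    (ht' : 0 < t')
    (heq : r • fderiv ℝ (extChartAt (𝓡 2) p ∘ ψ) (triVertex i) (triVertex (i + 1) - triVertex i) +
        t • fderiv ℝ (extChartAt (𝓡 2) p ∘ ψ) (triVertex i) (triVertex (i + 2) - triVertex i) =
      r' • fderiv ℝ (extChartAt (𝓡 2) p ∘ ψ') (triVertex i')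
          (triVertex (i' + 1) - triVertex i') +
        t' • fderiv ℝ (extChartAt (𝓡 2) p ∘ ψ') (triVertex i')
          (triVertex (i' + 2) - triVertex i')) :
    Finset.univ.image a = Finset.univ.image a' := by
  have hm' := hf'.triVertex_mem_inter hp'
  obtain ⟨τ, W, O, hzW, -, -, -, hτ, hτz, hτψ, -⟩ :=
    hf.isParamOn.exists_transition hh hf'.isParamOn (hf.subset (triVertex_mem i))
      (hf'.subset (triVertex_mem i')) (by rw [hf.apply_triVertex, hf'.apply_triVertex, hp, hp'])
  have hX' := hf'.isParamOn.isImmersionOn hh p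
  have h3 : extChartAt (𝓡 2) p ∘ ψ =ᶠ[𝓝 (triVertex i)] (extChartAt (𝓡 2) p ∘ ψ') ∘ τ := by
    filter_upwards [hτ.mem_nhds hzW] with y hy
    simp [hτψ y hy]
  have h4 := hX'.hasFDerivAt hm'
  rw [← hτz] at h4
  have h5 := h4.comp _ (hτ.hasFDerivAt hzW)
  rw [hτz] at h5
  rw [h3.fderiv_eq, h5.fderiv, ← map_smul, ← map_smul, ← map_add, ← map_smul, ← map_smul,
    ← map_add, ContinuousLinearMap.comp_apply] at heq
  have h6 := hX'.injective _ hm' heq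
  refine hf.image_eq_of_fderiv hΦ hf' (triVertex_mem i) (triVertex_mem i') (hτ.mem_nhds hzW)
    (hτ.hasFDerivAt hzW).differentiableAt hτz hτψ (fun j hj => baryLin_sector hj hr ht)
    fun j hj => ?_
  rw [h6]
  exact baryLin_sector hj hr' ht'

end Vertices

/-! ### The Euler characteristic of a positively curved surface -/

section Euler

variable {k : ℕ} {M : Type u} [TopologicalSpace M] [ChartedSpace (Euc 2) M]
  {Δ : Finset (Finset (Fin k))} {Φ : (Fin k → ℝ) → M}
  {h : ∀ q : M, TangentSpace (𝓡 2) q →L[ℝ] TangentSpace (𝓡 2) q →L[ℝ] ℝ}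

theorem exists_image_eq {t : Finset (Fin k)} (ht : t.card = 3) :
    ∃ a : Fin 3 → Fin k, Function.Injective a ∧ Finset.univ.image a = t := by
  refine ⟨fun j => ((t.equivFinOfCardEq ht).symm j : Fin k),
    Subtype.val_injective.comp (t.equivFinOfCardEq ht).symm.injective, ?_⟩
  ext l
  simp only [Finset.mem_image, Finset.mem_univ, true_and]
  constructor
  · rintro ⟨j, rfl⟩
    exact ((t.equivFinOfCardEq ht).symm j).2
  · intro hl
    exact ⟨t.equivFinOfCardEq ht ⟨l, hl⟩, by simp⟩

variable [IsManifold (𝓡 2) ∞ M]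

theorem IsSmoothTriangulation.exists_isFace (hΦ : IsSmoothTriangulation M Δ Φ)
    {t : Finset (Fin k)} (ht : t ∈ Δ) : ∃ (a : Fin 3 → Fin k) (ψ : Euc 2 → M) (V : Set (Euc 2)),
      IsFace Δ Φ a ψ V ∧ Finset.univ.image a = t := by
  obtain ⟨a, ha, rfl⟩ := exists_image_eq (hΦ.card_eq t ht)
  obtain ⟨U, ψ, hU, htU, hψ, hinj, heq⟩ := hΦ.smooth a ha ht
  obtain ⟨V, -, hV, hUV⟩ := isParamOn_interior hU hψ
  exact ⟨a, ψ, V, ⟨ha, ht, hV, fun z hz => hUV z (htU hz) (hinj z hz), heq⟩, rfl⟩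

/-- Summing the Gauss–Bonnet inequality over the triangles: the angles add up to at most `2π` at
each vertex, and the geodesic curvatures of the sides cancel in pairs, which also gives `3F = 2E`.
-/
theorem IsSmoothTriangulation.eulerChar_pos [T2Space M] [Nonempty M]
    (hΦ : IsSmoothTriangulation M Δ Φ) (hh : IsRiemannianField h)
    (hK : ∀ p, 0 < sectionalCurvature h p (stdVec 0 : Euc 2) (stdVec 1 : Euc 2)) :
    0 < eulerChar Δ := by
  obtain ⟨t₀, ht₀⟩ : Δ.Nonempty := by
    obtain ⟨p⟩ := ‹Nonempty M›
    obtain ⟨w, ⟨-, t, ht, -⟩, -⟩ := hΦ.bijOn.surjOn (Set.mem_univ p)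
    exact ⟨t, ht⟩
  have : Nonempty (Fin k) := by
    obtain ⟨a, -⟩ := exists_image_eq (hΦ.card_eq t₀ ht₀)
    exact ⟨a 0⟩
  choose! a ψ V hf ha using fun t (ht : t ∈ Δ) => hΦ.exists_isFace ht
  set ang : Finset (Fin k) × Fin 3 → ℝ := fun j => vertexAngle (paramField h (ψ j.1)) j.2 with hang
  set κ : Finset (Fin k) × Fin 3 → ℝ := fun j => sideTurning (paramField h (ψ j.1)) j.2 with hκ
  set J : Finset (Finset (Fin k) × Fin 3) := Δ ×ˢ Finset.univ with hJ
  set VS := Δ.biUnion id with hVS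
  set ES := Δ.biUnion (Finset.powersetCard 2) with hES
  have hmem : ∀ t ∈ Δ, ∀ i, a t i ∈ t := fun t ht i => by
    have hi := Finset.mem_image_of_mem (a t) (Finset.mem_univ i)
    rwa [ha t ht] at hi
  have hex : ∀ t ∈ Δ, ∀ l ∈ t, ∃ i, a t i = l := fun t ht l hl => by
    rw [← ha t ht] at hl
    obtain ⟨i, -, hi⟩ := Finset.mem_image.1 hl
    exact ⟨i, hi⟩
  have hJΔ : ∀ {j}, j ∈ J → j.1 ∈ Δ := fun hj => (Finset.mem_product.1 hj).1
  have hJV : ∀ j ∈ J, a j.1 j.2 ∈ VS := fun j hj =>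
    Finset.mem_biUnion.2 ⟨j.1, hJΔ hj, hmem _ (hJΔ hj) _⟩
  have hJE : ∀ j ∈ J, j.1.erase (a j.1 j.2) ∈ ES := fun j hj =>
    Finset.mem_biUnion.2 ⟨j.1, hJΔ hj, Finset.mem_powersetCard.2 ⟨Finset.erase_subset _ _, by
      rw [Finset.card_erase_of_mem (hmem _ (hJΔ hj) _), hΦ.card_eq _ (hJΔ hj)]⟩⟩
  -- the Gauss–Bonnet inequality of each triangle
  have hGB : ∑ t ∈ Δ, (Real.pi + ∑ i, κ (t, i)) < ∑ t ∈ Δ, ∑ i, ang (t, i) := by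
    refine Finset.sum_lt_sum_of_nonempty ⟨t₀, ht₀⟩ fun t ht => ?_
    refine ((hf t ht).isParamOn.isMetricOn hh).pi_add_sideTurning_lt (hf t ht).subset fun y hy => ?_
    rw [← (hf t ht).isParamOn.sectionalCurvature_eq hh ((hf t ht).subset hy)]
    exact hK _
  rw [Finset.sum_add_distrib, ← Finset.sum_product', ← Finset.sum_product', ← hJ,
    Finset.sum_const, nsmul_eq_mul] at hGB
  -- the angles around the vertices
  have hV : ∑ j ∈ J, ang j ≤ VS.card * (2 * Real.pi) := by
    rw [← Finset.sum_fiberwise_of_maps_to hJV, ← nsmul_eq_mul]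
    refine Finset.sum_le_card_nsmul _ _ _ fun v _ => ?_
    set p := Φ (Pi.single v 1) with hp
    have hvp : ∀ j ∈ J.filter (fun j => a j.1 j.2 = v), Φ (Pi.single (a j.1 j.2) 1) = p :=
      fun j hj => by rw [(Finset.mem_filter.1 hj).2]
    have hjΔ : ∀ j ∈ J.filter (fun j => a j.1 j.2 = v), j.1 ∈ Δ := fun j hj =>
      hJΔ (Finset.mem_filter.1 hj).1
    rw [Finset.sum_congr rfl fun j hj => (hf j.1 (hjΔ j hj)).vertexAngle_eq (hvp j hj)]
    refine sum_metricAngle_le_two_pi ((hh p).symm _ (mem_extChartAt_target p))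
      ((hh p).pos _ (mem_extChartAt_target p)) _ _ _
      (fun j hj => (hf j.1 (hjΔ j hj)).det2_sectors_ne_zero hh (hvp j hj)) ?_
    intro j hj j' hj' hne r t r' t' hr ht hr' ht' heq
    have h1 := (hf j.1 (hjΔ j hj)).image_eq_of_sectors hΦ hh (hf j'.1 (hjΔ j' hj')) (hvp j hj)
      (hvp j' hj') hr ht hr' ht' heq
    rw [ha _ (hjΔ j hj), ha _ (hjΔ j' hj')] at h1
    refine hne (Prod.ext h1 ((hf j.1 (hjΔ j hj)).injective ?_))
    rw [(Finset.mem_filter.1 hj).2]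
    conv_rhs => rw [h1]
    exact (Finset.mem_filter.1 hj').2.symm
  -- every side belongs to exactly two triangles
  have hflag : ∀ t ∈ Δ, ∀ e ⊆ t, e.card = 2 → ∃ i, t.erase (a t i) = e := by
    intro t ht e het he
    have h3 := hΦ.card_eq t ht
    obtain ⟨l, hl, hle⟩ := Finset.exists_mem_notMem_of_card_lt_card (s := e) (t := t) (by omega)
    obtain ⟨i, rfl⟩ := hex t ht l hl
    refine ⟨i, (Finset.eq_of_subset_of_card_le (fun x hx => Finset.mem_erase.2
      ⟨by rintro rfl; exact hle hx, het hx⟩) ?_).symm⟩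
    rw [Finset.card_erase_of_mem hl, h3, he]
  have hE : ∀ e ∈ ES, ∃ j j', j ≠ j' ∧ J.filter (fun j => j.1.erase (a j.1 j.2) = e) = {j, j'} ∧
      κ j + κ j' = 0 := by
    intro e he
    obtain ⟨t₁, ht₁, he⟩ := Finset.mem_biUnion.1 he
    obtain ⟨het, hecard⟩ := Finset.mem_powersetCard.1 he
    obtain ⟨x, y, hxy, rfl⟩ := Finset.card_eq_two.1 hecard
    set F := J.filter (fun j => j.1.erase (a j.1 j.2) = {x, y}) with hF
    have hFΔ : ∀ j ∈ F, j.1 ∈ Δ := fun j hj => hJΔ (Finset.mem_filter.1 hj).1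
    have hsides : ∀ j ∈ F, ∃ b c, j.2 ≠ b ∧ j.2 ≠ c ∧ b ≠ c ∧ a j.1 b = x ∧ a j.1 c = y := by
      intro j hj
      have hj1 := (Finset.mem_filter.1 hj).2
      have hx : x ∈ j.1.erase (a j.1 j.2) := by rw [hj1]; simp
      have hy : y ∈ j.1.erase (a j.1 j.2) := by rw [hj1]; simp
      obtain ⟨b, hb⟩ := hex _ (hFΔ j hj) x (Finset.mem_of_mem_erase hx)
      obtain ⟨c, hc⟩ := hex _ (hFΔ j hj) y (Finset.mem_of_mem_erase hy)
      refine ⟨b, c, ?_, ?_, ?_, hb, hc⟩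
      · rintro rfl
        exact Finset.ne_of_mem_erase hx hb.symm
      · rintro rfl
        exact Finset.ne_of_mem_erase hy hc.symm
      · rintro rfl
        exact hxy (hb.symm.trans hc)
    choose! b c hib hic hbc hb hc using hsides
    have hdiff : ∀ j ∈ F, ∀ j' ∈ F, j ≠ j' →
        Finset.univ.image (a j.1) ≠ Finset.univ.image (a j'.1) := by
      intro j hj j' hj' hne h1
      rw [ha _ (hFΔ j hj), ha _ (hFΔ j' hj')] at h1
      refine hne (Prod.ext h1 ?_)
      have h2 := (Finset.mem_filter.1 hj).2.trans (Finset.mem_filter.1 hj').2.symm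
      rw [← h1] at h2
      by_contra hij
      have h3 : a j.1 j.2 ∈ j.1.erase (a j.1 j'.2) := Finset.mem_erase.2
        ⟨(hf _ (hFΔ j hj)).injective.ne hij, hmem _ (hFΔ j hj) _⟩
      rw [← h2] at h3
      exact Finset.notMem_erase _ _ h3
    set p := Φ ((1 - (1 / 2 : ℝ)) • Pi.single x 1 + (1 / 2 : ℝ) • Pi.single y 1) with hp
    have hmid : ∀ j ∈ F, ψ j.1 (sidePoint (b j) (c j) (1 / 2)) = p := by
      intro j hj
      rw [(hf _ (hFΔ j hj)).eq _ (sidePoint_mem (by norm_num)), triangleMap_sidePoint, hb j hj,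
        hc j hj]
    have hsign := fun j (hj : j ∈ F) j' (hj' : j' ∈ F) (hne : j ≠ j') =>
      (hf _ (hFΔ j hj)).side_sign hΦ hh (hf _ (hFΔ j' hj')) (hdiff j hj j' hj' hne) (hib j hj)
        (hic j hj) (hbc j hj) (hib j' hj') (hic j' hj') (hbc j' hj')
        ((hb j hj).trans (hb j' hj').symm) ((hc j hj).trans (hc j' hj').symm) (hmid j hj)
    have hle : F.card ≤ 2 := by
      by_contra hlt
      obtain ⟨j₁, h1, j₂, h2, j₃, h3, h12, h13, h23⟩ := Finset.two_lt_card.1 (not_le.1 hlt)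
      -- three triangles cannot lie on pairwise opposite sides of an edge
      have hopp : ∀ r s t : ℝ, r * s < 0 → r * t < 0 → s * t < 0 → False := fun r s t e1 e2 e3 =>
        absurd (mul_neg_of_pos_of_neg (mul_pos_of_neg_of_neg e1 e2) e3)
          (by nlinarith [sq_nonneg (r * s * t)])
      exact hopp _ _ _ (hsign _ h1 _ h2 h12) (hsign _ h1 _ h3 h13) (hsign _ h2 _ h3 h23)
    have hge : 1 < F.card := by
      obtain ⟨i₁, hi₁⟩ := hflag t₁ ht₁ _ het hecard
      have h1 : (t₁, i₁) ∈ F :=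
        Finset.mem_filter.2 ⟨Finset.mem_product.2 ⟨ht₁, Finset.mem_univ _⟩, hi₁⟩
      obtain ⟨t₂, ht₂, hne, hx, hy⟩ := (hf _ ht₁).exists_adjacent hΦ hh (hib _ h1) (hic _ h1)
        (hbc _ h1)
      rw [hb _ h1] at hx
      rw [hc _ h1] at hy
      rw [ha _ ht₁] at hne
      obtain ⟨i₂, hi₂⟩ := hflag t₂ ht₂ {x, y} (by
        intro l hl
        rcases Finset.mem_insert.1 hl with rfl | hl
        · exact hx
        · rw [Finset.mem_singleton.1 hl]; exact hy) hecard
      have h2 : (t₂, i₂) ∈ F :=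
        Finset.mem_filter.2 ⟨Finset.mem_product.2 ⟨ht₂, Finset.mem_univ _⟩, hi₂⟩
      exact Finset.one_lt_card.2 ⟨_, h1, _, h2, fun h0 => hne (Prod.ext_iff.1 h0).1.symm⟩
    obtain ⟨j, j', hjj, hFj⟩ := Finset.card_eq_two.1 (le_antisymm hle hge)
    have hj : j ∈ F := by rw [hFj]; simp
    have hj' : j' ∈ F := by rw [hFj]; simp
    exact ⟨j, j', hjj, hFj, (hf _ (hFΔ j hj)).sideTurning_add hΦ hh (hf _ (hFΔ j' hj'))
      (hdiff j hj j' hj' hjj) (hib j hj) (hic j hj) (hbc j hj) (hib j' hj') (hic j' hj')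
      (hbc j' hj') ((hb j hj).trans (hb j' hj').symm) ((hc j hj).trans (hc j' hj').symm)⟩
  have hκ0 : ∑ j ∈ J, κ j = 0 := by
    rw [← Finset.sum_fiberwise_of_maps_to hJE]
    refine Finset.sum_eq_zero fun e he => ?_
    obtain ⟨j, j', hne, hF, h0⟩ := hE e he
    rw [hF, Finset.sum_pair hne, h0]
  have hcard : Δ.card * 3 = ES.card * 2 := by
    have h1 := Finset.card_eq_sum_card_fiberwise (f := fun j => j.1.erase (a j.1 j.2)) (s := J)
      (t := ES) fun j hj => hJE j (Finset.mem_coe.1 hj)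
    rw [Finset.sum_congr rfl fun e he => (show _ = 2 by
      obtain ⟨j, j', hne, hF, -⟩ := hE e he
      rw [hF, Finset.card_pair hne]), Finset.sum_const, smul_eq_mul, hJ, Finset.card_product] at h1
    simpa using h1
  rw [hκ0, add_zero] at hGB
  have h1 : (Δ.card : ℝ) < VS.card * 2 := by
    have := hGB.trans_le hV
    have hpi := Real.pi_pos
    by_contra h0
    have := mul_le_mul_of_nonneg_right (not_lt.1 h0) hpi.le
    linarith
  -- `V - E + F = V - F / 2` by `hcard`
  have h2 : Δ.card < VS.card * 2 := by exact_mod_cast h1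
  rw [eulerChar, ← hVS, ← hES]
  omega

end Euler

/-- The Gauss equation makes the induced metric positively curved, so that the Euler characteristic
is positive. -/
theorem HasGenus.not_isTotallyUmbilic {n : ℕ} {N : Type u} [TopologicalSpace N]
    [ChartedSpace (Euc n) N] [IsManifold (𝓡 n) ∞ N] {g : Metric n N}
    (hg : PositiveSectionalCurvature g) {M : Type v} [TopologicalSpace M] [T2Space M]
    [ConnectedSpace M] [ChartedSpace (Euc 2) M] [IsManifold (𝓡 2) ∞ M] {γ : ℕ} (hγ : 1 ≤ γ)
    (hM : HasGenus M γ) {x : M → N} (hx : IsSmoothImmersion 2 n x) : ¬ IsTotallyUmbilic 2 g x := by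
  intro hu
  obtain ⟨-, k, Δ, Φ, hΦ, hχ⟩ := hM
  have := hΦ.eulerChar_pos (isRiemannianField_firstForm g hx)
    (gaussCurvature_pos_of_isTotallyUmbilic hg hx hu)
  omega

end Willmore

end

universe u v

theorem theorem3p1 (n : ℕ) (hn : 3 ≤ n)
    (N : Type u) [TopologicalSpace N] [T2Space N] [ChartedSpace (Willmore.Euc n) N]
    [IsManifold (𝓡 n) ∞ N] (g : Willmore.Metric n N) :
    -- (i)
    (∀ (T : Type v) [TopologicalSpace T] [T2Space T] [CompactSpace T] [ConnectedSpace T]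
        [MeasurableSpace T] [BorelSpace T]
        [ChartedSpace (Willmore.Euc 2) T] [IsManifold (𝓡 2) ∞ T],
        Willmore.IsTorus T → ∀ x : T → N, Willmore.IsSmoothImmersion 2 n x →
          MeasureTheory.Integrable (Willmore.willmoreDensity g x) (Willmore.inducedVolume g x) ∧
          0 ≤ Willmore.willmore g x ∧
          (Willmore.willmore g x = 0 ↔ Willmore.IsTotallyUmbilic 2 g x)) ∧
    -- (ii)
    (Willmore.PositiveSectionalCurvature g →
      (∀ (M : Type v) [TopologicalSpace M] [T2Space M] [CompactSpace M] [ConnectedSpace M]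
        [ChartedSpace (Willmore.Euc 2) M] [IsManifold (𝓡 2) ∞ M] (γ : ℕ),
        1 ≤ γ → Willmore.HasGenus M γ → ∀ x : M → N, Willmore.IsSmoothImmersion 2 n x →
          ¬ Willmore.IsTotallyUmbilic 2 g x) ∧
      (∀ (T : Type v) [TopologicalSpace T] [T2Space T] [CompactSpace T] [ConnectedSpace T]
        [MeasurableSpace T] [BorelSpace T]
        [ChartedSpace (Willmore.Euc 2) T] [IsManifold (𝓡 2) ∞ T],
        Willmore.IsTorus T → ∀ x : T → N, Willmore.IsSmoothImmersion 2 n x →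
          0 < Willmore.willmore g x)) ∧
    -- (iii)
    (Willmore.NonnegativeSectionalCurvature g →
      ∀ (T : Type v) [TopologicalSpace T] [T2Space T] [CompactSpace T] [ConnectedSpace T]
        [ChartedSpace (Willmore.Euc 2) T] [IsManifold (𝓡 2) ∞ T],
        Willmore.IsTorus T → ∀ x : T → N, Willmore.IsSmoothImmersion 2 n x →
          Willmore.IsTotallyUmbilic 2 g x →
            Willmore.IsFlat g x ∧ Willmore.IsTotallyGeodesic 2 g x) := by
  refine ⟨?_, fun hg => ⟨?_, ?_⟩, fun hg => ?_⟩
  · intro T _ _ _ _ _ _ _ _ _ x hx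
    exact ⟨Willmore.integrable_willmoreDensity g hx, Willmore.willmore_nonneg g hx,
      Willmore.willmore_eq_zero_iff g hx⟩
  · intro M _ _ _ _ _ _ γ hγ hM x hx
    exact hM.not_isTotallyUmbilic hg hγ hx
  · intro T _ _ _ _ _ _ _ _ hT x hx
    exact (Willmore.willmore_nonneg g hx).lt_of_ne' fun h0 =>
      hT.not_isTotallyUmbilic hg hx ((Willmore.willmore_eq_zero_iff g hx).1 h0)
  · intro T _ _ _ _ _ _ hT x hx hu
    exact hT.isFlat_and_isTotallyGeodesic hg hx hu
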